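/- Let $n\ge 1$, and let $\gamma$ be a Radon measure on $\mathbb R^n$ that is rotation invariant, i.e. $\gamma(TA)=\gamma(A)$ for every Borel set $A$ and every orthogonal transformation $T$, and log-concave, i.e. $$\gamma(\lambda A+(1-\lambda)B)\ge \gamma(A)^{\lambda}\gamma(B)^{1-\lambda}$$ for every $\lambda\in[0,1]$ and all non-empty Borel sets $A,B\subset\mathbb R^n$ for which $\lambda A+(1-\lambda)B$ is Borel. For a convex body $K$ (a compact convex set with non-empty interior) let $h_K(u)=\sup_{x\in K}\langle x,u\rangle$, $u\in\mathbb S^{n-1}$, be its support function, and for convex bodies $K,L$ containing the origin in their interior put $$K^{\lambda}L^{1-\lambda}=\{x\in\mathbb R^n:\ \langle x,u\rangle\le h_K(u)^{\lambda}h_L(u)^{1-\lambda}\ \text{ for all } u\in\mathbb S^{n-1}\}.$$ Let $R\in(0,\infty)$ and let $\varphi\in C^2(\mathbb S^{n-1})$ be even and strictly positive. Then there exists $a>0$ such that for every $\epsilon\in(0,a)$ there is exactly one convex body with support function $R\varphi^{\epsilon}$, and such that for all $\epsilon_1,\epsilon_2\in(0,a)$ and all $\lambda\in[0,1]$ $$\gamma(K_1^{\lambda}K_2^{1-\lambda})\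 \ge\ \gamma(K_1)^{\lambda}\,\gamma(K_2)^{1-\lambda},$$ where $K_i$ is the convex body with support function $R\varphi^{\epsilon_i}$, $i=1,2$. -/

import Mathlib

open scoped Pointwise Manifold ContDiff
open MeasureTheory

/-- The support function `h_K(u) = sup_{x ∈ K} ⟨x, u⟩`, for unit vectors `u`. -/
noncomputable def supportFn {n : ℕ} (K : Set (EuclideanSpace ℝ (Fin n)))
    (u : Metric.sphere (0 : EuclideanSpace ℝ (Fin n)) 1) : ℝ :=
  sSup ((fun x => inner ℝ x (u : EuclideanSpace ℝ (Fin n))) '' K)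

/-- A convex body: a compact convex set with non-empty interior. -/
structure IsConvexBody {n : ℕ} (K : Set (EuclideanSpace ℝ (Fin n))) : Prop where
  convex : Convex ℝ K
  isCompact : IsCompact K
  interior_nonempty : (interior K).Nonempty

/-- `K` is a convex body whose support function is `h`. -/
def IsBodyWithSupport {n : ℕ} (K : Set (EuclideanSpace ℝ (Fin n)))
    (h : Metric.sphere (0 : EuclideanSpace ℝ (Fin n)) 1 → ℝ) : Prop :=
  IsConvexBody K ∧ ∀ u, supportFn K u = h u

/-- The geometric average `K^lam L^(1-lam)`: all `x` with
`⟨x, u⟩ ≤ h_K(u)^lam h_L(u)^(1-lam)` for every unit vector `u`. -/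
def geomAverage {n : ℕ} (lam : ℝ) (K L : Set (EuclideanSpace ℝ (Fin n))) :
    Set (EuclideanSpace ℝ (Fin n)) :=
  {x | ∀ u : Metric.sphere (0 : EuclideanSpace ℝ (Fin n)) 1,
    inner ℝ x (u : EuclideanSpace ℝ (Fin n)) ≤ supportFn K u ^ lam * supportFn L u ^ (1 - lam)}

/-- A log-concave measure: `γ(lam A + (1-lam) B) ≥ γ(A)^lam γ(B)^(1-lam)` for all `lam ∈ [0,1]`
and all non-empty measurable `A`, `B` whose combination `lam A + (1-lam) B` is measurable. -/
def IsLogConcaveMeasure {n : ℕ} (γ : Measure (EuclideanSpace ℝ (Fin n))) : Prop :=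
  ∀ lam ∈ Set.Icc (0 : ℝ) 1, ∀ A B : Set (EuclideanSpace ℝ (Fin n)),
    A.Nonempty → B.Nonempty → MeasurableSet A → MeasurableSet B →
    MeasurableSet (lam • A + (1 - lam) • B) →
    γ A ^ lam * γ B ^ (1 - lam) ≤ γ (lam • A + (1 - lam) • B)

/-- A rotation invariant measure: `γ(TA) = γ(A)` for every measurable `A` and every linear isometry
`T` of the space (in dimension one this is symmetry, as for a density of the form `f(|x|)`). -/
def IsRotationInvariant {n : ℕ} (γ : Measure (EuclideanSpace ℝ (Fin n))) : Prop :=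
  ∀ T : EuclideanSpace ℝ (Fin n) ≃ₗᵢ[ℝ] EuclideanSpace ℝ (Fin n),
    ∀ A : Set (EuclideanSpace ℝ (Fin n)), MeasurableSet A → γ (T '' A) = γ A

/-! Let `n` be the dimension and write `φ = exp g`, so the bodies have support functions `R exp(ε
g)`. A weighted geometric mean of two of these functions is again in the family, with `ε` averaged
(`geomAverage_eq_wulff`). The claim is therefore that the measure of the body is log-concave in `ε`
near `0`. By rotation invariance this measure is the mean over directions `θ` of `H(t_ε(θ))`. Here
`H(t)` is the mass of the centred ball of radius `R exp t`, and `t_ε` is `logRadial`, the logarithm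
of the radial function divided by `R` (`measure_wulff`).

Two expansions enter. First, `H` is log-concave with decreasing logarithmic slopes `p` in `[0, n]`
(`exists_logConcave_radial`, `exists_isRadialProfile`), so it lies below its tangent exponentials
and no second derivative of `H` is needed. Second, `t_ε(θ)` is the minimum over unit `u` of `ε g(u)
- log ⟨θ, u⟩`. Hence it is concave in `ε`, equals `ε g(θ)` to first order, and has second derivative
essentially at most `-|∇g(θ)|²` (`exists_logRadial_bounds`). To second order, log-concavity then
reduces to `Var(p g) ≤ E(p |∇g|²)`, which `integral_mul_exp_le` makes quantitative.

The density of `γ` may jump, so `p` may jump at `0`. As `ε` tends to `0`, the slope at `t_ε(θ)`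
becomes a function `P` equal to `p(0-)` where `g < 0` and to `p(0+)` where `g > 0`. The function `ψ
= P g` is even and Lipschitz, with gradient bounded by `P |∇g|`. The spectral gap `2n` for even
functions on the sphere (`poincare`) gives `2n Var ψ ≤ E(P² |∇g|²) ≤ n E(P |∇g|²)`. A factor two is
left over, and it absorbs all error terms unless `ψ` is constant (`kink_const_or_variance_lt`).

The gap itself comes from one dimension. On a great circle an even function is `π`-periodic, and
Parseval bounds the mean square of its difference at angle `α` by `sin² α` times the energy.
Averaging over all orthonormal pairs, and then over the second point, produces the constant `2n`.

The degenerate cases are treated directly. If `p(0-) = 0`, then `H` is concave near `0`. If `ψ` is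
constant, then either `g` is constant and the bodies are balls, or `p(0+) = 0 ≤ g` and all the
bodies have the same mass. An atom at the origin forces `γ` to be concentrated there. -/

/-- The orthogonal group of a Euclidean space, as a compact group of operators. -/
noncomputable abbrev OrthGroup (E : Type*) [NormedAddCommGroup E] [InnerProductSpace ℝ E]
    [FiniteDimensional ℝ E] := unitary (E →L[ℝ] E)

/-! ### Haar averages over the orthogonal group. -/

namespace OrthGroup

variable {E : Type*} [NormedAddCommGroup E] [InnerProductSpace ℝ E] [FiniteDimensional ℝ E]

instance : CompactSpace (OrthGroup E) := by
  have : ProperSpace (E →L[ℝ] E) := FiniteDimensional.proper_real _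
  refine isCompact_iff_compactSpace.1 ?_
  refine Metric.isCompact_of_isClosed_isBounded isClosed_unitary ?_
  refine (Metric.isBounded_closedBall (x := (0 : E →L[ℝ] E)) (r := 1)).subset fun T hT => ?_
  rw [mem_closedBall_zero_iff]
  refine T.opNorm_le_bound zero_le_one fun x => ?_
  rw [one_mul]
  exact (Unitary.norm_map (⟨T, hT⟩ : OrthGroup E) x).le

/-- The action of an orthogonal transformation on a vector. -/
def act (T : OrthGroup E) (x : E) : E := (T : E →L[ℝ] E) x

/-- The orthogonal transformation given by a linear isometry. -/
noncomputable def ofIsometry (e : E ≃ₗᵢ[ℝ] E) : OrthGroup E :=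
  Unitary.linearIsometryEquiv.symm e

@[simp] lemma act_ofIsometry (e : E ≃ₗᵢ[ℝ] E) (x : E) : act (ofIsometry e) x = e x := rfl

@[simp] lemma act_mul (S T : OrthGroup E) (x : E) : act (S * T) x = act S (act T x) := rfl

@[simp] lemma norm_act (T : OrthGroup E) (x : E) : ‖act T x‖ = ‖x‖ := Unitary.norm_map T x

@[simp] lemma inner_act (T : OrthGroup E) (x y : E) :
    inner ℝ (act T x) (act T y) = inner ℝ x y := Unitary.inner_map_map T x y

@[simp] lemma act_add (T : OrthGroup E) (x y : E) : act T (x + y) = act T x + act T y :=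
  map_add (T : E →L[ℝ] E) x y

@[simp] lemma act_smul (T : OrthGroup E) (c : ℝ) (x : E) : act T (c • x) = c • act T x :=
  map_smul (T : E →L[ℝ] E) c x

@[simp] lemma act_neg (T : OrthGroup E) (x : E) : act T (-x) = -act T x :=
  map_neg (T : E →L[ℝ] E) x

lemma continuous_act : Continuous fun p : OrthGroup E × E => act p.1 p.2 :=
  (continuous_subtype_val.comp continuous_fst).clm_apply continuous_snd

@[fun_prop]
lemma continuous_act' {X : Type*} [TopologicalSpace X] {f : X → OrthGroup E} {g : X → E}
    (hf : Continuous f) (hg : Continuous g) : Continuous fun x => act (f x) (g x) :=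
  continuous_act.comp (hf.prodMk hg)

lemma exists_act_eq {x y : E} (h : ‖x‖ = ‖y‖) : ∃ S : OrthGroup E, act S x = y :=
  ⟨ofIsometry ((ℝ ∙ (x - y))ᗮ.reflection), by
    rw [act_ofIsometry]; exact Submodule.reflection_sub h⟩

/-- Two reflections suffice: the second one swaps the images of the second vectors, and its mirror
contains `x'` because both images are orthogonal to `x'`. -/
lemma exists_act_eq_pair {x y x' y' : E} (hx : ‖x‖ = ‖x'‖) (hy : ‖y‖ = ‖y'‖)
    (h : inner ℝ x y = 0) (h' : inner ℝ x' y' = 0) :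
    ∃ S : OrthGroup E, act S x = x' ∧ act S y = y' := by
  obtain ⟨S, hS⟩ := exists_act_eq hx
  have h1 : ‖act S y‖ = ‖y'‖ := by simp [hy]
  have h2 : inner ℝ x' (act S y) = 0 := by rw [← hS, inner_act, h]
  refine ⟨ofIsometry ((ℝ ∙ (act S y - y'))ᗮ.reflection) * S, ?_, ?_⟩
  · rw [act_mul, hS, act_ofIsometry]
    apply Submodule.reflection_mem_subspace_eq_self
    rw [Submodule.mem_orthogonal_singleton_iff_inner_left, inner_sub_right, h2, h', sub_zero]
  · rw [act_mul, act_ofIsometry]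
    exact Submodule.reflection_sub h1

/-- The invariant probability measure on the orthogonal group. -/
noncomputable def haar : Measure (OrthGroup E) := Measure.haarMeasure ⊤

instance : Measure.IsHaarMeasure (haar : Measure (OrthGroup E)) := by
  unfold haar; infer_instance

instance : IsProbabilityMeasure (haar : Measure (OrthGroup E)) :=
  ⟨by simpa [haar] using Measure.haarMeasure_self (K₀ := (⊤ : TopologicalSpace.PositiveCompacts (OrthGroup E)))⟩

/-- A compact group is unimodular: a right translate of the Haar probability measure is again one,
and that measure is unique. -/
instance : Measure.IsMulRightInvariant (haar : Measure (OrthGroup E)) where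
  map_mul_right_eq_self g := by
    have : IsProbabilityMeasure (Measure.map (· * g) (haar : Measure (OrthGroup E))) :=
      Measure.isProbabilityMeasure_map (measurable_mul_const g).aemeasurable
    exact Measure.isHaarMeasure_eq_of_isProbabilityMeasure _ _

lemma lintegral_act_eq {x y : E} (h : ‖x‖ = ‖y‖) (F : E → ENNReal) :
    ∫⁻ T, F (act T x) ∂haar = ∫⁻ T, F (act T y) ∂haar := by
  obtain ⟨S, rfl⟩ := exists_act_eq h
  exact (lintegral_mul_right_eq_self (μ := haar) (fun T => F (act T x)) S).symm

lemma integral_act_pair_eq {x y x' y' : E} (hx : ‖x‖ = ‖x'‖) (hy : ‖y‖ = ‖y'‖)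
    (h : inner ℝ x y = 0) (h' : inner ℝ x' y' = 0) (F : E → E → ℝ) :
    ∫ T, F (act T x) (act T y) ∂haar = ∫ T, F (act T x') (act T y') ∂haar := by
  obtain ⟨S, rfl, rfl⟩ := exists_act_eq_pair hx hy h h'
  exact (integral_mul_right_eq_self (μ := haar) (fun T => F (act T x) (act T y)) S).symm

lemma integrable_of_continuous {F : OrthGroup E → ℝ} (hF : Continuous F) :
    Integrable F haar := by
  have := hF.integrable_of_hasCompactSupport (μ := haar)
    (HasCompactSupport.of_compactSpace F)
  exact this

variable [MeasurableSpace E] [BorelSpace E]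

/-- Averaging a rotation invariant measure over the orthogonal group. -/
lemma measure_eq_lintegral {γ : Measure E} [SFinite γ]
    (hγ : ∀ T : E ≃ₗᵢ[ℝ] E, ∀ A, MeasurableSet A → γ (T '' A) = γ A) {e : E} (he : ‖e‖ = 1)
    {K : Set E} (hK : MeasurableSet K) :
    γ K = ∫⁻ T, γ {x | ‖x‖ • act T e ∈ K} ∂haar := by
  have h1 (T : OrthGroup E) : γ {x | act T x ∈ K} = γ K := by
    let t := Unitary.linearIsometryEquiv T
    have hm : MeasurableSet {x | act T x ∈ K} :=
      (show Continuous fun x => act T x by fun_prop).measurable hK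
    rw [← hγ t _ hm]
    congr 1
    ext y
    constructor
    · rintro ⟨x, hx, rfl⟩; exact hx
    · intro hy
      refine ⟨t.symm y, ?_, t.apply_symm_apply y⟩
      change t (t.symm y) ∈ K
      rwa [t.apply_symm_apply]
  have hme : Measurable fun p : OrthGroup E × E => K.indicator (fun _ => (1 : ENNReal)) (act p.1 p.2) :=
    (measurable_const.indicator hK).comp continuous_act.measurable
  have hme' : Measurable fun p : OrthGroup E × E =>
      K.indicator (fun _ => (1 : ENNReal)) (‖p.2‖ • act p.1 e) :=
    (measurable_const.indicator hK).comp
      (show Continuous fun p : OrthGroup E × E => ‖p.2‖ • act p.1 e by fun_prop).measurable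
  calc γ K = ∫⁻ T : OrthGroup E, γ {x | act T x ∈ K} ∂haar := by simp [h1]
    _ = ∫⁻ T : OrthGroup E, ∫⁻ x, K.indicator (fun _ => 1) (act T x) ∂γ ∂haar := by
        refine lintegral_congr fun T => ?_
        exact (lintegral_indicator_one
          ((show Continuous fun x => act T x by fun_prop).measurable hK)).symm
    _ = ∫⁻ x, ∫⁻ T : OrthGroup E, K.indicator (fun _ => 1) (act T x) ∂haar ∂γ :=
        lintegral_lintegral_swap hme.aemeasurable
    -- Since `x` and `‖x‖ • e` have the same norm, the average over their orbits is the same.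
    _ = ∫⁻ x, ∫⁻ T : OrthGroup E, K.indicator (fun _ => 1) (‖x‖ • act T e) ∂haar ∂γ := by
        refine lintegral_congr fun x => ?_
        rw [lintegral_act_eq (x := x) (y := ‖x‖ • e) (by simp [norm_smul, he])]
        simp
    _ = ∫⁻ T : OrthGroup E, ∫⁻ x, K.indicator (fun _ => 1) (‖x‖ • act T e) ∂γ ∂haar :=
        (lintegral_lintegral_swap hme'.aemeasurable).symm
    _ = _ := by
        refine lintegral_congr fun T => ?_
        exact lintegral_indicator_one
          ((show Continuous fun x : E => ‖x‖ • act T e by fun_prop).measurable hK)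

end OrthGroup

/-! ### Periodic functions on a half circle: Parseval for differences. -/

section Circle

open Filter Topology

/-- This compares Fourier modes: after squaring, the difference at angle `x` in frequency `k` costs
at most `sin² x` times the energy factor `k²`. -/
lemma abs_sin_int_mul_le (k : ℤ) (x : ℝ) : |Real.sin (k * x)| ≤ |(k : ℝ)| * |Real.sin x| := by
  have hn (n : ℕ) : |Real.sin (n * x)| ≤ n * |Real.sin x| := by
    induction n with
    | zero => simp
    | succ n ih =>
      have : ((n + 1 : ℕ) : ℝ) * x = n * x + x := by push_cast; ring
      rw [this, Real.sin_add]
      push_cast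
      calc _ ≤ |Real.sin (n * x) * Real.cos x| + |Real.cos (n * x) * Real.sin x| := abs_add_le _ _
        _ ≤ |Real.sin (n * x)| * 1 + 1 * |Real.sin x| := by
          rw [abs_mul, abs_mul]
          gcongr
          · exact Real.abs_cos_le_one _
          · exact Real.abs_cos_le_one _
        _ ≤ _ := by linarith
  obtain ⟨n, rfl | rfl⟩ := k.eq_nat_or_neg
  · simpa using hn n
  · simpa [Real.sin_neg, neg_mul] using hn n

lemma norm_fourier_sub_one_sq (n : ℤ) (h : ℝ) :
    ‖Complex.exp (2 * n * h * Complex.I) - 1‖ ^ 2 = 4 * Real.sin (n * h) ^ 2 := by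
  have h1 : (2 * n * h * Complex.I : ℂ) = ((2 * (n * h) : ℝ) : ℂ) * Complex.I := by
    push_cast; ring
  rw [h1, Complex.sq_norm, Complex.normSq_apply]
  simp only [Complex.sub_re, Complex.sub_im, Complex.exp_ofReal_mul_I_re,
    Complex.exp_ofReal_mul_I_im, Complex.one_re, Complex.one_im, sub_zero]
  rw [Real.cos_two_mul, Real.sin_two_mul]
  nlinarith [Real.sin_sq_add_cos_sq (n * h)]

lemma fourierCoeffOn_translate_sub {f : ℝ → ℝ} (hf : Continuous f)
    (hp : Function.Periodic f Real.pi) (h : ℝ) (n : ℤ) :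
    fourierCoeffOn Real.pi_pos (fun s => ((f (s + h) - f s : ℝ) : ℂ)) n =
      (Complex.exp (2 * n * h * Complex.I) - 1) *
        fourierCoeffOn Real.pi_pos (fun s => (f s : ℂ)) n := by
  have hpi : (Real.pi : ℂ) ≠ 0 := by exact_mod_cast Real.pi_ne_zero
  have hfc : Continuous fun s => (f s : ℂ) := Complex.continuous_ofReal.comp hf
  let F : ℝ → ℂ := fun x => Complex.exp (-(2 * n * x * Complex.I)) * f x
  have hFc : Continuous F := by
    have : Continuous fun x : ℝ => (x : ℂ) := Complex.continuous_ofReal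
    fun_prop
  have hFp : Function.Periodic F Real.pi := fun x => by
    simp only [F, hp x]
    congr 1
    have : -(2 * n * ((x + Real.pi : ℝ) : ℂ) * Complex.I) =
        -(2 * n * x * Complex.I) + ((-n : ℤ) : ℂ) * (2 * Real.pi * Complex.I) := by
      push_cast; ring
    rw [this, Complex.exp_add, Complex.exp_int_mul_two_pi_mul_I, mul_one]
  have key (x : ℝ) (z : ℂ) : fourier (-n) (x : AddCircle (Real.pi - 0)) • z =
      Complex.exp (-(2 * n * x * Complex.I)) * z := by
    rw [fourier_coe_apply, smul_eq_mul]
    congr 2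
    push_cast
    rw [sub_zero]
    field_simp
  rw [fourierCoeffOn_eq_integral, fourierCoeffOn_eq_integral]
  simp only [key]
  have e1 : ∀ x : ℝ, Complex.exp (-(2 * n * x * Complex.I)) * ((f (x + h) - f x : ℝ) : ℂ) =
      Complex.exp (2 * n * h * Complex.I) * F (x + h) - F x := fun x => by
    simp only [F]
    rw [← mul_assoc, ← Complex.exp_add]
    have : 2 * n * h * Complex.I + -(2 * n * ((x + h : ℝ) : ℂ) * Complex.I) =
      -(2 * n * x * Complex.I) := by push_cast; ring
    rw [this]
    push_cast; ring
  simp only [e1]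
  have hFc' : Continuous fun x => F (x + h) := hFc.comp (continuous_id.add continuous_const)
  have hsub := intervalIntegral.integral_sub (a := 0) (b := Real.pi) (μ := volume)
    (f := fun x => Complex.exp (2 * n * h * Complex.I) * F (x + h)) (g := F)
    ((continuous_const.mul hFc').intervalIntegrable _ _) (hFc.intervalIntegrable _ _)
  rw [hsub, intervalIntegral.integral_const_mul,
    intervalIntegral.integral_comp_add_right (f := F)]
  have := hFp.intervalIntegral_add_eq h 0
  rw [zero_add, add_comm Real.pi h, this, zero_add]
  simp only [Complex.real_smul, F]
  ring

/-- Parseval's identity for the differences of a `π`-periodic function. -/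
lemma exists_hasSum_integral_translate_sub_sq {f : ℝ → ℝ} (hf : Continuous f)
    (hp : Function.Periodic f Real.pi) :
    ∃ a : ℤ → ℝ, (∀ k, 0 ≤ a k) ∧ ∀ h : ℝ,
      HasSum (fun k : ℤ => 4 * Real.sin (k * h) ^ 2 * a k)
        (∫ s in (0 : ℝ)..Real.pi, (f (s + h) - f s) ^ 2) := by
  refine ⟨fun k => Real.pi * ‖fourierCoeffOn Real.pi_pos (fun s => (f s : ℂ)) k‖ ^ 2,
    fun k => by have := Real.pi_pos; positivity, fun h => ?_⟩
  have hc : Continuous fun s => ((f (s + h) - f s : ℝ) : ℂ) :=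
    Complex.continuous_ofReal.comp
      ((hf.comp (continuous_id.add continuous_const)).sub hf)
  have hL : MemLp (fun s => ((f (s + h) - f s : ℝ) : ℂ)) 2
      (volume.restrict (Set.Ioc 0 Real.pi)) := by
    obtain ⟨C, hC⟩ := (isCompact_Icc (a := (0 : ℝ)) (b := Real.pi)).exists_bound_of_continuousOn
      hc.continuousOn
    refine MemLp.of_bound hc.aestronglyMeasurable C ?_
    exact (ae_restrict_iff' measurableSet_Ioc).2
      (Filter.Eventually.of_forall fun x hx => hC x (Set.Ioc_subset_Icc_self hx))
  have := (hasSum_sq_fourierCoeffOn Real.pi_pos hL).mul_left Real.pi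
  have hpi := Real.pi_ne_zero
  have e1 : (fun k : ℤ => 4 * Real.sin (k * h) ^ 2 *
      (Real.pi * ‖fourierCoeffOn Real.pi_pos (fun s => (f s : ℂ)) k‖ ^ 2)) =
      fun k => Real.pi *
        ‖fourierCoeffOn Real.pi_pos (fun s => ((f (s + h) - f s : ℝ) : ℂ)) k‖ ^ 2 := by
    funext k
    rw [fourierCoeffOn_translate_sub hf hp, norm_mul, mul_pow, norm_fourier_sub_one_sq]
    ring
  have e2 : ∫ s in (0 : ℝ)..Real.pi, (f (s + h) - f s) ^ 2 = Real.pi * ((Real.pi - 0)⁻¹ •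
      ∫ s in (0 : ℝ)..Real.pi, ‖((f (s + h) - f s : ℝ) : ℂ)‖ ^ 2) := by
    rw [sub_zero, smul_eq_mul, ← mul_assoc, mul_inv_cancel₀ hpi, one_mul]
    refine intervalIntegral.integral_congr fun s _ => ?_
    rw [Complex.norm_real, Real.norm_eq_abs, sq_abs]
  simp only [e1, e2]
  exact this

/-- The sharp bound for the differences of a `π`-periodic function. -/
lemma integral_translate_sub_sq_le {f : ℝ → ℝ} (hf : Continuous f)
    (hp : Function.Periodic f Real.pi) {L : ℝ}
    (hL : ∀ ε > 0, ∀ᶠ h in 𝓝[>] (0 : ℝ),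
      ∫ s in (0 : ℝ)..Real.pi, (f (s + h) - f s) ^ 2 ≤ (L + ε) * h ^ 2) (α : ℝ) :
    ∫ s in (0 : ℝ)..Real.pi, (f (s + α) - f s) ^ 2 ≤ Real.sin α ^ 2 * L := by
  obtain ⟨a, ha, hs⟩ := exists_hasSum_integral_translate_sub_sq hf hp
  -- The energy is read off mode by mode: divide a partial Parseval sum at small `h` by `h²` and let
  -- `h` tend to `0`. Only an upper bound on difference quotients is used, so `f` need not be
  -- differentiable.
  have hF (F : Finset ℤ) : ∑ k ∈ F, 4 * (k : ℝ) ^ 2 * a k ≤ L := by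
    refine le_of_forall_pos_le_add fun ε hε => ?_
    have hlim : Tendsto (fun h : ℝ => ∑ k ∈ F, 4 * (Real.sin (k * h) / h) ^ 2 * a k) (𝓝[>] 0)
        (𝓝 (∑ k ∈ F, 4 * (k : ℝ) ^ 2 * a k)) := by
      refine tendsto_finsetSum _ fun k _ => ?_
      refine ((Tendsto.pow ?_ 2).const_mul 4).mul_const _
      have hd : HasDerivAt (fun h : ℝ => Real.sin (k * h)) k 0 := by
        have := ((hasDerivAt_id (0 : ℝ)).const_mul (k : ℝ)).sin
        simpa using this
      have := hd.tendsto_slope_zero_right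
      simpa [div_eq_inv_mul] using this
    refine le_of_tendsto hlim ?_
    filter_upwards [hL ε hε, self_mem_nhdsWithin] with h hh hpos
    have hpos : 0 < h := hpos
    have h1 := (sum_le_hasSum F (fun k _ => by have := ha k; positivity) (hs h)).trans hh
    rw [← div_le_iff₀ (by positivity), Finset.sum_div] at h1
    refine le_trans (le_of_eq (Finset.sum_congr rfl fun k _ => ?_)) h1
    field_simp
  refine hasSum_le_of_sum_le (hs α) fun F => ?_
  calc _ ≤ ∑ k ∈ F, Real.sin α ^ 2 * (4 * (k : ℝ) ^ 2 * a k) := by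
        refine Finset.sum_le_sum fun k _ => ?_
        have h1 : Real.sin (k * α) ^ 2 ≤ (k : ℝ) ^ 2 * Real.sin α ^ 2 := by
          rw [← mul_pow, sq_le_sq, abs_mul]
          exact abs_sin_int_mul_le k α
        have := mul_le_mul_of_nonneg_right h1 (ha k)
        linarith
    _ = Real.sin α ^ 2 * ∑ k ∈ F, 4 * (k : ℝ) ^ 2 * a k := by rw [Finset.mul_sum]
    _ ≤ _ := mul_le_mul_of_nonneg_left (hF F) (sq_nonneg _)

end Circle

/-! ### Great circles and functions with a gradient bound. -/

section Poincare

open Filter Topology OrthGroup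

variable {E : Type*} [NormedAddCommGroup E] [InnerProductSpace ℝ E]

/-- The point at angle `s` of the great circle through `x` and `e`. -/
noncomputable def circlePt (x e : E) (s : ℝ) : E := Real.cos s • x + Real.sin s • e

/-- For an orthonormal pair, `circlePt e (-x) s` is the unit tangent at `circlePt x e s`. Any point
of the circle may thus serve as its base point. -/
lemma circlePt_add (x e : E) (s h : ℝ) :
    circlePt x e (s + h) = circlePt (circlePt x e s) (circlePt e (-x) s) h := by
  simp only [circlePt, Real.cos_add, Real.sin_add]
  module

lemma circlePt_add_pi (x e : E) (s : ℝ) : circlePt x e (s + Real.pi) = -circlePt x e s := by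
  simp only [circlePt, Real.cos_add_pi, Real.sin_add_pi]
  module

@[fun_prop]
lemma continuous_circlePt {X : Type*} [TopologicalSpace X] {f g : X → E} {h : X → ℝ}
    (hf : Continuous f) (hg : Continuous g) (hh : Continuous h) :
    Continuous fun x => circlePt (f x) (g x) (h x) := by
  unfold circlePt; fun_prop

lemma norm_circlePt {x e : E} (hx : ‖x‖ = 1) (he : ‖e‖ = 1) (h : inner ℝ x e = 0) (s : ℝ) :
    ‖circlePt x e s‖ = 1 := by
  have : ‖circlePt x e s‖ ^ 2 = 1 := by
    rw [circlePt, norm_add_sq_real, norm_smul, norm_smul, inner_smul_left, inner_smul_right, h,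
      hx, he]
    simp
  nlinarith [norm_nonneg (circlePt x e s)]

lemma inner_circlePt {x e : E} (hx : ‖x‖ = 1) (he : ‖e‖ = 1) (h : inner ℝ x e = 0) (s : ℝ) :
    inner ℝ (circlePt x e s) (circlePt e (-x) s) = 0 := by
  simp only [circlePt, inner_add_left, inner_add_right, inner_smul_left, inner_smul_right,
    inner_neg_right, real_inner_self_eq_norm_sq, hx, he, h, real_inner_comm x e]
  simp; ring

lemma norm_circlePt_sub_le {x e : E} (hx : ‖x‖ = 1) (he : ‖e‖ = 1) (h : inner ℝ x e = 0)
    (s : ℝ) : ‖circlePt x e s - x‖ ≤ |s| := by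
  rw [← abs_norm, ← sq_le_sq]
  have h1 : circlePt x e s - x = (Real.cos s - 1) • x + Real.sin s • e := by
    simp only [circlePt]; module
  rw [h1, norm_add_sq_real, norm_smul, norm_smul, inner_smul_left, inner_smul_right, h, hx, he]
  simp only [mul_one, Real.norm_eq_abs, sq_abs, mul_zero, add_zero]
  nlinarith [Real.sin_sq_add_cos_sq s, Real.one_sub_sq_div_two_le_cos (x := s)]

/-- `V` bounds the directional derivatives of the even function `ψ` on the unit sphere. -/
structure EvenWithGradientBound (ψ : E → ℝ) (V : E → E) (K : ℝ) : Prop where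
  even : ∀ x, ‖x‖ = 1 → ψ (-x) = ψ x
  lipschitz : ∀ x y, ‖x‖ = 1 → ‖y‖ = 1 → |ψ x - ψ y| ≤ K * ‖x - y‖
  norm_le : ∀ x, ‖x‖ = 1 → ‖V x‖ ≤ K
  tangent : ∀ x, ‖x‖ = 1 → inner ℝ (V x) x = 0
  slope_le : ∀ x e, ‖x‖ = 1 → ‖e‖ = 1 → inner ℝ x e = 0 → ∀ ε > 0, ∀ᶠ h in 𝓝[>] (0 : ℝ),
    |ψ (circlePt x e h) - ψ x| ≤ (|inner ℝ (V x) e| + ε) * h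

namespace EvenWithGradientBound

variable {ψ : E → ℝ} {V : E → E} {K : ℝ}

lemma continuousOn (H : EvenWithGradientBound ψ V K) : ContinuousOn ψ (Metric.sphere 0 1) := by
  refine (LipschitzOnWith.of_dist_le_mul (K := K.toNNReal) fun x hx y hy => ?_).continuousOn
  rw [Real.dist_eq, dist_eq_norm]
  exact (H.lipschitz x y (by simpa using hx) (by simpa using hy)).trans
    (mul_le_mul_of_nonneg_right (Real.le_coe_toNNReal K) (norm_nonneg _))

variable [MeasurableSpace E] [BorelSpace E]

/-- Evenness makes the restriction to the great circle `π`-periodic, so the one-dimensional bound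
applies with the squared tangential component of `V` as energy density. -/
lemma integral_circle_le (H : EvenWithGradientBound ψ V K) (hV : Measurable V)
    [SecondCountableTopology E] {x e : E}
    (hx : ‖x‖ = 1) (he : ‖e‖ = 1) (h : inner ℝ x e = 0) (α : ℝ) :
    ∫ s in (0 : ℝ)..Real.pi, (ψ (circlePt x e (s + α)) - ψ (circlePt x e s)) ^ 2 ≤
      Real.sin α ^ 2 *
        ∫ s in (0 : ℝ)..Real.pi, (inner ℝ (V (circlePt x e s)) (circlePt e (-x) s)) ^ 2 := by
  have hK : 0 ≤ K := (norm_nonneg _).trans (H.norm_le x hx)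
  have hn (s : ℝ) : ‖circlePt x e s‖ = 1 := norm_circlePt hx he h s
  have hn' (s : ℝ) : ‖circlePt e (-x) s‖ = 1 :=
    norm_circlePt he (by simpa using hx) (by rw [inner_neg_right, real_inner_comm, h, neg_zero]) s
  have hi (s : ℝ) := inner_circlePt hx he h s
  have hf : Continuous fun s => ψ (circlePt x e s) :=
    H.continuousOn.comp_continuous (by fun_prop) fun s => by simpa using hn s
  refine integral_translate_sub_sq_le (f := fun s => ψ (circlePt x e s)) hf
    (fun s => ?_) ?_ α
  · simp only [circlePt_add_pi]
    exact H.even _ (hn s)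
  intro ε hε
  set b : ℝ → ℝ := fun s => (inner ℝ (V (circlePt x e s)) (circlePt e (-x) s)) ^ 2 with hb
  have hbm : Measurable b := by
    refine Measurable.pow_const (Measurable.inner (𝕜 := ℝ) ?_ ?_) 2
    · exact hV.comp (show Continuous fun s => circlePt x e s by fun_prop).measurable
    · exact (show Continuous fun s => circlePt e (-x) s by fun_prop).measurable
  have hbK (s : ℝ) : b s ≤ K ^ 2 := by
    simp only [hb]
    rw [sq_le_sq, abs_of_nonneg hK]
    refine (abs_real_inner_le_norm _ _).trans ?_
    rw [hn', mul_one]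
    exact H.norm_le _ (hn s)
  -- Squared difference quotients are only bounded above asymptotically by `b` and need not
  -- converge. Their maximum with `b` does converge to `b`, which permits dominated convergence.
  let Q : ℝ → ℝ → ℝ := fun t s =>
    max (((ψ (circlePt x e (s + t)) - ψ (circlePt x e s)) / t) ^ 2) (b s)
  have hQm (t : ℝ) : Measurable (Q t) := by
    refine Measurable.max (Measurable.pow_const (Measurable.div_const ?_ _) 2) hbm
    exact ((hf.comp (continuous_id.add continuous_const)).sub hf).measurable
  have hQb (t : ℝ) (s : ℝ) : Q t s ≤ K ^ 2 := by
    refine max_le ?_ (hbK s)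
    rw [sq_le_sq, abs_of_nonneg hK, abs_div]
    rcases eq_or_ne t 0 with rfl | ht
    · simpa using hK
    rw [div_le_iff₀ (abs_pos.2 ht), circlePt_add]
    refine (H.lipschitz _ _ (norm_circlePt (hn s) (hn' s) (hi s) t) (hn s)).trans ?_
    exact mul_le_mul_of_nonneg_left (norm_circlePt_sub_le (hn s) (hn' s) (hi s) t) hK
  have hQ0 (t s : ℝ) : 0 ≤ Q t s := le_max_of_le_left (sq_nonneg _)
  have hlim : Tendsto (fun t => ∫ s in (0 : ℝ)..Real.pi, Q t s) (𝓝[>] 0)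
      (𝓝 (∫ s in (0 : ℝ)..Real.pi, b s)) := by
    refine intervalIntegral.tendsto_integral_filter_of_dominated_convergence (fun _ => K ^ 2)
      (Eventually.of_forall fun t => (hQm t).aestronglyMeasurable) ?_ (by simp) ?_
    · refine Eventually.of_forall fun t => Eventually.of_forall fun s _ => ?_
      rw [Real.norm_of_nonneg (hQ0 t s)]
      exact hQb t s
    · refine Eventually.of_forall fun s _ => ?_
      set c := |inner ℝ (V (circlePt x e s)) (circlePt e (-x) s)| with hc
      have hbc : b s = c ^ 2 := by rw [hc, sq_abs]
      rw [tendsto_order]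
      refine ⟨fun a ha => Eventually.of_forall fun t => ha.trans_le (le_max_right _ _),
        fun a ha => ?_⟩
      have hc0 : 0 ≤ c := abs_nonneg _
      obtain ⟨δ, hδ, hδa⟩ : ∃ δ > 0, (c + δ) ^ 2 < a := by
        have : Tendsto (fun δ : ℝ => (c + δ) ^ 2) (𝓝[>] 0) (𝓝 ((c + 0) ^ 2)) :=
          ((continuous_const.add continuous_id).pow 2).continuousWithinAt
        rw [add_zero, ← hbc] at this
        obtain ⟨δ, h1, h2⟩ := ((this.eventually (gt_mem_nhds ha)).and self_mem_nhdsWithin).exists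
        exact ⟨δ, h2, h1⟩
      filter_upwards [H.slope_le _ _ (hn s) (hn' s) (hi s) δ hδ, self_mem_nhdsWithin] with t ht ht0
      have ht0 : 0 < t := ht0
      refine max_lt ?_ ha
      refine lt_of_le_of_lt ?_ hδa
      rw [sq_le_sq, abs_of_nonneg (by positivity : 0 ≤ c + δ), abs_div, abs_of_pos ht0,
        div_le_iff₀ ht0, circlePt_add]
      exact ht
  have hev := hlim.eventually (gt_mem_nhds (lt_add_of_pos_right _ hε))
  filter_upwards [hev, self_mem_nhdsWithin] with t ht ht0
  have ht0 : 0 < t := ht0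
  have hle : ∫ s in (0 : ℝ)..Real.pi,
      ((ψ (circlePt x e (s + t)) - ψ (circlePt x e s)) / t) ^ 2 ≤
      ∫ s in (0 : ℝ)..Real.pi, Q t s := by
    refine intervalIntegral.integral_mono_on Real.pi_pos.le ?_ ?_ fun s _ => le_max_left _ _
    · exact ((((hf.comp (continuous_id.add continuous_const)).sub hf).div_const t).pow
        2).intervalIntegrable _ _
    · refine (intervalIntegrable_const (c := K ^ 2)).mono_fun
        (hQm t).aestronglyMeasurable (Eventually.of_forall fun s => ?_)
      change ‖Q t s‖ ≤ ‖K ^ 2‖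
      rw [Real.norm_of_nonneg (hQ0 t s), Real.norm_of_nonneg (sq_nonneg K)]
      exact hQb t s
  have h3 := hle.trans ht.le
  simp only [div_pow] at h3
  rw [intervalIntegral.integral_div, div_le_iff₀ (by positivity)] at h3
  exact h3

end EvenWithGradientBound

end Poincare

/-! ### The spectral gap for even functions on the sphere. -/

namespace EvenWithGradientBound

open Filter Topology OrthGroup

variable {E : Type*} [NormedAddCommGroup E] [InnerProductSpace ℝ E] [FiniteDimensional ℝ E]
variable {ψ : E → ℝ} {V : E → E} {K : ℝ}

lemma _root_.OrthGroup.act_circlePt (T : OrthGroup E) (x e : E) (s : ℝ) :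
    act T (circlePt x e s) = circlePt (act T x) (act T e) s := by
  simp [circlePt]

lemma continuous_comp_act (H : EvenWithGradientBound ψ V K) {x : E} (hx : ‖x‖ = 1) :
    Continuous fun T : OrthGroup E => ψ (act T x) :=
  H.continuousOn.comp_continuous (by fun_prop) fun T => by simpa using hx

lemma exists_basis {x : E} (hx : ‖x‖ = 1) : ∃ (b : OrthonormalBasis (Fin (Module.finrank ℝ E)) ℝ E)
    (i : Fin (Module.finrank ℝ E)), b i = x := by
  have h0 : x ≠ 0 := by rintro rfl; simp at hx
  have : Nontrivial E := ⟨x, 0, h0⟩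
  let i : Fin (Module.finrank ℝ E) := ⟨0, Module.finrank_pos⟩
  have ho : Orthonormal ℝ (({i} : Set (Fin (Module.finrank ℝ E))).domRestrict fun _ => x) := by
    refine ⟨fun _ => hx, fun a b hab => (hab (Subsingleton.elim _ _)).elim⟩
  obtain ⟨b, hb⟩ := ho.exists_orthonormalBasis_extension_of_card_eq (by simp)
  exact ⟨b, i, hb i rfl⟩

lemma sum_inner_act_sq (b : OrthonormalBasis (Fin (Module.finrank ℝ E)) ℝ E) (T : OrthGroup E)
    (v : E) : ∑ i, (inner ℝ v (act T (b i))) ^ 2 = ‖v‖ ^ 2 := by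
  have := (b.map (Unitary.linearIsometryEquiv T)).sum_sq_norm_inner_left v
  simp only [Real.norm_eq_abs, sq_abs] at this
  exact this

/-- The squared coordinates of a unit vector sum to one, and by invariance they have equal means.
This is where the dimension enters the gap. -/
lemma _root_.OrthGroup.integral_inner_act_sq {x : E} (hx : ‖x‖ = 1) :
    (Module.finrank ℝ E : ℝ) * ∫ T : OrthGroup E, (inner ℝ x (act T x)) ^ 2 ∂haar = 1 := by
  obtain ⟨b, i, hb⟩ := exists_basis hx
  have hint (y : E) : Integrable (fun T : OrthGroup E => (inner ℝ y (act T x)) ^ 2) haar :=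
    integrable_of_continuous (by fun_prop)
  have hj (j) : ∫ T : OrthGroup E, (inner ℝ (b j) (act T x)) ^ 2 ∂haar =
      ∫ T : OrthGroup E, (inner ℝ x (act T x)) ^ 2 ∂haar := by
    obtain ⟨S, hS⟩ := exists_act_eq (x := b j) (y := x) (by rw [hx]; exact b.orthonormal.1 j)
    rw [← integral_mul_left_eq_self (μ := haar)
      (fun T : OrthGroup E => (inner ℝ x (act T x)) ^ 2) S]
    refine integral_congr_ae (.of_forall fun T => ?_)
    change _ = (inner ℝ x (act (S * T) x)) ^ 2
    have h1 : inner ℝ x (act (S * T) x) = inner ℝ (act S (b j)) (act S (act T x)) := by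
      rw [hS, act_mul]
    rw [h1, inner_act]
  calc _ = ∑ j, ∫ T : OrthGroup E, (inner ℝ (b j) (act T x)) ^ 2 ∂haar := by simp [hj]
    _ = ∫ T : OrthGroup E, 1 ∂haar := by
        rw [← integral_finsetSum _ fun j _ => hint _]
        refine integral_congr_ae (.of_forall fun T => ?_)
        have := b.sum_sq_norm_inner_right (act T x)
        simp only [Real.norm_eq_abs, sq_abs, norm_act, hx] at this
        simpa using this
    _ = 1 := by simp

variable [MeasurableSpace E] [BorelSpace E]

lemma integrable_inner_sq (H : EvenWithGradientBound ψ V K) (hV : Measurable V) {x e : E}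
    (hx : ‖x‖ = 1) :
    Integrable (fun T : OrthGroup E => (inner ℝ (V (act T x)) (act T e)) ^ 2) haar := by
  have hm : Measurable fun T : OrthGroup E => (inner ℝ (V (act T x)) (act T e)) ^ 2 := by
    refine Measurable.pow_const (Measurable.inner (𝕜 := ℝ) ?_ ?_) 2
    · exact hV.comp (show Continuous fun T : OrthGroup E => act T x by fun_prop).measurable
    · exact (show Continuous fun T : OrthGroup E => act T e by fun_prop).measurable
  refine Integrable.of_bound hm.aestronglyMeasurable ((K * ‖e‖) ^ 2) (.of_forall fun T => ?_)
  rw [Real.norm_of_nonneg (sq_nonneg _), ← sq_abs]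
  gcongr
  refine (abs_real_inner_le_norm _ _).trans ?_
  rw [norm_act]
  exact mul_le_mul_of_nonneg_right (H.norm_le _ (by simpa using hx)) (norm_nonneg _)

/-- Apply the circle bound to each rotated pair and average over rotations. -/
lemma integral_sub_sq_le_of_orthonormal (H : EvenWithGradientBound ψ V K) (hV : Measurable V)
    {x e : E} (hx : ‖x‖ = 1) (he : ‖e‖ = 1) (h : inner ℝ x e = 0) (α : ℝ) :
    ∫ T : OrthGroup E, (ψ (act T (circlePt x e α)) - ψ (act T x)) ^ 2 ∂haar ≤
      Real.sin α ^ 2 * ∫ T : OrthGroup E, (inner ℝ (V (act T x)) (act T e)) ^ 2 ∂haar := by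
  have hK : 0 ≤ K := (norm_nonneg _).trans (H.norm_le x hx)
  have hmx : ‖-x‖ = 1 := by simpa using hx
  have hex : inner ℝ e (-x) = 0 := by rw [inner_neg_right, real_inner_comm, h, neg_zero]
  have hn (s : ℝ) : ‖circlePt x e s‖ = 1 := norm_circlePt hx he h s
  have hn' (s : ℝ) : ‖circlePt e (-x) s‖ = 1 := norm_circlePt he hmx hex s
  have hi (s : ℝ) := inner_circlePt hx he h s
  let F : OrthGroup E → ℝ → ℝ := fun T s =>
    (ψ (circlePt (act T x) (act T e) (s + α)) - ψ (circlePt (act T x) (act T e) s)) ^ 2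
  let B : OrthGroup E → ℝ → ℝ := fun T s =>
    (inner ℝ (V (circlePt (act T x) (act T e) s)) (circlePt (act T e) (-act T x) s)) ^ 2
  have hFc : Continuous (Function.uncurry F) := by
    refine Continuous.pow (Continuous.sub ?_ ?_) 2
    · refine H.continuousOn.comp_continuous (by fun_prop) fun p => ?_
      rw [← act_circlePt]; simpa using hn _
    · refine H.continuousOn.comp_continuous (by fun_prop) fun p => ?_
      rw [← act_circlePt]; simpa using hn _
  have hBm : Measurable (Function.uncurry B) := by
    refine Measurable.pow_const (Measurable.inner (𝕜 := ℝ) ?_ ?_) 2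
    · exact hV.comp (show Continuous fun p : OrthGroup E × ℝ =>
        circlePt (act p.1 x) (act p.1 e) p.2 by fun_prop).measurable
    · exact (show Continuous fun p : OrthGroup E × ℝ =>
        circlePt (act p.1 e) (-act p.1 x) p.2 by fun_prop).measurable
  have hFb (T : OrthGroup E) (s : ℝ) : ‖F T s‖ ≤ (K * 2) ^ 2 := by
    rw [Real.norm_of_nonneg (sq_nonneg _), ← sq_abs]
    simp only [← act_circlePt]
    gcongr
    refine (H.lipschitz _ _ (by simpa using hn _) (by simpa using hn _)).trans ?_
    gcongr
    refine (norm_sub_le _ _).trans ?_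
    rw [norm_act, norm_act, hn, hn]; norm_num
  have hBb (T : OrthGroup E) (s : ℝ) : ‖B T s‖ ≤ K ^ 2 := by
    rw [Real.norm_of_nonneg (sq_nonneg _), ← sq_abs]
    simp only [← act_circlePt, ← act_neg]
    gcongr
    refine (abs_real_inner_le_norm _ _).trans ?_
    rw [norm_act, hn', mul_one]
    exact H.norm_le _ (by simpa using hn _)
  let ν : Measure ℝ := volume.restrict (Set.Ioc 0 Real.pi)
  have hFi : Integrable (Function.uncurry F) (haar.prod ν) :=
    Integrable.of_bound hFc.aestronglyMeasurable ((K * 2) ^ 2) (.of_forall fun p => hFb p.1 p.2)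
  have hBi : Integrable (Function.uncurry B) (haar.prod ν) :=
    Integrable.of_bound hBm.aestronglyMeasurable (K ^ 2) (.of_forall fun p => hBb p.1 p.2)
  have hle (T : OrthGroup E) : ∫ s, F T s ∂ν ≤ Real.sin α ^ 2 * ∫ s, B T s ∂ν := by
    have := H.integral_circle_le hV (x := act T x) (e := act T e) (by simpa using hx)
      (by simpa using he) (by simpa using h) α
    rwa [intervalIntegral.integral_of_le Real.pi_pos.le,
      intervalIntegral.integral_of_le Real.pi_pos.le] at this
  have hint : ∫ T, ∫ s, F T s ∂ν ∂haar ≤ Real.sin α ^ 2 * ∫ T, ∫ s, B T s ∂ν ∂haar := by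
    rw [← integral_const_mul]
    exact integral_mono hFi.integral_prod_left (hBi.integral_prod_left.const_mul _) hle
  rw [integral_integral_swap hFi, integral_integral_swap hBi] at hint
  -- The group moves the frame at parameter `s` to the frame at `0`, so after exchanging integrals
  -- nothing depends on `s`.
  have hF2 (s : ℝ) : ∫ T, F T s ∂haar =
      ∫ T : OrthGroup E, (ψ (act T (circlePt x e α)) - ψ (act T x)) ^ 2 ∂haar := by
    have := integral_act_pair_eq (x := circlePt x e s) (y := circlePt e (-x) s) (x' := x) (y' := e)
      (by rw [hn, hx]) (by rw [hn', he]) (hi s) h fun y z => (ψ (circlePt y z α) - ψ y) ^ 2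
    simp only [act_circlePt, act_neg, ← circlePt_add] at this ⊢
    exact this
  have hB2 (s : ℝ) : ∫ T, B T s ∂haar =
      ∫ T : OrthGroup E, (inner ℝ (V (act T x)) (act T e)) ^ 2 ∂haar := by
    have := integral_act_pair_eq (x := circlePt x e s) (y := circlePt e (-x) s) (x' := x) (y' := e)
      (by rw [hn, hx]) (by rw [hn', he]) (hi s) h fun y z => (inner ℝ (V y) z) ^ 2
    simp only [act_circlePt, act_neg] at this ⊢
    exact this
  simp only [hF2, hB2, integral_const, smul_eq_mul] at hint
  have hν : ν.real Set.univ = Real.pi := by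
    simp [ν, Measure.real, Real.pi_pos.le]
  rw [hν, ← mul_assoc, mul_comm (Real.sin α ^ 2), mul_assoc] at hint
  exact le_of_mul_le_mul_left hint Real.pi_pos

/-- Complete `x` to an orthonormal basis: `V` has no component along `x`, and the remaining `n - 1`
components have equal mean squares. -/
lemma integral_inner_sq_eq (H : EvenWithGradientBound ψ V K) (hV : Measurable V)
    {x e : E} (hx : ‖x‖ = 1) (he : ‖e‖ = 1) (h : inner ℝ x e = 0) :
    ((Module.finrank ℝ E : ℝ) - 1) *
      ∫ T : OrthGroup E, (inner ℝ (V (act T x)) (act T e)) ^ 2 ∂haar =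
      ∫ T : OrthGroup E, ‖V (act T x)‖ ^ 2 ∂haar := by
  obtain ⟨b, i, hb⟩ := exists_basis hx
  calc _ = ∑ j, ∫ T : OrthGroup E, (inner ℝ (V (act T x)) (act T (b j))) ^ 2 ∂haar := by
        rw [← Finset.sum_erase_add _ _ (Finset.mem_univ i)]
        have h1 : ∫ T : OrthGroup E, (inner ℝ (V (act T x)) (act T (b i))) ^ 2 ∂haar = 0 := by
          rw [hb]
          simp [H.tangent (act _ x) (by simpa using hx)]
        rw [h1, add_zero, Finset.sum_congr rfl (g := fun _ =>
          ∫ T : OrthGroup E, (inner ℝ (V (act T x)) (act T e)) ^ 2 ∂haar)]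
        · rw [Finset.sum_const, Finset.card_erase_of_mem (Finset.mem_univ i)]
          have : 0 < Module.finrank ℝ E := Fin.pos i
          simp [Nat.cast_sub this]
        · intro j hj
          have hji : j ≠ i := by simpa using hj
          exact integral_act_pair_eq rfl (by rw [he]; exact b.orthonormal.1 j)
            (by rw [← hb]; exact b.orthonormal.2 hji.symm) h fun y z => (inner ℝ (V y) z) ^ 2
    _ = _ := by
        rw [← integral_finsetSum _ fun j _ => H.integrable_inner_sq hV hx]
        exact integral_congr_ae (.of_forall fun T => sum_inner_act_sq b T _)

/-- The points `x` and `y` lie on a great circle at angle `arccos ⟨x, y⟩`, whose squared sine is `1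
- ⟨x, y⟩²`. If `y = ±x`, evenness makes the left side vanish. -/
lemma integral_sub_sq_le (H : EvenWithGradientBound ψ V K) (hV : Measurable V)
    {x y : E} (hx : ‖x‖ = 1) (hy : ‖y‖ = 1) :
    ((Module.finrank ℝ E : ℝ) - 1) *
      ∫ T : OrthGroup E, (ψ (act T y) - ψ (act T x)) ^ 2 ∂haar ≤
      (1 - inner ℝ x y ^ 2) * ∫ T : OrthGroup E, ‖V (act T x)‖ ^ 2 ∂haar := by
  have h0 : x ≠ 0 := by rintro rfl; simp at hx
  have : Nontrivial E := ⟨x, 0, h0⟩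
  have hn1 : (1 : ℝ) ≤ Module.finrank ℝ E := by exact_mod_cast Module.finrank_pos (R := ℝ) (M := E)
  set c := inner ℝ x y with hc
  set z := y - c • x with hz
  have hxz : inner ℝ x z = 0 := by
    rw [hz, inner_sub_right, inner_smul_right, real_inner_self_eq_norm_sq, hx, ← hc]; ring
  have hz2 : ‖z‖ ^ 2 = 1 - c ^ 2 := by
    have : ‖y‖ ^ 2 = ‖c • x + z‖ ^ 2 := by rw [hz]; congr 2; abel
    rw [norm_add_sq_real, inner_smul_left, hxz, norm_smul, hx, hy] at this
    simp at this
    linarith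
  have hJ : 0 ≤ ∫ T : OrthGroup E, ‖V (act T x)‖ ^ 2 ∂haar := integral_nonneg fun T => sq_nonneg _
  rcases eq_or_ne z 0 with h | h
  · have hyc : y = c • x := by rw [hz, sub_eq_zero] at h; exact h
    have hc1 : c ^ 2 = 1 := by rw [h] at hz2; simp at hz2; linarith
    have he : ∀ T : OrthGroup E, ψ (act T y) = ψ (act T x) := fun T => by
      rcases (by simpa using hc1 : c = 1 ∨ c = -1) with h | h
      · rw [hyc, h, one_smul]
      · rw [hyc, h, neg_one_smul, act_neg, H.even _ (by simpa using hx)]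
    simp only [he, sub_self]
    rw [hc1]
    simp
  · have hzn : ‖z‖ ≠ 0 := norm_ne_zero_iff.2 h
    set e := ‖z‖⁻¹ • z with he
    have hen : ‖e‖ = 1 := by rw [he, norm_smul, norm_inv, norm_norm, inv_mul_cancel₀ hzn]
    have hxe : inner ℝ x e = 0 := by rw [he, inner_smul_right, hxz, mul_zero]
    have hc1 : c ^ 2 ≤ 1 := by nlinarith [sq_nonneg ‖z‖]
    have hcl : -1 ≤ c ∧ c ≤ 1 := abs_le.1 (by nlinarith [abs_nonneg c, sq_abs c])
    have hsin : Real.sin (Real.arccos c) = ‖z‖ := by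
      rw [Real.sin_arccos, ← hz2, Real.sqrt_sq (norm_nonneg _)]
    have hyp : circlePt x e (Real.arccos c) = y := by
      rw [circlePt, Real.cos_arccos hcl.1 hcl.2, hsin, he, smul_smul, mul_inv_cancel₀ hzn,
        one_smul, hz]
      abel
    have h1 := H.integral_sub_sq_le_of_orthonormal hV hx hen hxe (Real.arccos c)
    rw [hyp, hsin, hz2] at h1
    calc _ ≤ ((Module.finrank ℝ E : ℝ) - 1) * ((1 - c ^ 2) *
          ∫ T : OrthGroup E, (inner ℝ (V (act T x)) (act T e)) ^ 2 ∂haar) :=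
          mul_le_mul_of_nonneg_left h1 (by linarith)
      _ = _ := by rw [← H.integral_inner_sq_eq hV hx hen hxe]; ring

/-- The spectral gap of even functions on the sphere. -/
theorem poincare (H : EvenWithGradientBound ψ V K) (hV : Measurable V) {x : E} (hx : ‖x‖ = 1) :
    2 * (Module.finrank ℝ E : ℝ) * (∫ T : OrthGroup E, ψ (act T x) ^ 2 ∂haar -
      (∫ T : OrthGroup E, ψ (act T x) ∂haar) ^ 2) ≤
      ∫ T : OrthGroup E, ‖V (act T x)‖ ^ 2 ∂haar := by
  have h0 : x ≠ 0 := by rintro rfl; simp at hx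
  have : Nontrivial E := ⟨x, 0, h0⟩
  have hc := H.continuous_comp_act hx
  set J := ∫ T : OrthGroup E, ‖V (act T x)‖ ^ 2 ∂haar with hJd
  have hJ : 0 ≤ J := integral_nonneg fun T => sq_nonneg _
  -- In dimension one the sphere is an antipodal pair, on which an even function is constant; the
  -- factor `n - 1` could not be cancelled there.
  rcases (Nat.one_le_iff_ne_zero.2 (Module.finrank_pos (R := ℝ) (M := E)).ne').eq_or_lt with h1 | h1
  · have hcst (T : OrthGroup E) : ψ (act T x) = ψ x := by
      obtain ⟨c, hc⟩ := (finrank_eq_one_iff_of_nonzero' x h0).1 h1.symm (act T x)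
      have hn := congrArg norm hc
      rw [norm_smul, norm_act, hx, mul_one, Real.norm_eq_abs] at hn
      rw [← hc]
      rcases eq_or_eq_neg_of_abs_eq hn with h | h
      · rw [h, one_smul]
      · rw [h, neg_one_smul, H.even x hx]
    simp only [hcst]
    simpa using hJ
  · have hn1 : (1 : ℝ) < Module.finrank ℝ E := by exact_mod_cast h1
    set n : ℝ := (Module.finrank ℝ E : ℝ)
    set A := ∫ T : OrthGroup E, ψ (act T x) ^ 2 ∂haar
    set M := ∫ T : OrthGroup E, ψ (act T x) ∂haar
    have hpair (T : OrthGroup E) : ∫ S : OrthGroup E,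
        (ψ (act (T * S) x) - ψ (act T x)) ^ 2 ∂haar = A - 2 * M * ψ (act T x) + ψ (act T x) ^ 2 := by
      rw [integral_mul_left_eq_self (μ := haar)
        (fun S : OrthGroup E => (ψ (act S x) - ψ (act T x)) ^ 2) T]
      have e : ∀ S : OrthGroup E, (ψ (act S x) - ψ (act T x)) ^ 2 =
          ψ (act S x) ^ 2 - 2 * ψ (act T x) * ψ (act S x) + ψ (act T x) ^ 2 := fun S => by ring
      simp only [e]
      rw [integral_add, integral_sub, integral_const_mul]
      · simp; ring
      · exact integrable_of_continuous (hc.pow 2)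
      · exact integrable_of_continuous (continuous_const.mul hc)
      · exact integrable_of_continuous ((hc.pow 2).sub (continuous_const.mul hc))
      · exact integrable_const _
    -- For independent rotations `T` and `S`, the points `TSx` and `Tx` are independent and uniform,
    -- so the mean squared difference is twice the variance.
    have htot : ∫ T : OrthGroup E, ∫ S : OrthGroup E,
        (ψ (act (T * S) x) - ψ (act T x)) ^ 2 ∂haar ∂haar = 2 * (A - M ^ 2) := by
      simp only [hpair]
      rw [integral_add, integral_sub, integral_const_mul]
      · simp [A, M]; ring
      · exact integrable_const _
      · exact integrable_of_continuous (continuous_const.mul hc)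
      · exact integrable_of_continuous (continuous_const.sub (continuous_const.mul hc))
      · exact integrable_of_continuous (hc.pow 2)
    have hcont : Continuous fun p : OrthGroup E × OrthGroup E =>
        (ψ (act (p.1 * p.2) x) - ψ (act p.1 x)) ^ 2 :=
      ((hc.comp (continuous_fst.mul continuous_snd)).sub (hc.comp continuous_fst)).pow 2
    have hI : Integrable (Function.uncurry fun T S : OrthGroup E =>
        (ψ (act (T * S) x) - ψ (act T x)) ^ 2) (haar.prod haar) := by
      exact hcont.integrable_of_hasCompactSupport (HasCompactSupport.of_compactSpace _)
    rw [integral_integral_swap hI] at htot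
    -- With `S` fixed, this is the two-point bound for `y = S x`. Averaging over `S` replaces `⟨x, S
    -- x⟩²` by `1/n`.
    have hle (S : OrthGroup E) : (n - 1) * ∫ T : OrthGroup E,
        (ψ (act (T * S) x) - ψ (act T x)) ^ 2 ∂haar ≤ (1 - inner ℝ x (act S x) ^ 2) * J := by
      simpa only [act_mul] using H.integral_sub_sq_le hV hx (y := act S x) (by simpa using hx)
    have hi2 : Integrable (fun S : OrthGroup E => inner ℝ x (act S x) ^ 2) haar :=
      integrable_of_continuous (by fun_prop)
    have h3 := integral_mono (hI.integral_prod_right.const_mul (n - 1))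
      (((integrable_const 1).sub hi2).mul_const J) hle
    simp only [Function.uncurry_apply_pair] at h3
    rw [integral_const_mul, htot, integral_mul_const] at h3
    have h4 : ∫ S : OrthGroup E, (1 - inner ℝ x (act S x) ^ 2) ∂haar =
        1 - ∫ S : OrthGroup E, inner ℝ x (act S x) ^ 2 ∂haar := by
      rw [integral_sub (integrable_const 1) hi2]; simp
    have h5 := OrthGroup.integral_inner_act_sq hx
    set q := ∫ S : OrthGroup E, inner ℝ x (act S x) ^ 2 ∂haar
    change n * q = 1 at h5
    simp only [Pi.sub_apply] at h3
    rw [h4] at h3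
    have h6 : (n - 1) * (2 * n * (A - M ^ 2)) ≤ (n - 1) * J := by
      have := mul_le_mul_of_nonneg_left h3 (by linarith : 0 ≤ n)
      calc _ = n * ((n - 1) * (2 * (A - M ^ 2))) := by ring
        _ ≤ n * ((1 - q) * J) := this
        _ = (n - n * q) * J := by ring
        _ = _ := by rw [h5]
    exact le_of_mul_le_mul_left h6 (by linarith)

end EvenWithGradientBound

/-! ### Rotation invariant log-concave measures: atoms and absolute continuity. -/

section RadialDensity

open Filter Topology Metric
open scoped ENNReal

variable {d : ℕ} {γ : Measure (EuclideanSpace ℝ (Fin (d + 1)))}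

lemma IsLogConcaveMeasure.closedBall_le (hlog : IsLogConcaveMeasure γ)
    (x y : EuclideanSpace ℝ (Fin (d + 1))) {δ : ℝ} (hδ : 0 ≤ δ) {lam : ℝ}
    (hl : lam ∈ Set.Icc (0 : ℝ) 1) :
    γ (closedBall x δ) ^ lam * γ (closedBall y δ) ^ (1 - lam) ≤
      γ (closedBall (lam • x + (1 - lam) • y) δ) := by
  have h1 : 0 ≤ 1 - lam := by linarith [hl.2]
  have e : lam • closedBall x δ + (1 - lam) • closedBall y δ =
      closedBall (lam • x + (1 - lam) • y) δ := by
    rw [smul_closedBall _ _ hδ, smul_closedBall _ _ hδ, Real.norm_of_nonneg hl.1,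
      Real.norm_of_nonneg h1, closedBall_add_closedBall (mul_nonneg hl.1 hδ) (mul_nonneg h1 hδ)]
    congr 1; ring
  have := hlog lam hl (closedBall x δ) (closedBall y δ) (nonempty_closedBall.2 hδ)
    (nonempty_closedBall.2 hδ) measurableSet_closedBall measurableSet_closedBall
    (by rw [e]; exact measurableSet_closedBall)
  rwa [e] at this

lemma IsRotationInvariant.closedBall_eq (hrot : IsRotationInvariant γ)
    {x y : EuclideanSpace ℝ (Fin (d + 1))} (h : ‖x‖ = ‖y‖) (δ : ℝ) :
    γ (closedBall x δ) = γ (closedBall y δ) := by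
  have := hrot ((ℝ ∙ (x - y))ᗮ.reflection) (closedBall x δ) measurableSet_closedBall
  rw [← this, LinearIsometryEquiv.image_closedBall, Submodule.reflection_sub h]

/-- Balls about `y` and `-y` have equal mass, hence by log-concavity a ball about any point `c y` of
the segment between them has at least that mass. Rotation carries `c y` to `x`. -/
lemma IsLogConcaveMeasure.closedBall_anti (hlog : IsLogConcaveMeasure γ)
    (hrot : IsRotationInvariant γ) {x y : EuclideanSpace ℝ (Fin (d + 1))} (h : ‖x‖ ≤ ‖y‖)
    {δ : ℝ} (hδ : 0 ≤ δ) : γ (closedBall y δ) ≤ γ (closedBall x δ) := by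
  rcases eq_or_ne y 0 with rfl | hy
  · have : x = 0 := by simpa using h
    rw [this]
  have hy0 : 0 < ‖y‖ := norm_pos_iff.2 hy
  set c := ‖x‖ / ‖y‖ with hc
  have hc0 : 0 ≤ c := by positivity
  have hc1 : c ≤ 1 := (div_le_one hy0).2 h
  have hl : (1 + c) / 2 ∈ Set.Icc (0 : ℝ) 1 := ⟨by linarith, by linarith⟩
  have h1 := hlog.closedBall_le y (-y) hδ hl
  rw [hrot.closedBall_eq (norm_neg y) δ, ← ENNReal.rpow_add_of_nonneg _ _ hl.1
    (by linarith [hl.2]), add_sub_cancel, ENNReal.rpow_one] at h1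
  refine h1.trans (le_of_eq (hrot.closedBall_eq ?_ δ))
  have : ((1 + c) / 2) • y + (1 - (1 + c) / 2) • (-y) = c • y := by module
  rw [this, norm_smul, Real.norm_of_nonneg hc0, hc, div_mul_cancel₀ _ hy0.ne']

/-- Otherwise, interpolating between the shell and the atom bounds below, by one positive constant,
the masses of all dyadic contractions of the shell. These are disjoint and lie in one ball, against
local finiteness. -/
lemma IsLogConcaveMeasure.measure_shell_eq_zero [IsLocallyFiniteMeasure γ]
    (hlog : IsLogConcaveMeasure γ) (h0 : γ {0} ≠ 0) {r : ℝ} (hr : 0 < r) :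
    γ {x | r / 2 < ‖x‖ ∧ ‖x‖ ≤ r} = 0 := by
  set S : Set (EuclideanSpace ℝ (Fin (d + 1))) := {x | r / 2 < ‖x‖ ∧ ‖x‖ ≤ r} with hS
  have hSm : MeasurableSet S :=
    (measurableSet_lt measurable_const measurable_norm).inter
      (measurableSet_le measurable_norm measurable_const)
  by_contra hne
  let l : ℕ → ℝ := fun k => (1 / 2) ^ k
  have hl0 (k) : 0 < l k := by positivity
  have hl1 (k) : l k ≤ 1 := pow_le_one₀ (by norm_num) (by norm_num)
  have hSne : S.Nonempty := nonempty_of_measure_ne_zero hne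
  have hmem (k : ℕ) (x : EuclideanSpace ℝ (Fin (d + 1))) :
      x ∈ l k • S ↔ l k * r / 2 < ‖x‖ ∧ ‖x‖ ≤ l k * r := by
    rw [Set.mem_smul_set_iff_inv_smul_mem₀ (hl0 k).ne', hS]
    simp only [Set.mem_ofPred_eq, norm_smul, norm_inv, Real.norm_of_nonneg (hl0 k).le]
    rw [inv_mul_eq_div, lt_div_iff₀ (hl0 k), div_le_iff₀ (hl0 k)]
    constructor <;> rintro ⟨h1, h2⟩ <;> constructor <;> linarith
  have hm (k) : MeasurableSet (l k • S) := hSm.const_smul₀ _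
  have hle (k) : min (γ S) (γ {0}) ≤ γ (l k • S) := by
    have h1 := hlog (l k) ⟨(hl0 k).le, hl1 k⟩ S {0} hSne (Set.singleton_nonempty _) hSm
      (measurableSet_singleton _)
    have e : l k • S + (1 - l k) • ({0} : Set (EuclideanSpace ℝ (Fin (d + 1)))) = l k • S := by
      simp
    rw [e] at h1
    refine le_trans ?_ (h1 (hm k))
    calc min (γ S) (γ {0}) = min (γ S) (γ {0}) ^ (l k) * min (γ S) (γ {0}) ^ (1 - l k) := by
          rw [← ENNReal.rpow_add_of_nonneg _ _ (hl0 k).le (by linarith [hl1 k]), add_sub_cancel,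
            ENNReal.rpow_one]
      _ ≤ _ := mul_le_mul' (ENNReal.rpow_le_rpow (min_le_left _ _) (hl0 k).le)
          (ENNReal.rpow_le_rpow (min_le_right _ _) (by linarith [hl1 k]))
  have hdisj : Pairwise (Function.onFun Disjoint fun k => l k • S) := by
    refine (Std.Symm.pairwise_on (r := fun A B : Set (EuclideanSpace ℝ (Fin (d + 1))) => Disjoint A B) fun k => l k • S).2 ?_
    intro m n hmn
    rw [Set.disjoint_left]
    intro x hx hx'
    rw [hmem] at hx hx'
    have : l n ≤ l m / 2 := by
      have : l n ≤ l (m + 1) := pow_le_pow_of_le_one (by norm_num) (by norm_num) hmn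
      simp only [l, pow_succ] at this ⊢
      linarith
    nlinarith [hx.1, hx'.2]
  have hsum := measure_iUnion hdisj hm (μ := γ)
  have hsub : (⋃ k, l k • S) ⊆ closedBall 0 r := by
    refine Set.iUnion_subset fun k x hx => ?_
    rw [mem_closedBall_zero_iff]
    have := ((hmem k x).1 hx).2
    nlinarith [hl1 k]
  have hfin : γ (⋃ k, l k • S) < ⊤ :=
    (measure_mono hsub).trans_lt (isCompact_closedBall _ _).measure_lt_top
  have htop : ∑' k, γ (l k • S) = ⊤ := by
    refine top_le_iff.1 ?_
    rw [← ENNReal.tsum_const_eq_top_of_ne_zero (α := ℕ) (c := min (γ S) (γ {0}))]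
    · exact ENNReal.tsum_le_tsum hle
    · exact (lt_min (pos_iff_ne_zero.2 hne) (pos_iff_ne_zero.2 h0)).ne'
  rw [hsum, htop] at hfin
  exact lt_irrefl _ hfin

/-- A log-concave measure with an atom at the origin has no other mass. -/
lemma IsLogConcaveMeasure.measure_compl_zero_eq_zero [IsLocallyFiniteMeasure γ]
    (hlog : IsLogConcaveMeasure γ) (h0 : γ {0} ≠ 0) :
    γ {0}ᶜ = 0 := by
  refine measure_null_of_locally_null _ fun x hx => ?_
  have hx0 : 0 < ‖x‖ := norm_pos_iff.2 (by simpa using hx)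
  refine ⟨{y | (3 / 2 * ‖x‖) / 2 < ‖y‖ ∧ ‖y‖ ≤ 3 / 2 * ‖x‖}, mem_nhdsWithin_of_mem_nhds ?_,
    hlog.measure_shell_eq_zero h0 (by positivity)⟩
  have h1 : ∀ᶠ y in 𝓝 x, (3 / 2 * ‖x‖) / 2 < ‖y‖ :=
    (continuous_norm.tendsto x).eventually (lt_mem_nhds (by linarith))
  have h2 : ∀ᶠ y in 𝓝 x, ‖y‖ < 3 / 2 * ‖x‖ :=
    (continuous_norm.tendsto x).eventually (gt_mem_nhds (by linarith))
  filter_upwards [h1, h2] with y hy1 hy2 using ⟨hy1, hy2.le⟩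

/-- The small ball at `x` is lightest among those centred at points `y` with `‖y‖ ≤ ‖x‖`. Integrate
over such `y` and exchange integrals: each `z` is covered by a set of `y` of at most the volume of a
small ball. Away from the origin this bounds the density. -/
lemma IsLogConcaveMeasure.closedBall_mul_le [IsLocallyFiniteMeasure γ]
    (hlog : IsLogConcaveMeasure γ) (hrot : IsRotationInvariant γ)
    (x : EuclideanSpace ℝ (Fin (d + 1))) {δ : ℝ} (hδ : 0 ≤ δ) :
    γ (closedBall x δ) * volume (closedBall (0 : EuclideanSpace ℝ (Fin (d + 1))) ‖x‖) ≤
      volume (closedBall (0 : EuclideanSpace ℝ (Fin (d + 1))) δ) *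
        γ (closedBall 0 (‖x‖ + δ)) := by
  set B := closedBall (0 : EuclideanSpace ℝ (Fin (d + 1))) ‖x‖ with hB
  set B' := closedBall (0 : EuclideanSpace ℝ (Fin (d + 1))) (‖x‖ + δ) with hB'
  let D := closedBall (0 : EuclideanSpace ℝ (Fin (d + 1))) δ
  let k : EuclideanSpace ℝ (Fin (d + 1)) → EuclideanSpace ℝ (Fin (d + 1)) → ℝ≥0∞ :=
    fun y z => B.indicator (fun _ => 1) y * D.indicator (fun _ => 1) (z - y)
  have hk : Measurable (Function.uncurry k) := by
    refine Measurable.mul ?_ ?_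
    · exact (measurable_const.indicator measurableSet_closedBall).comp measurable_fst
    · exact (measurable_const.indicator measurableSet_closedBall).comp
        (measurable_snd.sub measurable_fst)
  have hD (y z : EuclideanSpace ℝ (Fin (d + 1))) :
      D.indicator (fun _ => (1 : ℝ≥0∞)) (z - y) = (closedBall y δ).indicator 1 z := by
    by_cases h : dist z y ≤ δ
    · have h' : z - y ∈ D := by simpa [D, dist_eq_norm] using h
      rw [Set.indicator_of_mem h', Set.indicator_of_mem (mem_closedBall.2 h), Pi.one_apply]
    · have h' : z - y ∉ D := by simpa [D, dist_eq_norm] using h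
      rw [Set.indicator_of_notMem h', Set.indicator_of_notMem (fun h2 => h (mem_closedBall.1 h2))]
  have hD' (y z : EuclideanSpace ℝ (Fin (d + 1))) :
      D.indicator (fun _ => (1 : ℝ≥0∞)) (z - y) = (closedBall z δ).indicator 1 y := by
    rw [hD]
    by_cases h : dist z y ≤ δ
    · rw [Set.indicator_of_mem (mem_closedBall.2 h), Set.indicator_of_mem (mem_closedBall'.2 h)]
      rfl
    · rw [Set.indicator_of_notMem (fun h2 => h (mem_closedBall.1 h2)),
        Set.indicator_of_notMem (fun h2 => h (mem_closedBall'.1 h2))]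
  calc γ (closedBall x δ) * volume B = ∫⁻ y in B, γ (closedBall x δ) := by
        rw [setLIntegral_const]
    _ ≤ ∫⁻ y in B, γ (closedBall y δ) := by
        refine setLIntegral_mono' measurableSet_closedBall fun y hy => ?_
        exact hlog.closedBall_anti hrot (by simpa [hB] using hy) hδ
    _ = ∫⁻ y, ∫⁻ z, k y z ∂γ := by
        rw [← lintegral_indicator measurableSet_closedBall]
        refine lintegral_congr fun y => ?_
        by_cases hy : y ∈ B
        · rw [Set.indicator_of_mem hy, ← lintegral_indicator_one measurableSet_closedBall]
          exact lintegral_congr fun z => by simp only [k, Set.indicator_of_mem hy, hD, one_mul]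
        · rw [Set.indicator_of_notMem hy]
          simp [k, hy]
    _ = ∫⁻ z, (∫⁻ y, k y z) ∂γ := lintegral_lintegral_swap hk.aemeasurable
    _ ≤ ∫⁻ z, B'.indicator (fun _ => volume (closedBall (0 : EuclideanSpace ℝ (Fin (d + 1))) δ))
          z ∂γ := by
        refine lintegral_mono fun z => ?_
        have h1 : ∀ y, k y z ≤ B'.indicator (fun _ => (closedBall z δ).indicator 1 y) z := by
          intro y
          simp only [k, hD']
          by_cases hz : z ∈ B'
          · rw [Set.indicator_of_mem hz]
            refine mul_le_of_le_one_left (zero_le) ?_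
            exact Set.indicator_le_self' (fun _ _ => zero_le) y
          · rw [Set.indicator_of_notMem hz]
            by_cases hy : y ∈ B
            · have : y ∉ closedBall z δ := fun hyz => hz <| by
                rw [hB', mem_closedBall]
                refine (dist_triangle z y 0).trans ?_
                have h3 := mem_closedBall.1 hy
                have h4 := mem_closedBall'.1 hyz
                linarith
              simp [this]
            · simp [hy]
        refine (lintegral_mono h1).trans ?_
        by_cases hz : z ∈ B'
        · simp only [Set.indicator_of_mem hz]
          rw [lintegral_indicator_one measurableSet_closedBall, Measure.addHaar_closedBall_center]
        · simp [Set.indicator_of_notMem hz]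
    _ = _ := by rw [lintegral_indicator_const measurableSet_closedBall]

/-- On a compact shell the ratios of `γ` to volume over small balls are bounded uniformly, and the
Besicovitch covering theorem passes the bound to subsets. Countably many shells cover everything but
the origin. -/
lemma IsLogConcaveMeasure.absolutelyContinuous [IsLocallyFiniteMeasure γ]
    (hlog : IsLogConcaveMeasure γ) (hrot : IsRotationInvariant γ) (h0 : γ {0} = 0) :
    γ ≪ volume := by
  refine Measure.AbsolutelyContinuous.mk fun s _ hs0 => ?_
  have hcov : s ⊆ {0} ∪ ⋃ k : ℕ, s ∩ {x | 1 / ((k : ℝ) + 1) ≤ ‖x‖ ∧ ‖x‖ ≤ k} := by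
    intro x hx
    rcases eq_or_ne x 0 with h | h
    · exact Or.inl h
    right
    obtain ⟨k1, hk1⟩ := exists_nat_ge ‖x‖
    obtain ⟨k2, hk2⟩ := exists_nat_one_div_lt (norm_pos_iff.2 h)
    refine Set.mem_iUnion.2 ⟨max k1 k2, hx, ?_, ?_⟩
    · refine le_trans ?_ hk2.le
      gcongr
      exact le_max_right _ _
    · exact hk1.trans (by exact_mod_cast le_max_left _ _)
  refine measure_mono_null hcov (measure_union_null h0 (measure_iUnion_null fun k => ?_))
  have hv0 : volume (closedBall (0 : EuclideanSpace ℝ (Fin (d + 1))) (1 / ((k : ℝ) + 1))) ≠ 0 :=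
    (measure_closedBall_pos _ _ (by positivity)).ne'
  let C : ℝ≥0∞ := γ (closedBall 0 ((k : ℝ) + 1)) /
    volume (closedBall (0 : EuclideanSpace ℝ (Fin (d + 1))) (1 / ((k : ℝ) + 1)))
  have hC : C ≠ ⊤ := ENNReal.div_ne_top (isCompact_closedBall _ _).measure_lt_top.ne hv0
  have hle : γ (s ∩ {x | 1 / ((k : ℝ) + 1) ≤ ‖x‖ ∧ ‖x‖ ≤ k}) ≤
      (C.toNNReal • (volume : Measure (EuclideanSpace ℝ (Fin (d + 1)))))
        (s ∩ {x | 1 / ((k : ℝ) + 1) ≤ ‖x‖ ∧ ‖x‖ ≤ k}) := by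
    refine (Besicovitch.vitaliFamily γ).measure_le_of_frequently_le _
      Measure.AbsolutelyContinuous.rfl _ fun x hx => ?_
    refine (Besicovitch.tendsto_filterAt γ x).frequently (Eventually.frequently ?_)
    filter_upwards [Ioc_mem_nhdsGT (zero_lt_one' ℝ)] with δ hδ
    have h1 := hlog.closedBall_mul_le hrot x hδ.1.le
    rw [Measure.smul_apply, ENNReal.smul_def, smul_eq_mul, ENNReal.coe_toNNReal hC,
      ← ENNReal.mul_div_right_comm, ENNReal.le_div_iff_mul_le (Or.inl hv0)
      (Or.inl (isCompact_closedBall _ _).measure_lt_top.ne)]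
    refine (mul_le_mul_right (measure_mono (closedBall_subset_closedBall hx.2.1)) _).trans
      (h1.trans ?_)
    rw [mul_comm, Measure.addHaar_closedBall_center volume x]
    refine mul_le_mul_left (measure_mono (closedBall_subset_closedBall ?_)) _
    linarith [hx.2.2, hδ.2]
  refine le_antisymm (hle.trans ?_) (zero_le)
  rw [Measure.smul_apply, measure_mono_null Set.inter_subset_left hs0, smul_zero]

end RadialDensity

/-! ### A pointwise density and the masses of centred balls. -/

section RadialDensity

open Filter Topology Metric
open scoped ENNReal

variable {d : ℕ} {γ : Measure (EuclideanSpace ℝ (Fin (d + 1)))}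

/-- The lower density of a measure with respect to the volume. -/
noncomputable def lowerDensity (γ : Measure (EuclideanSpace ℝ (Fin (d + 1))))
    (x : EuclideanSpace ℝ (Fin (d + 1))) : ℝ≥0∞ :=
  liminf (fun δ : ℝ => γ (closedBall x δ) / volume (closedBall x δ)) (𝓝[>] 0)

/-- The lower density is a version of the Radon–Nikodym derivative for which monotonicity and
log-concavity hold at every point, so that it can be restricted to a ray. -/
lemma lowerDensity_ae_eq [IsLocallyFiniteMeasure γ] : lowerDensity γ =ᵐ[volume] γ.rnDeriv volume := by
  filter_upwards [Besicovitch.ae_tendsto_rnDeriv γ volume] with x hx using hx.liminf_eq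

lemma withDensity_lowerDensity [IsLocallyFiniteMeasure γ]
    (hlog : IsLogConcaveMeasure γ) (hrot : IsRotationInvariant γ) (h0 : γ {0} = 0) :
    volume.withDensity (lowerDensity γ) = γ := by
  rw [withDensity_congr_ae lowerDensity_ae_eq]
  exact Measure.withDensity_rnDeriv_eq _ _ (hlog.absolutelyContinuous hrot h0)

lemma lowerDensity_anti (hlog : IsLogConcaveMeasure γ) (hrot : IsRotationInvariant γ)
    {x y : EuclideanSpace ℝ (Fin (d + 1))} (h : ‖x‖ ≤ ‖y‖) :
    lowerDensity γ y ≤ lowerDensity γ x := by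
  refine liminf_le_liminf ?_
  filter_upwards [self_mem_nhdsWithin] with δ hδ
  rw [Measure.addHaar_closedBall_center volume x, Measure.addHaar_closedBall_center volume y]
  exact ENNReal.div_le_div_right (hlog.closedBall_anti hrot h (le_of_lt hδ)) _

lemma lowerDensity_lt_top [IsLocallyFiniteMeasure γ] (hlog : IsLogConcaveMeasure γ)
    (hrot : IsRotationInvariant γ) {x : EuclideanSpace ℝ (Fin (d + 1))} (hx : x ≠ 0) :
    lowerDensity γ x < ⊤ := by
  have hv0 : volume (closedBall (0 : EuclideanSpace ℝ (Fin (d + 1))) ‖x‖) ≠ 0 :=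
    (measure_closedBall_pos _ _ (norm_pos_iff.2 hx)).ne'
  have hle : lowerDensity γ x ≤ γ (closedBall 0 (‖x‖ + 1)) /
      volume (closedBall (0 : EuclideanSpace ℝ (Fin (d + 1))) ‖x‖) := by
    refine liminf_le_of_frequently_le' (Eventually.frequently ?_)
    filter_upwards [Ioc_mem_nhdsGT (zero_lt_one' ℝ)] with δ hδ
    have hvδ : volume (closedBall x δ) ≠ 0 := (measure_closedBall_pos _ _ hδ.1).ne'
    rw [ENNReal.div_le_iff_le_mul (Or.inl hvδ) (Or.inl (isCompact_closedBall _ _).measure_lt_top.ne),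
      ← ENNReal.mul_div_right_comm, ENNReal.le_div_iff_mul_le (Or.inl hv0)
      (Or.inl (isCompact_closedBall _ _).measure_lt_top.ne)]
    refine (hlog.closedBall_mul_le hrot x hδ.1.le).trans ?_
    rw [mul_comm, Measure.addHaar_closedBall_center volume x]
    exact mul_le_mul_left (measure_mono (closedBall_subset_closedBall (by linarith [hδ.2]))) _
  exact hle.trans_lt (ENNReal.div_lt_top (isCompact_closedBall _ _).measure_lt_top.ne hv0)

/-- Divide the inequality for small balls of equal radius by their volume. A lower limit of products
is at least the product of the lower limits, which is the direction needed. -/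
lemma lowerDensity_logConcave (hlog : IsLogConcaveMeasure γ)
    (x y : EuclideanSpace ℝ (Fin (d + 1))) {lam : ℝ} (hl : lam ∈ Set.Icc (0 : ℝ) 1) :
    lowerDensity γ x ^ lam * lowerDensity γ y ^ (1 - lam) ≤
      lowerDensity γ (lam • x + (1 - lam) • y) := by
  have h1 : 0 ≤ 1 - lam := by linarith [hl.2]
  have hpow {s : ℝ} (hs : 0 ≤ s) (z : EuclideanSpace ℝ (Fin (d + 1))) : lowerDensity γ z ^ s =
      liminf (fun δ : ℝ => (γ (closedBall z δ) / volume (closedBall z δ)) ^ s) (𝓝[>] 0) :=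
    (ENNReal.monotone_rpow_of_nonneg hs).map_liminf_of_continuousAt _
      ENNReal.continuous_rpow_const.continuousAt
  rw [hpow hl.1, hpow h1]
  refine ENNReal.le_liminf_mul.trans (liminf_le_liminf ?_)
  filter_upwards [self_mem_nhdsWithin] with δ hδ
  have hδ : 0 < δ := hδ
  simp only [Pi.mul_apply]
  rw [Measure.addHaar_closedBall_center volume x, Measure.addHaar_closedBall_center volume y,
    Measure.addHaar_closedBall_center volume (lam • x + (1 - lam) • y)]
  set v := volume (closedBall (0 : EuclideanSpace ℝ (Fin (d + 1))) δ) with hv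
  have hv0 : v ≠ 0 := (measure_closedBall_pos _ _ hδ).ne'
  have hvt : v ≠ ⊤ := (isCompact_closedBall _ _).measure_lt_top.ne
  rw [ENNReal.div_rpow_of_nonneg _ _ hl.1, ENNReal.div_rpow_of_nonneg _ _ h1]
  calc _ = (γ (closedBall x δ) ^ lam * γ (closedBall y δ) ^ (1 - lam)) *
        (v ^ lam * v ^ (1 - lam))⁻¹ := by
        rw [ENNReal.mul_inv (Or.inr (ENNReal.rpow_ne_top_of_nonneg h1 hvt))
          (Or.inl (ENNReal.rpow_ne_top_of_nonneg hl.1 hvt)), div_eq_mul_inv, div_eq_mul_inv]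
        ring
    _ = (γ (closedBall x δ) ^ lam * γ (closedBall y δ) ^ (1 - lam)) / v := by
        rw [← ENNReal.rpow_add_of_nonneg _ _ hl.1 h1, add_sub_cancel, ENNReal.rpow_one,
          div_eq_mul_inv]
    _ ≤ _ := ENNReal.div_le_div_right (hlog.closedBall_le x y hδ.le hl) _

/-- The masses of the centred balls, on a logarithmic scale, are the integrals of a log-concave
function. -/
theorem exists_logConcave_radial [IsLocallyFiniteMeasure γ] (hlog : IsLogConcaveMeasure γ)
    (hrot : IsRotationInvariant γ) (h0 : γ {0} = 0) {R : ℝ} (hR : 0 < R) :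
    ∃ w : ℝ → ℝ, (∀ t, 0 ≤ w t) ∧
      (∀ x y, ∀ lam ∈ Set.Icc (0 : ℝ) 1,
        w x ^ lam * w y ^ (1 - lam) ≤ w (lam * x + (1 - lam) * y)) ∧
      (∀ x y, x ≤ y → Real.exp (-((d : ℝ) + 1) * y) * w y ≤ Real.exp (-((d : ℝ) + 1) * x) * w x) ∧
      (∀ t, IntegrableOn w (Set.Iic t)) ∧
      ∀ t, γ.real (closedBall 0 (R * Real.exp t)) = ∫ x in Set.Iic t, w x := by
  let e : EuclideanSpace ℝ (Fin (d + 1)) := EuclideanSpace.single 0 1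
  have he : ‖e‖ = 1 := by simp [e]
  let f : ℝ → ℝ := fun s => (lowerDensity γ (s • e)).toReal
  have hne {s : ℝ} (hs : 0 < s) : s • e ≠ 0 := by
    rw [← norm_pos_iff, norm_smul, he, mul_one]; simpa using hs.ne'
  have hnorm {s : ℝ} (hs : 0 < s) : ‖s • e‖ = s := by
    rw [norm_smul, he, mul_one, Real.norm_of_nonneg hs.le]
  have hf0 (s) : 0 ≤ f s := ENNReal.toReal_nonneg
  have hfanti {s t : ℝ} (hs : 0 < s) (hst : s ≤ t) : f t ≤ f s := by
    refine ENNReal.toReal_mono (lowerDensity_lt_top hlog hrot (hne hs)).ne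
      (lowerDensity_anti hlog hrot ?_)
    rwa [hnorm hs, hnorm (hs.trans_le hst)]
  have hflog {s t lam : ℝ} (hs : 0 < s) (ht : 0 < t) (hl : lam ∈ Set.Icc (0 : ℝ) 1) :
      f s ^ lam * f t ^ (1 - lam) ≤ f (lam * s + (1 - lam) * t) := by
    have h1 : 0 ≤ 1 - lam := by linarith [hl.2]
    have hpos : 0 < lam * s + (1 - lam) * t := by
      rcases hl.1.eq_or_lt with h | h
      · rw [← h]; simpa using ht
      · have := mul_pos h hs
        have := mul_nonneg h1 ht.le
        linarith
    have := lowerDensity_logConcave hlog (s • e) (t • e) hl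
    rw [smul_smul, smul_smul, ← add_smul] at this
    have := ENNReal.toReal_mono (lowerDensity_lt_top hlog hrot (hne hpos)).ne this
    rwa [ENNReal.toReal_mul, ← ENNReal.toReal_rpow, ← ENNReal.toReal_rpow] at this
  have hfeq (x : EuclideanSpace ℝ (Fin (d + 1))) : (lowerDensity γ x).toReal = f ‖x‖ := by
    have hx : ‖‖x‖ • e‖ = ‖x‖ := by rw [norm_smul, he, mul_one, norm_norm]
    have := le_antisymm (lowerDensity_anti hlog hrot hx.le) (lowerDensity_anti hlog hrot hx.ge)
    simp only [f, this]
  have hae : AEMeasurable (lowerDensity γ) volume :=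
    ⟨_, Measure.measurable_rnDeriv γ volume, lowerDensity_ae_eq⟩
  -- This is the surface area of the unit sphere, the constant of polar integration.
  set c : ℝ := (d + 1 : ℕ) * volume.real (ball (0 : EuclideanSpace ℝ (Fin (d + 1))) 1) with hc
  have hc0 : 0 ≤ c := by positivity
  have hlt : ∀ᵐ x ∂(volume : Measure (EuclideanSpace ℝ (Fin (d + 1)))), lowerDensity γ x < ⊤ := by
    have : ∀ᵐ x ∂(volume : Measure (EuclideanSpace ℝ (Fin (d + 1)))), x ≠ 0 := by
      simp [ae_iff]
    filter_upwards [this] with x hx using lowerDensity_lt_top hlog hrot hx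
  have hball (r : ℝ) : γ (closedBall 0 r) = ∫⁻ x in closedBall 0 r, lowerDensity γ x := by
    rw [← withDensity_apply _ measurableSet_closedBall, withDensity_lowerDensity hlog hrot h0]
  have hballR (r : ℝ) : γ.real (closedBall 0 r) =
      ∫ x in closedBall (0 : EuclideanSpace ℝ (Fin (d + 1))) r, f ‖x‖ := by
    simp only [← hfeq]
    rw [Measure.real, hball r, integral_toReal hae.restrict (ae_restrict_of_ae hlt)]
  have hintB (r : ℝ) : IntegrableOn (fun x : EuclideanSpace ℝ (Fin (d + 1)) => f ‖x‖)
      (closedBall 0 r) := by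
    simp only [← hfeq]
    refine integrable_toReal_of_lintegral_ne_top hae.restrict ?_
    rw [← hball r]
    exact (isCompact_closedBall _ _).measure_lt_top.ne
  have hind (r : ℝ) (x : EuclideanSpace ℝ (Fin (d + 1))) :
      (closedBall 0 r).indicator (fun x => f ‖x‖) x = (Set.Iic r).indicator f ‖x‖ := by
    by_cases hx : ‖x‖ ≤ r
    · rw [Set.indicator_of_mem (by simpa using hx), Set.indicator_of_mem (by simpa using hx)]
    · rw [Set.indicator_of_notMem (by simpa using hx), Set.indicator_of_notMem (by simpa using hx)]
  have hpolint (r : ℝ) : IntegrableOn (fun y => y ^ d * f y) (Set.Ioc 0 r) := by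
    have h1 := (hintB r).integrable_indicator measurableSet_closedBall
    rw [show (closedBall (0 : EuclideanSpace ℝ (Fin (d + 1))) r).indicator (fun x => f ‖x‖) =
      fun x => (Set.Iic r).indicator f ‖x‖ from funext (hind r),
      integrable_fun_norm_addHaar] at h1
    simp only [finrank_euclideanSpace, Fintype.card_fin, Nat.add_sub_cancel, smul_eq_mul] at h1
    have h2 := h1.mono_set (fun y (hy : y ∈ Set.Ioc 0 r) => hy.1)
    refine h2.congr_fun (fun y hy => ?_) measurableSet_Ioc
    simp only
    rw [Set.indicator_of_mem (by exact hy.2)]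
  have hpol (r : ℝ) : γ.real (closedBall 0 r) = c * ∫ y in Set.Ioc 0 r, y ^ d * f y := by
    rw [hballR, ← integral_indicator measurableSet_closedBall]
    simp only [hind]
    rw [integral_fun_norm_addHaar]
    simp only [finrank_euclideanSpace, Fintype.card_fin, Nat.add_sub_cancel, smul_eq_mul,
      nsmul_eq_mul]
    rw [← mul_assoc, ← hc]
    congr 1
    have : ∀ y, y ^ d * (Set.Iic r).indicator f y = (Set.Iic r).indicator (fun y => y ^ d * f y) y :=
      fun y => by by_cases hy : y ∈ Set.Iic r <;> simp [hy]
    simp only [this]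
    rw [setIntegral_indicator measurableSet_Iic, Set.Ioi_inter_Iic]
  have himg (t : ℝ) : (fun x => R * Real.exp x) '' Set.Iic t = Set.Ioc 0 (R * Real.exp t) := by
    ext y
    constructor
    · rintro ⟨x, hx, rfl⟩
      exact ⟨by positivity, by simpa [hR] using hx⟩
    · rintro ⟨hy0, hy⟩
      refine ⟨Real.log (y / R), ?_, ?_⟩
      · rw [Set.mem_Iic, Real.log_le_iff_le_exp (by positivity), div_le_iff₀ hR]; linarith
      · simp only
        rw [Real.exp_log (by positivity)]; field_simp
  have hder (t : ℝ) : ∀ x ∈ Set.Iic t,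
      HasDerivWithinAt (fun x => R * Real.exp x) (R * Real.exp x) (Set.Iic t) x :=
    fun x _ => ((Real.hasDerivAt_exp x).const_mul R).hasDerivWithinAt
  have hinj (t : ℝ) : Set.InjOn (fun x => R * Real.exp x) (Set.Iic t) := by
    intro x _ y _ hxy
    exact Real.exp_injective (mul_left_cancel₀ hR.ne' hxy)
  have hwe : ∀ x, |R * Real.exp x| • ((R * Real.exp x) ^ d * f (R * Real.exp x)) =
      (R * Real.exp x) ^ (d + 1) * f (R * Real.exp x) := fun x => by
    rw [abs_of_pos (by positivity), smul_eq_mul]; ring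
  -- Substituting `r = R exp x` in polar coordinates, `dr = r dx` raises the power of the radius
  -- from `d` to `d + 1`.
  refine ⟨fun x => c * ((R * Real.exp x) ^ (d + 1) * f (R * Real.exp x)), fun t => ?_, ?_, ?_, ?_,
    fun t => ?_⟩
  · have := hf0 (R * Real.exp t); positivity
  · intro x y lam hl
    have h1 : 0 ≤ 1 - lam := by linarith [hl.2]
    have hx : 0 < R * Real.exp x := by positivity
    have hy : 0 < R * Real.exp y := by positivity
    -- Convexity of `exp` puts the new radius below the average of the radii, and `f` decreases, so
    -- log-concavity survives the change of scale.
    have key : f (R * Real.exp x) ^ lam * f (R * Real.exp y) ^ (1 - lam) ≤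
        f (R * Real.exp (lam * x + (1 - lam) * y)) := by
      refine (hflog hx hy hl).trans (hfanti (by positivity) ?_)
      have := convexOn_exp.2 (Set.mem_univ x) (Set.mem_univ y) hl.1 h1 (by ring)
      simp only [smul_eq_mul] at this
      nlinarith
    have hmul : ∀ a : ℝ, 0 ≤ a → a ^ lam * a ^ (1 - lam) = a := fun a ha => by
      rcases ha.eq_or_lt with h | h
      · rcases hl.1.eq_or_lt with h' | h'
        · rw [← h']; simp
        · rw [← h, Real.zero_rpow h'.ne', zero_mul]
      · rw [← Real.rpow_add h, add_sub_cancel, Real.rpow_one]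
    have hexp : ((R * Real.exp x) ^ (d + 1)) ^ lam * ((R * Real.exp y) ^ (d + 1)) ^ (1 - lam) =
        (R * Real.exp (lam * x + (1 - lam) * y)) ^ (d + 1) := by
      rw [← Real.rpow_pow_comm hx.le, ← Real.rpow_pow_comm hy.le, ← mul_pow]
      congr 1
      rw [Real.mul_rpow hR.le (Real.exp_pos _).le, Real.mul_rpow hR.le (Real.exp_pos _).le,
        ← Real.exp_mul, ← Real.exp_mul, Real.exp_add, mul_comm lam, mul_comm (1 - lam)]
      calc _ = (R ^ lam * R ^ (1 - lam)) * (Real.exp (x * lam) * Real.exp (y * (1 - lam))) := by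
            ring
        _ = _ := by rw [hmul R hR.le]
    have hfx := hf0 (R * Real.exp x)
    have hfy := hf0 (R * Real.exp y)
    rw [Real.mul_rpow hc0 (by positivity), Real.mul_rpow hc0 (by positivity),
      Real.mul_rpow (by positivity) hfx, Real.mul_rpow (by positivity) hfy]
    calc _ = (c ^ lam * c ^ (1 - lam)) * ((((R * Real.exp x) ^ (d + 1)) ^ lam *
          ((R * Real.exp y) ^ (d + 1)) ^ (1 - lam)) *
          (f (R * Real.exp x) ^ lam * f (R * Real.exp y) ^ (1 - lam))) := by ring
      _ ≤ _ := by
        rw [hmul c hc0, hexp]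
        exact mul_le_mul_of_nonneg_left (mul_le_mul_of_nonneg_left key (by positivity)) hc0
  · intro x y hxy
    have h1 (x : ℝ) : Real.exp (-((d : ℝ) + 1) * x) *
        (c * ((R * Real.exp x) ^ (d + 1) * f (R * Real.exp x))) =
        c * R ^ (d + 1) * f (R * Real.exp x) := by
      have : Real.exp (-((d : ℝ) + 1) * x) * Real.exp x ^ (d + 1) = 1 := by
        rw [← Real.exp_nat_mul, ← Real.exp_add]
        push_cast
        simp only [Real.exp_eq_one_iff]
        ring
      rw [mul_pow]
      calc _ = (Real.exp (-((d : ℝ) + 1) * x) * Real.exp x ^ (d + 1)) *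
            (c * R ^ (d + 1) * f (R * Real.exp x)) := by ring
        _ = _ := by rw [this, one_mul]
    rw [h1, h1]
    refine mul_le_mul_of_nonneg_left (hfanti (by positivity) ?_) (by positivity)
    gcongr
  · intro t
    refine Integrable.const_mul ?_ c
    have := (integrableOn_image_iff_integrableOn_abs_deriv_smul measurableSet_Iic (hder t) (hinj t)
      (fun y => y ^ d * f y)).1 (by rw [himg]; exact hpolint _)
    simpa only [hwe, IntegrableOn] using this
  · rw [hpol, ← himg, integral_image_eq_integral_abs_deriv_smul measurableSet_Iic (hder t) (hinj t)
      (fun y => y ^ d * f y), integral_const_mul]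
    simp only [hwe]

lemma IsLogConcaveMeasure.closedBall_pos [IsLocallyFiniteMeasure γ] (hlog : IsLogConcaveMeasure γ)
    (hrot : IsRotationInvariant γ) (hne : γ ≠ 0) {r : ℝ} (hr : 0 < r) :
    0 < γ.real (closedBall 0 r) := by
  refine ENNReal.toReal_pos (fun h => hne ?_) (isCompact_closedBall _ _).measure_lt_top.ne
  refine Measure.measure_univ_eq_zero.1 (measure_null_of_locally_null _ fun x _ =>
    ⟨closedBall x r, mem_nhdsWithin_of_mem_nhds (closedBall_mem_nhds x hr), ?_⟩)
  exact le_antisymm ((hlog.closedBall_anti hrot (by simp) hr.le).trans h.le) zero_le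

end RadialDensity

/-! ### Logarithmic slopes of the ball masses. -/

section Profile

open Filter Topology

lemma rpow_mul_rpow_one_sub {a lam : ℝ} (ha : 0 ≤ a) (hl : lam ∈ Set.Icc (0 : ℝ) 1) :
    a ^ lam * a ^ (1 - lam) = a := by
  rw [← Real.rpow_add_of_nonneg ha hl.1 (by linarith [hl.2]), add_sub_cancel, Real.rpow_one]

/-- A positive function `H` with logarithmic slopes `p`, as for the masses of the balls of radius
`exp t` under a rotation invariant log-concave measure in dimension `n`. -/
structure IsRadialProfile (H p : ℝ → ℝ) (n : ℝ) : Prop where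
  pos : ∀ t, 0 < H t
  anti : Antitone p
  nonneg : ∀ t, 0 ≤ p t
  le : ∀ t, p t ≤ n
  le_mul_exp : ∀ s t, H t ≤ H s * Real.exp (p s * (t - s))
  left_cont : Tendsto p (𝓝[<] 0) (𝓝 (p 0))
  concaveOn : p 0 = 0 → ∃ δ > 0, ConcaveOn ℝ (Set.Ici (-δ)) H

/-- Iterate over `N` equal steps and let `(1 + x/N)^N` tend to `exp x`. This replaces a differential
inequality where `F` need not be differentiable. -/
lemma mul_exp_le_of_forall_mul_le {F : ℝ → ℝ} {c s t : ℝ} (hst : s ≤ t)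
    (h : ∀ a b, s ≤ a → a ≤ b → b ≤ t → F a * (1 + c * (b - a)) ≤ F b) :
    F s * Real.exp (c * (t - s)) ≤ F t := by
  have hlim : Tendsto (fun N : ℕ => F s * (1 + c * (t - s) / N) ^ N) atTop
      (𝓝 (F s * Real.exp (c * (t - s)))) :=
    (Real.tendsto_one_add_div_pow_exp _).const_mul _
  refine le_of_tendsto hlim ?_
  have hlim0 : Tendsto (fun N : ℕ => 1 + c * (t - s) / (N : ℝ)) atTop (𝓝 (1 + 0)) :=
    tendsto_const_nhds.add (tendsto_const_div_atTop_nhds_zero_nat _)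
  rw [add_zero] at hlim0
  filter_upwards [hlim0.eventually (lt_mem_nhds one_pos), eventually_gt_atTop 0] with N hN hN0
  have hN0' : (0 : ℝ) < N := by exact_mod_cast hN0
  have key : ∀ k : ℕ, k ≤ N → F s * (1 + c * (t - s) / N) ^ k ≤ F (s + k * ((t - s) / N)) := by
    intro k
    induction k with
    | zero => simp
    | succ k ih =>
      intro hk
      have h1 := ih (by omega)
      have hd : 0 ≤ (t - s) / N := div_nonneg (by linarith) hN0'.le
      have hkN : ((k + 1 : ℕ) : ℝ) * ((t - s) / N) ≤ t - s := by
        have : ((k + 1 : ℕ) : ℝ) ≤ N := by exact_mod_cast hk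
        calc _ ≤ (N : ℝ) * ((t - s) / N) := mul_le_mul_of_nonneg_right this hd
          _ = _ := by field_simp
      have h2 := h (s + k * ((t - s) / N)) (s + (k + 1 : ℕ) * ((t - s) / N))
        (by have : 0 ≤ (k : ℝ) * ((t - s) / N) := by positivity
            linarith)
        (by push_cast; nlinarith) (by linarith)
      refine le_trans ?_ h2
      have e : c * (s + (k + 1 : ℕ) * ((t - s) / N) - (s + k * ((t - s) / N))) =
          c * (t - s) / N := by push_cast; ring
      rw [e, pow_succ, ← mul_assoc]
      exact mul_le_mul_of_nonneg_right h1 hN.le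
  have := key N le_rfl
  rwa [mul_div_cancel₀ _ hN0'.ne', add_sub_cancel] at this

section

variable {w : ℝ → ℝ} {n : ℝ}

/-- The points `s` and `x + h` lie between `x` and `s + h` with exchanged weights; multiply the two
log-concavity inequalities. Integrating over `x ≤ s` makes `w / H` decreasing. -/
lemma mul_le_mul_of_logConcave (hw0 : ∀ t, 0 ≤ w t)
    (hw : ∀ x y, ∀ lam ∈ Set.Icc (0 : ℝ) 1,
      w x ^ lam * w y ^ (1 - lam) ≤ w (lam * x + (1 - lam) * y))
    {x s h : ℝ} (hxs : x ≤ s) (hh : 0 ≤ h) : w (s + h) * w x ≤ w (x + h) * w s := by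
  rcases hh.eq_or_lt with rfl | hh
  · simp [mul_comm]
  have hD : 0 < s + h - x := by linarith
  set l := (s - x) / (s + h - x) with hl
  have hlD : l * (s + h - x) = s - x := div_mul_cancel₀ _ hD.ne'
  have hl01 : l ∈ Set.Icc (0 : ℝ) 1 :=
    ⟨div_nonneg (by linarith) hD.le, (div_le_one hD).2 (by linarith)⟩
  have h1 := hw (s + h) x l hl01
  have h2 := hw x (s + h) l hl01
  have e1 : l * (s + h) + (1 - l) * x = s := by linarith
  have e2 : l * x + (1 - l) * (s + h) = x + h := by linarith
  rw [e1] at h1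
  rw [e2] at h2
  calc w (s + h) * w x = (w (s + h) ^ l * w (s + h) ^ (1 - l)) * (w x ^ l * w x ^ (1 - l)) := by
        rw [rpow_mul_rpow_one_sub (hw0 _) hl01, rpow_mul_rpow_one_sub (hw0 _) hl01]
    _ = (w x ^ l * w (s + h) ^ (1 - l)) * (w (s + h) ^ l * w x ^ (1 - l)) := by ring
    _ ≤ _ := mul_le_mul h2 h1 (mul_nonneg (Real.rpow_nonneg (hw0 _) _)
        (Real.rpow_nonneg (hw0 _) _)) (hw0 _)

lemma min_le_of_logConcave (hw0 : ∀ t, 0 ≤ w t)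
    (hw : ∀ x y, ∀ lam ∈ Set.Icc (0 : ℝ) 1,
      w x ^ lam * w y ^ (1 - lam) ≤ w (lam * x + (1 - lam) * y))
    {a m b : ℝ} (h1 : a ≤ m) (h2 : m ≤ b) : min (w a) (w b) ≤ w m := by
  rcases (h1.trans h2).eq_or_lt with h | h
  · have : m = a := le_antisymm (h ▸ h2) h1
    rw [this]; exact min_le_left _ _
  have hD : 0 < b - a := by linarith
  set l := (b - m) / (b - a) with hl
  have hlD : l * (b - a) = b - m := div_mul_cancel₀ _ hD.ne'
  have hl01 : l ∈ Set.Icc (0 : ℝ) 1 :=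
    ⟨div_nonneg (by linarith) hD.le, (div_le_one hD).2 (by linarith)⟩
  have h3 := hw a b l hl01
  rw [show l * a + (1 - l) * b = m by linarith] at h3
  have hm : 0 ≤ min (w a) (w b) := le_min (hw0 _) (hw0 _)
  refine le_trans ?_ h3
  rw [← rpow_mul_rpow_one_sub hm hl01]
  exact mul_le_mul (Real.rpow_le_rpow hm (min_le_left _ _) hl01.1)
    (Real.rpow_le_rpow hm (min_le_right _ _) (by linarith [hl01.2]))
    (Real.rpow_nonneg hm _) (Real.rpow_nonneg (hw0 _) _)

/-- The natural slope is `w / H`. It decreases by log-concavity of `w`, and it is at most `n`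
because `exp(-n x) w x` decreases, so the integral up to `t` is at least `w t / n`. Monotonicity
then gives the tangent exponentials. -/
theorem exists_isRadialProfile (hn : 0 < n) (hw0 : ∀ t, 0 ≤ w t)
    (hw : ∀ x y, ∀ lam ∈ Set.Icc (0 : ℝ) 1,
      w x ^ lam * w y ^ (1 - lam) ≤ w (lam * x + (1 - lam) * y))
    (hwn : ∀ x y, x ≤ y → Real.exp (-n * y) * w y ≤ Real.exp (-n * x) * w x)
    (hint : ∀ t, IntegrableOn w (Set.Iic t)) {H : ℝ → ℝ}
    (hH : ∀ t, H t = ∫ x in Set.Iic t, w x) (hpos : ∀ t, 0 < H t) :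
    ∃ p, IsRadialProfile H p n := by
  have hsub {a b : ℝ} (hab : a ≤ b) : H b - H a = ∫ x in Set.Ioc a b, w x := by
    rw [hH, hH, intervalIntegral.integral_Iic_sub_Iic (hint a) (hint b),
      intervalIntegral.integral_of_le hab]
  have hintI (a b : ℝ) : IntegrableOn w (Set.Ioc a b) :=
    (hint b).mono_set fun x hx => hx.2
  have hmono : Monotone H := fun a b hab => by
    have := hsub hab
    have h2 : 0 ≤ ∫ x in Set.Ioc a b, w x := integral_nonneg fun x => hw0 x
    linarith
  have hupper {a b m : ℝ} (hab : a ≤ b) (h : ∀ x ∈ Set.Ioc a b, w x ≤ m) :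
      H b - H a ≤ m * (b - a) := by
    rw [hsub hab]
    calc _ ≤ ∫ x in Set.Ioc a b, m :=
          setIntegral_mono_on (hintI a b) (by simp) measurableSet_Ioc h
      _ = _ := by simp [hab, mul_comm]
  have hlower {a b m : ℝ} (hab : a ≤ b) (h : ∀ x ∈ Set.Ioc a b, m ≤ w x) :
      m * (b - a) ≤ H b - H a := by
    rw [hsub hab]
    calc _ = ∫ x in Set.Ioc a b, m := by simp [hab, mul_comm]
      _ ≤ _ := setIntegral_mono_on (by simp) (hintI a b) measurableSet_Ioc h
  let q : ℝ → ℝ := fun t => w t / H t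
  have hq0 (t) : 0 ≤ q t := div_nonneg (hw0 t) (hpos t).le
  have hwq (t) : w t = q t * H t := (div_mul_cancel₀ _ (hpos t).ne').symm
  have hqanti : Antitone q := by
    intro s t hst
    simp only [q]
    rw [div_le_div_iff₀ (hpos t) (hpos s)]
    obtain ⟨h, hh, rfl⟩ : ∃ h, 0 ≤ h ∧ t = s + h := ⟨t - s, by linarith, by ring⟩
    have hshift : ∫ x in Set.Iic s, w (x + h) = H (s + h) := by
      have := (measurePreserving_add_right (volume : Measure ℝ) h).setIntegral_preimage_emb
        (MeasurableEquiv.addRight h).measurableEmbedding w (Set.Iic (s + h))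
      rw [← hH, Set.preimage_add_const_Iic, add_sub_cancel_right] at this
      exact this
    have hshiftI : IntegrableOn (fun x => w (x + h)) (Set.Iic s) := by
      have := (measurePreserving_add_right (volume : Measure ℝ) h).integrableOn_comp_preimage
        (MeasurableEquiv.addRight h).measurableEmbedding (f := w) (s := Set.Iic (s + h))
      rw [Set.preimage_add_const_Iic, add_sub_cancel_right] at this
      exact this.2 (hint _)
    rw [hH s, mul_comm (w s), ← hshift, ← integral_const_mul, ← integral_mul_const]
    refine setIntegral_mono_on ((hint s).const_mul _) (hshiftI.mul_const _) measurableSet_Iic ?_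
    intro x hx
    exact mul_le_mul_of_logConcave hw0 hw hx hh
  have hqn (t) : q t ≤ n := by
    simp only [q]
    rw [div_le_iff₀ (hpos t), hH]
    have h1 : ∫ x in Set.Iic t, w t * Real.exp (-n * t) * Real.exp (n * x) ≤
        ∫ x in Set.Iic t, w x := by
      refine setIntegral_mono_on ((integrableOn_exp_mul_Iic hn t).const_mul _) (hint t)
        measurableSet_Iic fun x hx => ?_
      have h2 := mul_le_mul_of_nonneg_right (hwn x t hx) (Real.exp_pos (n * x)).le
      calc _ = Real.exp (-n * t) * w t * Real.exp (n * x) := by ring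
        _ ≤ _ := h2
        _ = (Real.exp (-n * x) * Real.exp (n * x)) * w x := by ring
        _ = w x := by rw [← Real.exp_add]; simp
    rw [integral_const_mul, integral_exp_mul_Iic hn] at h1
    have h2 : w t * Real.exp (-n * t) * (Real.exp (n * t) / n) = w t / n := by
      calc _ = w t * (Real.exp (-n * t) * Real.exp (n * t)) / n := by ring
        _ = _ := by rw [← Real.exp_add]; simp
    rw [h2, div_le_iff₀ hn] at h1
    linarith
  have hqexp (s t) : H t ≤ H s * Real.exp (q s * (t - s)) := by
    rcases le_total s t with hst | hts
    -- An upper bound for `H` going forward is a lower bound going backward, hence the reflection.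
    · have h1 := mul_exp_le_of_forall_mul_le (F := fun x => H (-x)) (c := -q s) (s := -t)
        (t := -s) (by linarith) fun a b h1 h2 h3 => by
          have := hupper (a := -b) (b := -a) (m := q s * H (-a)) (by linarith) fun x hx => by
            rw [hwq]
            exact mul_le_mul (hqanti (by linarith [hx.1])) (hmono hx.2) (hpos _).le (hq0 _)
          linarith
      simp only [neg_neg] at h1
      have h2 : -q s * (-s - -t) = -(q s * (t - s)) := by ring
      rw [h2, Real.exp_neg, ← div_eq_mul_inv, div_le_iff₀ (Real.exp_pos _)] at h1
      exact h1
    · have h1 := mul_exp_le_of_forall_mul_le (F := H) (c := q s) hts fun a b h1 h2 h3 => by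
          have := hlower (a := a) (b := b) (m := q s * H a) h2 fun x hx => by
            rw [hwq]
            exact mul_le_mul (hqanti (hx.2.trans h3)) (hmono hx.1.le) (hpos _).le (hq0 _)
          linarith
      have h2 : q s * (s - t) = -(q s * (t - s)) := by ring
      rw [h2, Real.exp_neg, ← div_eq_mul_inv, div_le_iff₀ (Real.exp_pos _)] at h1
      exact h1
  have hHcont : Continuous H := by
    refine continuous_iff_continuousAt.2 fun s => ?_
    have hup : Tendsto (fun t => H s * Real.exp (n * |t - s|)) (𝓝 s) (𝓝 (H s)) := by
      have : Continuous fun t => H s * Real.exp (n * |t - s|) := by fun_prop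
      simpa using this.tendsto s
    have hlo : Tendsto (fun t => H s * Real.exp (-(n * |t - s|))) (𝓝 s) (𝓝 (H s)) := by
      have : Continuous fun t => H s * Real.exp (-(n * |t - s|)) := by fun_prop
      simpa using this.tendsto s
    have hb (a b : ℝ) : q a * (b - a) ≤ n * |b - a| :=
      (mul_le_mul_of_nonneg_left (le_abs_self _) (hq0 a)).trans
        (mul_le_mul_of_nonneg_right (hqn a) (abs_nonneg _))
    refine tendsto_of_tendsto_of_tendsto_of_le_of_le hlo hup (fun t => ?_) fun t => ?_
    · change H s * Real.exp (-(n * |t - s|)) ≤ H t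
      rw [Real.exp_neg, ← div_eq_mul_inv, div_le_iff₀ (Real.exp_pos _)]
      refine (hqexp t s).trans (mul_le_mul_of_nonneg_left (Real.exp_le_exp.2 ?_) (hpos t).le)
      rw [abs_sub_comm]; exact hb t s
    · exact (hqexp s t).trans
        (mul_le_mul_of_nonneg_left (Real.exp_le_exp.2 (hb s t)) (hpos s).le)
  have hlim : Tendsto q (𝓝[<] 0) (𝓝 (Function.leftLim q 0)) := hqanti.tendsto_leftLim 0
  set l := Function.leftLim q 0 with hl
  have hle_l {t : ℝ} (ht : t < 0) : l ≤ q t := hqanti.leftLim_le ht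
  have hl_le : q 0 ≤ l := hqanti.le_leftLim le_rfl
  -- Taking the left limit at `0` makes `p` left continuous there; the tangent inequality passes to
  -- this limit.
  let p : ℝ → ℝ := Function.update q 0 l
  have hp0 : p 0 = l := by simp [p]
  have hpne {t : ℝ} (ht : t ≠ 0) : p t = q t := by simp [p, ht]
  have hpanti : Antitone p := by
    intro s t hst
    rcases hst.eq_or_lt with rfl | hst
    · exact le_rfl
    rcases eq_or_ne s 0 with rfl | hs
    · rw [hp0, hpne hst.ne']; exact (hqanti hst.le).trans hl_le
    rcases eq_or_ne t 0 with rfl | ht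
    · rw [hp0, hpne hs]; exact hle_l hst
    · rw [hpne hs, hpne ht]; exact hqanti hst.le
  have hevne : ∀ᶠ t in 𝓝[<] (0 : ℝ), p t = q t := by
    filter_upwards [self_mem_nhdsWithin] with t ht using hpne (ne_of_lt ht)
  have hl0 : 0 ≤ l := (hq0 0).trans hl_le
  refine ⟨p, hpos, hpanti, fun t => ?_, fun t => ?_, fun s t => ?_, ?_, fun h0 => ?_⟩
  · rcases eq_or_ne t 0 with rfl | ht
    · rw [hp0]; exact hl0
    · rw [hpne ht]; exact hq0 t
  · rcases eq_or_ne t 0 with rfl | ht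
    · rw [hp0]; exact (hle_l (by norm_num : (-1 : ℝ) < 0)).trans (hqn _)
    · rw [hpne ht]; exact hqn t
  · rcases eq_or_ne s 0 with rfl | hs
    · rw [hp0]
      have h1 : Tendsto (fun s => H s * Real.exp (q s * (t - s))) (𝓝[<] 0)
          (𝓝 (H 0 * Real.exp (l * (t - 0)))) := by
        refine ((hHcont.tendsto 0).mono_left nhdsWithin_le_nhds).mul ?_
        refine (Real.continuous_exp.tendsto _).comp (hlim.mul ?_)
        exact ((continuous_const.sub continuous_id).tendsto 0).mono_left nhdsWithin_le_nhds
      exact ge_of_tendsto h1 (Eventually.of_forall fun s => hqexp s t)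
    · rw [hpne hs]; exact hqexp s t
  · rw [hp0]
    exact hlim.congr' (hevne.mono fun t ht => ht.symm)
  · rw [hp0] at h0
    rw [h0] at hlim hl_le
    have hwlim : Tendsto w (𝓝[<] 0) (𝓝 0) := by
      have := hlim.mul ((hHcont.tendsto 0).mono_left (nhdsWithin_le_nhds (s := Set.Iio 0)))
      rw [zero_mul] at this
      exact this.congr fun t => (hwq t).symm
    -- A vanishing left slope means `w` tends to `0` at `0-`. Since `w` is positive somewhere
    -- before, it has already begun to decrease at some `t2 < 0`, and `H` is concave from there on.
    obtain ⟨t1, ht1, hwt1⟩ : ∃ t1 < 0, 0 < w t1 := by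
      by_contra! hcon
      have : H 0 = 0 := by
        rw [hH, ← setIntegral_congr_set Iio_ae_eq_Iic]
        exact setIntegral_eq_zero_of_forall_eq_zero fun x hx =>
          le_antisymm (hcon x hx) (hw0 x)
      exact (hpos 0).ne' this
    obtain ⟨t2, ⟨ht12, ht2⟩, hwt2⟩ : ∃ t2 ∈ Set.Ioo t1 0, w t2 < w t1 :=
      ((hwlim.eventually (gt_mem_nhds hwt1)).and (Ioo_mem_nhdsLT ht1)).exists.imp
        fun t h => ⟨h.2, h.1⟩
    have hwanti {s t : ℝ} (hs : t2 ≤ s) (hst : s ≤ t) : w t ≤ w s := by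
      have h1 : w s ≤ w t2 := by
        have := min_le_of_logConcave hw0 hw ht12.le hs
        rcases min_le_iff.1 this with h | h
        · exact absurd h (not_le.2 hwt2)
        · exact h
      have h2 := min_le_of_logConcave hw0 hw (ht12.le.trans hs) hst
      rcases min_le_iff.1 h2 with h | h
      · exact absurd (h.trans h1) (not_le.2 hwt2)
      · exact h
    have hsg {s t : ℝ} (hs : t2 ≤ s) (ht : t2 ≤ t) : H t ≤ H s + w s * (t - s) := by
      rcases le_total s t with h | h
      · have := hupper h (m := w s) fun x hx => hwanti hs hx.1.le
        linarith
      · have := hlower h (m := w s) fun x hx => hwanti (ht.trans hx.1.le) hx.2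
        linarith
    refine ⟨-t2, by linarith, convex_Ici _, fun x hx y hy a b ha hb hab => ?_⟩
    rw [neg_neg, Set.mem_Ici] at hx hy
    simp only [smul_eq_mul]
    have hm : t2 ≤ a * x + b * y := by
      calc t2 = a * t2 + b * t2 := by rw [← add_mul, hab, one_mul]
        _ ≤ _ := by gcongr
    have h1 := mul_le_mul_of_nonneg_left (hsg hm hx) ha
    have h2 := mul_le_mul_of_nonneg_left (hsg hm hy) hb
    have h3 : a * (H (a * x + b * y) + w (a * x + b * y) * (x - (a * x + b * y))) +
        b * (H (a * x + b * y) + w (a * x + b * y) * (y - (a * x + b * y))) =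
        (a + b) * H (a * x + b * y) + w (a * x + b * y) * ((a * x + b * y) -
          (a + b) * (a * x + b * y)) := by ring
    rw [hab] at h3
    linarith

end

end Profile

/-! ### Degree zero extensions and their Taylor bounds. -/

section SphereFunction

open Filter Topology Metric

/-- `g` is the degree zero extension of an even `C²` function on the unit sphere, with
gradient `G`. -/
structure IsSphereFunction {E : Type*} [NormedAddCommGroup E] [InnerProductSpace ℝ E]
    [MeasurableSpace E] (g : E → ℝ) (G : E → E) (C : ℝ) : Prop where
  smul : ∀ c : ℝ, 0 < c → ∀ x, g (c • x) = g x
  even : ∀ x, g (-x) = g x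
  measurable : Measurable g
  measurable_grad : Measurable G
  continuousOn : ContinuousOn g {0}ᶜ
  continuousOn_grad : ContinuousOn G (sphere 0 1)
  tangent : ∀ u, ‖u‖ = 1 → inner ℝ (G u) u = 0
  abs_le : ∀ x, |g x| ≤ C
  norm_grad_le : ∀ u, ‖u‖ = 1 → ‖G u‖ ≤ C
  taylor : ∀ u y, ‖u‖ = 1 → y ≠ 0 → |g y - g u - inner ℝ (G u) (y - u)| ≤ C * ‖y - u‖ ^ 2

variable {d : ℕ}

/-- The degree zero extension of a function on the sphere. -/
noncomputable def sphereExtend (f : sphere (0 : EuclideanSpace ℝ (Fin (d + 1))) 1 → ℝ)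
    (x : EuclideanSpace ℝ (Fin (d + 1))) : ℝ :=
  if h : x = 0 then 0 else f ⟨‖x‖⁻¹ • x, by simp [norm_smul, h]⟩

lemma sphereExtend_coe (f : sphere (0 : EuclideanSpace ℝ (Fin (d + 1))) 1 → ℝ)
    (u : sphere (0 : EuclideanSpace ℝ (Fin (d + 1))) 1) : sphereExtend f u = f u := by
  have hu : ‖(u : EuclideanSpace ℝ (Fin (d + 1)))‖ = 1 := norm_eq_of_mem_sphere u
  have h0 : (u : EuclideanSpace ℝ (Fin (d + 1))) ≠ 0 := by
    rw [← norm_ne_zero_iff, hu]; exact one_ne_zero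
  rw [sphereExtend, dif_neg h0]
  congr 1
  ext1
  simp [hu]

/-- Off the origin the extension is `f` composed with the smooth radial projection to the sphere,
which turns manifold regularity into ordinary regularity. -/
lemma contDiffOn_sphereExtend {f : sphere (0 : EuclideanSpace ℝ (Fin (d + 1))) 1 → ℝ}
    (hf : ContMDiff (𝓡 d) 𝓘(ℝ, ℝ) 2 f) : ContDiffOn ℝ 2 (sphereExtend f) {0}ᶜ := by
  let U : TopologicalSpace.Opens (EuclideanSpace ℝ (Fin (d + 1))) := ⟨{0}ᶜ, isOpen_compl_singleton⟩
  have := Fact.mk (@finrank_euclideanSpace_fin ℝ _ (d + 1))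
  let r : EuclideanSpace ℝ (Fin (d + 1)) → EuclideanSpace ℝ (Fin (d + 1)) := fun x => ‖x‖⁻¹ • x
  have hr : ∀ x : U, ContMDiffAt 𝓘(ℝ, EuclideanSpace ℝ (Fin (d + 1)))
      𝓘(ℝ, EuclideanSpace ℝ (Fin (d + 1))) 2 r (x : EuclideanSpace ℝ (Fin (d + 1))) := by
    intro x
    have hx : (x : EuclideanSpace ℝ (Fin (d + 1))) ≠ 0 := x.2
    refine ContDiffAt.contMDiffAt ?_
    exact ((contDiffAt_norm ℝ hx).inv (norm_ne_zero_iff.2 hx)).smul contDiffAt_id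
  have hrU : ContMDiff 𝓘(ℝ, EuclideanSpace ℝ (Fin (d + 1)))
      𝓘(ℝ, EuclideanSpace ℝ (Fin (d + 1))) 2 (fun x : U => r x) :=
    fun x => contMDiffAt_subtype_iff.2 (hr x)
  have hmem : ∀ x : U, r x ∈ sphere (0 : EuclideanSpace ℝ (Fin (d + 1))) 1 := fun x => by
    have hx : (x : EuclideanSpace ℝ (Fin (d + 1))) ≠ 0 := x.2
    simp [r, norm_smul, hx]
  have hcomp := hf.comp (hrU.codRestrict_sphere hmem)
  intro x hx
  have h1 := hcomp ⟨x, hx⟩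
  have h2 : (f ∘ Set.codRestrict (fun x : U => r x) _ hmem) = fun x : U => sphereExtend f x := by
    funext y
    have hy : (y : EuclideanSpace ℝ (Fin (d + 1))) ≠ 0 := y.2
    simp only [Function.comp, sphereExtend, dif_neg hy]
    rfl
  rw [h2, contMDiffAt_subtype_iff] at h1
  exact h1.contDiffAt.contDiffWithinAt

lemma sphereExtend_smul (f : sphere (0 : EuclideanSpace ℝ (Fin (d + 1))) 1 → ℝ) {c : ℝ}
    (hc : 0 < c) (x : EuclideanSpace ℝ (Fin (d + 1))) :
    sphereExtend f (c • x) = sphereExtend f x := by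
  by_cases h : x = 0
  · simp [h]
  have h' : c • x ≠ 0 := smul_ne_zero hc.ne' h
  rw [sphereExtend, sphereExtend, dif_neg h, dif_neg h']
  congr 2
  rw [norm_smul, Real.norm_of_nonneg hc.le, mul_inv, smul_smul]
  congr 1
  field_simp

theorem exists_isSphereFunction {f : sphere (0 : EuclideanSpace ℝ (Fin (d + 1))) 1 → ℝ}
    (hf : ContMDiff (𝓡 d) 𝓘(ℝ, ℝ) 2 f) (heven : ∀ u, f (-u) = f u) :
    ∃ (g : EuclideanSpace ℝ (Fin (d + 1)) → ℝ)
      (G : EuclideanSpace ℝ (Fin (d + 1)) → EuclideanSpace ℝ (Fin (d + 1))) (C : ℝ),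
      IsSphereFunction g G C ∧
      ∀ u : sphere (0 : EuclideanSpace ℝ (Fin (d + 1))) 1, g u = f u := by
  set g := sphereExtend f with hg
  have hC2 := contDiffOn_sphereExtend hf
  have hopen : IsOpen ({0}ᶜ : Set (EuclideanSpace ℝ (Fin (d + 1)))) := isOpen_compl_singleton
  let G : EuclideanSpace ℝ (Fin (d + 1)) → EuclideanSpace ℝ (Fin (d + 1)) :=
    fun x => (InnerProductSpace.toDual ℝ _).symm (fderiv ℝ g x)
  have hGi (x v) : inner ℝ (G x) v = fderiv ℝ g x v := by
    simp [G]
  have hdiff {x : EuclideanSpace ℝ (Fin (d + 1))} (hx : x ≠ 0) : DifferentiableAt ℝ g x :=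
    (hC2.contDiffAt (hopen.mem_nhds hx)).differentiableAt (by norm_num)
  have hfd : ContDiffOn ℝ 1 (fderiv ℝ g) {0}ᶜ := hC2.fderiv_of_isOpen hopen (by norm_num)
  have hfd2 : ContinuousOn (fderiv ℝ (fderiv ℝ g)) {0}ᶜ :=
    hfd.continuousOn_fderiv_of_isOpen hopen le_rfl
  have hGc : ContinuousOn G {0}ᶜ :=
    (InnerProductSpace.toDual ℝ _).symm.continuous.comp_continuousOn hfd.continuousOn
  have hsph : sphere (0 : EuclideanSpace ℝ (Fin (d + 1))) 1 ⊆ {0}ᶜ := fun x hx h => by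
    rw [Set.mem_singleton_iff.1 h] at hx; simp at hx
  obtain ⟨B, hB⟩ := (isCompact_sphere (0 : EuclideanSpace ℝ (Fin (d + 1))) 1).exists_bound_of_continuousOn
    (hC2.continuousOn.mono hsph)
  obtain ⟨B', hB'⟩ := (isCompact_sphere (0 : EuclideanSpace ℝ (Fin (d + 1))) 1).exists_bound_of_continuousOn
    (hGc.mono hsph)
  -- The second derivative is bounded on this annulus, which contains every ball of radius at most
  -- `1/2` about a unit vector. For `y` farther from `u`, the Taylor bound follows from boundedness
  -- alone.
  let K : Set (EuclideanSpace ℝ (Fin (d + 1))) := closedBall 0 2 \ ball 0 (1 / 2)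
  have hK : IsCompact K := (isCompact_closedBall _ _).diff isOpen_ball
  have hK0 : K ⊆ {0}ᶜ := fun x hx h => hx.2 (by rw [Set.mem_singleton_iff.1 h]; simp)
  obtain ⟨B2, hB2⟩ := hK.exists_bound_of_continuousOn
    (f := fderiv ℝ (fderiv ℝ g)) (hfd2.mono hK0)
  have hgB (x) : |g x| ≤ |B| := by
    by_cases h : x = 0
    · simp [hg, sphereExtend, h]
    have hx : 0 < ‖x‖ := norm_pos_iff.2 h
    rw [hg, ← sphereExtend_smul f (inv_pos.2 hx) x]
    refine (hB _ ?_).trans (le_abs_self B)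
    simp [norm_smul, h]
  refine ⟨g, G, |B2| + 8 * |B| + 2 * |B'|, ⟨fun c hc x => sphereExtend_smul f hc x, fun x => ?_,
    measurable_of_continuousOn_compl_singleton 0 hC2.continuousOn,
    (InnerProductSpace.toDual ℝ _).symm.continuous.measurable.comp (measurable_fderiv ℝ g),
    hC2.continuousOn, hGc.mono hsph, fun u hu => ?_, fun x => ?_, fun u hu => ?_,
    fun u y hu hy => ?_⟩, sphereExtend_coe f⟩
  · by_cases h : x = 0
    · simp [h]
    have h' : -x ≠ 0 := neg_ne_zero.2 h
    simp only [hg, sphereExtend, dif_neg h, dif_neg h']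
    rw [← heven]
    congr 1
    ext1
    simp
  · have hu0 : u ≠ 0 := by rw [← norm_ne_zero_iff, hu]; exact one_ne_zero
    rw [hGi]
    -- The function is constant on rays, so its gradient is tangential.
    have h1 : HasDerivAt (fun c : ℝ => g (c • u)) (fderiv ℝ g u u) 1 := by
      have h2 : HasDerivAt (fun c : ℝ => c • u) u 1 := by
        simpa using (hasDerivAt_id (1 : ℝ)).smul_const u
      have h3 : HasFDerivAt g (fderiv ℝ g u) ((1 : ℝ) • u) := by
        rw [one_smul]; exact (hdiff hu0).hasFDerivAt
      exact h3.comp_hasDerivAt 1 h2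
    have h4 : HasDerivAt (fun c : ℝ => g (c • u)) 0 1 := by
      refine (hasDerivAt_const (1 : ℝ) (g u)).congr_of_eventuallyEq ?_
      filter_upwards [lt_mem_nhds (zero_lt_one' ℝ)] with c hc using sphereExtend_smul f hc u
    exact h1.unique h4
  · have := hgB x
    have := abs_nonneg B2
    have := abs_nonneg B'
    have := abs_nonneg B
    linarith
  · have := (hB' u (by simpa using hu)).trans (le_abs_self B')
    have := abs_nonneg B2
    have := abs_nonneg B'
    have := abs_nonneg B
    linarith
  · have hGu := (hB' u (by simpa using hu)).trans (le_abs_self B')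
    have hB0 := abs_nonneg B
    have hB20 := abs_nonneg B2
    have hB'0 := abs_nonneg B'
    rcases le_or_gt ‖y - u‖ (1 / 2) with h | h
    · have hball : closedBall u ‖y - u‖ ⊆ K := by
        intro z hz
        rw [mem_closedBall, dist_eq_norm] at hz
        have h1 : ‖z‖ ≤ ‖z - u‖ + ‖u‖ := by simpa using norm_add_le (z - u) u
        have h2 : ‖u‖ ≤ ‖z - u‖ + ‖z‖ := by
          have := norm_sub_le z (z - u)
          rw [sub_sub_cancel] at this; linarith
        refine ⟨by rw [mem_closedBall_zero_iff]; linarith, ?_⟩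
        rw [mem_ball_zero_iff]; linarith
      have hu' : u ∈ closedBall u ‖y - u‖ := mem_closedBall_self (norm_nonneg _)
      have hy' : y ∈ closedBall u ‖y - u‖ := by rw [mem_closedBall, dist_eq_norm]
      have hfl : ∀ z ∈ closedBall u ‖y - u‖, ‖fderiv ℝ g z - fderiv ℝ g u‖ ≤ |B2| * ‖y - u‖ := by
        intro z hz
        have := (convex_closedBall u ‖y - u‖).norm_image_sub_le_of_norm_fderiv_le (𝕜 := ℝ)
          (f := fderiv ℝ g) (C := |B2|)
          (fun x hx => (hfd.contDiffAt (hopen.mem_nhds (hK0 (hball hx)))).differentiableAt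
            (by norm_num))
          (fun x hx => (hB2 x (hball hx)).trans (le_abs_self _)) hu' hz
        refine this.trans (mul_le_mul_of_nonneg_left ?_ hB20)
        rwa [mem_closedBall, dist_eq_norm] at hz
      have hmv := (convex_closedBall u ‖y - u‖).norm_image_sub_le_of_norm_hasFDerivWithin_le (𝕜 := ℝ)
        (f := fun z => g z - fderiv ℝ g u z) (f' := fun z => fderiv ℝ g z - fderiv ℝ g u)
        (C := |B2| * ‖y - u‖)
        (fun x hx => ((hdiff (hK0 (hball hx))).hasFDerivAt.sub
          (fderiv ℝ g u).hasFDerivAt).hasFDerivWithinAt) hfl hu' hy'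
      rw [hGi, map_sub]
      have e : g y - g u - (fderiv ℝ g u y - fderiv ℝ g u u) =
          g y - fderiv ℝ g u y - (g u - fderiv ℝ g u u) := by ring
      rw [e]
      refine hmv.trans ?_
      rw [mul_assoc, ← pow_two]
      gcongr
      linarith
    · have h1 : |inner ℝ (G u) (y - u)| ≤ |B'| * ‖y - u‖ :=
        (abs_real_inner_le_norm _ _).trans (mul_le_mul_of_nonneg_right hGu (norm_nonneg _))
      have h2 := hgB y
      have h3 := hgB u
      have h4 : ‖y - u‖ ≤ 2 * ‖y - u‖ ^ 2 := by nlinarith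
      have h5 : 1 ≤ 4 * ‖y - u‖ ^ 2 := by nlinarith
      have h6 : |g y - g u - inner ℝ (G u) (y - u)| ≤ |B| + |B| + |B'| * ‖y - u‖ := by
        refine (abs_sub _ _).trans (add_le_add ((abs_sub _ _).trans (add_le_add h2 h3)) h1)
      nlinarith [mul_le_mul_of_nonneg_left h4 hB'0, mul_le_mul_of_nonneg_left h5 hB0,
        mul_nonneg hB20 (sq_nonneg ‖y - u‖)]

end SphereFunction

/-! ### The bodies, their support functions and their radial functions. -/

section Bodies

open Filter Topology Metric

lemma one_sub_inner_eq {E : Type*} [NormedAddCommGroup E] [InnerProductSpace ℝ E] {u v : E}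
    (hu : ‖u‖ = 1) (hv : ‖v‖ = 1) : 1 - inner ℝ u v = ‖u - v‖ ^ 2 / 2 := by
  rw [norm_sub_sq_real, hu, hv]; ring

/-- The convex body with support function `R * exp (ε * g)`. -/
def wulff {E : Type*} [NormedAddCommGroup E] [InnerProductSpace ℝ E] (R ε : ℝ) (g : E → ℝ) :
    Set E := {x | ∀ u : E, ‖u‖ = 1 → inner ℝ x u ≤ R * Real.exp (ε * g u)}

section

variable {E : Type*} [NormedAddCommGroup E] [InnerProductSpace ℝ E] {g : E → ℝ}

lemma convex_wulff {R ε : ℝ} : Convex ℝ (wulff R ε g) := by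
  have : wulff R ε g = ⋂ u : E, ⋂ (_ : ‖u‖ = 1), {x | inner ℝ x u ≤ R * Real.exp (ε * g u)} := by
    ext x; simp [wulff]
  rw [this]
  refine convex_iInter fun u => convex_iInter fun _ => ?_
  exact convex_halfSpace_le ⟨fun x y => inner_add_left _ _ _, fun c x => by
    rw [inner_smul_left]; rfl⟩ _

lemma isClosed_wulff {R ε : ℝ} : IsClosed (wulff R ε g) := by
  have : wulff R ε g = ⋂ u : E, ⋂ (_ : ‖u‖ = 1), {x | inner ℝ x u ≤ R * Real.exp (ε * g u)} := by
    ext x; simp [wulff]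
  rw [this]
  refine isClosed_iInter fun u => isClosed_iInter fun _ => ?_
  exact isClosed_le (by fun_prop) continuous_const

end

namespace IsSphereFunction

section

variable {E : Type*} [NormedAddCommGroup E] [InnerProductSpace ℝ E] [MeasurableSpace E]
  {g : E → ℝ} {G : E → E} {C : ℝ}

lemma nonneg (hg : IsSphereFunction g G C) : 0 ≤ C := (abs_nonneg _).trans (hg.abs_le 0)

/-- The vector on the left is the candidate boundary point with normal `u`. The Taylor error `ε C ‖v
- u‖²` is at most `‖v - u‖²/2 = 1 - ⟨u, v⟩`, so for small `ε` this point satisfies every constraint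
and the prescribed function really is the support function. -/
lemma inner_le_exp (hg : IsSphereFunction g G C) {ε : ℝ} (hε : 0 ≤ ε) (hεC : 2 * ε * C ≤ 1)
    {u v : E} (hu : ‖u‖ = 1) (hv : ‖v‖ = 1) :
    inner ℝ (Real.exp (ε * g u) • (u + ε • G u)) v ≤ Real.exp (ε * g v) := by
  have hv0 : v ≠ 0 := by rw [← norm_ne_zero_iff, hv]; exact one_ne_zero
  have h1 := _root_.abs_le.1 (hg.taylor u v hu hv0)
  have h2 : inner ℝ (G u) (v - u) = inner ℝ (G u) v := by
    rw [inner_sub_right, hg.tangent u hu, sub_zero]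
  have h3 := one_sub_inner_eq hu hv
  rw [norm_sub_rev] at h3
  rw [h2] at h1
  have h4 := Real.add_one_le_exp (ε * (g v - g u))
  have h5 : Real.exp (ε * g v) = Real.exp (ε * g u) * Real.exp (ε * (g v - g u)) := by
    rw [← Real.exp_add]; congr 1; ring
  rw [h5, inner_smul_left, inner_add_left, inner_smul_left]
  simp only [conj_trivial]
  refine mul_le_mul_of_nonneg_left ?_ (Real.exp_pos _).le
  refine le_trans ?_ h4
  have h6 : ε * (inner ℝ (G u) v - C * ‖v - u‖ ^ 2) ≤ ε * (g v - g u) :=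
    mul_le_mul_of_nonneg_left (by linarith [h1.1]) hε
  nlinarith [mul_le_mul_of_nonneg_right hεC (sq_nonneg ‖v - u‖)]

lemma isCompact_wulff [FiniteDimensional ℝ E] (hg : IsSphereFunction g G C) {R ε : ℝ}
    (hR : 0 < R) : IsCompact (wulff R ε g) := by
  have := FiniteDimensional.proper_real E
  refine Metric.isCompact_of_isClosed_isBounded isClosed_wulff ?_
  refine (isBounded_closedBall (x := (0 : E)) (r := R * Real.exp (|ε| * C))).subset fun x hx => ?_
  rw [mem_closedBall_zero_iff]
  rcases eq_or_ne x 0 with rfl | h0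
  · rw [norm_zero]; positivity
  have hn : ‖x‖ ≠ 0 := norm_ne_zero_iff.2 h0
  have h1 := hx (‖x‖⁻¹ • x) (by simp [norm_smul, h0])
  rw [inner_smul_right, real_inner_self_eq_norm_sq, pow_two, ← mul_assoc, inv_mul_cancel₀ hn,
    one_mul] at h1
  refine h1.trans (mul_le_mul_of_nonneg_left (Real.exp_le_exp.2 ?_) hR.le)
  refine (le_abs_self _).trans ?_
  rw [abs_mul]
  exact mul_le_mul_of_nonneg_left (hg.abs_le _) (abs_nonneg _)

lemma interior_wulff_nonempty (hg : IsSphereFunction g G C) {R ε : ℝ}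
    (hR : 0 < R) : (interior (wulff R ε g)).Nonempty := by
  refine ⟨0, mem_interior.2 ⟨ball 0 (R * Real.exp (-(|ε| * C))), fun x hx u hu => ?_, isOpen_ball,
    mem_ball_self (by positivity)⟩⟩
  rw [mem_ball_zero_iff] at hx
  refine (real_inner_le_norm x u).trans ?_
  rw [hu, mul_one]
  refine hx.le.trans (mul_le_mul_of_nonneg_left (Real.exp_le_exp.2 ?_) hR.le)
  refine le_trans ?_ (neg_abs_le _)
  rw [abs_mul, neg_le_neg_iff]
  exact mul_le_mul_of_nonneg_left (hg.abs_le _) (abs_nonneg _)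

end

section

variable {d : ℕ} {g : EuclideanSpace ℝ (Fin (d + 1)) → ℝ}
  {G : EuclideanSpace ℝ (Fin (d + 1)) → EuclideanSpace ℝ (Fin (d + 1))} {C : ℝ}

lemma isBodyWithSupport_wulff (hg : IsSphereFunction g G C) {R ε : ℝ} (hR : 0 < R) (hε : 0 ≤ ε)
    (hεC : 2 * ε * C ≤ 1) :
    IsBodyWithSupport (wulff R ε g) (fun u => R * Real.exp (ε * g u)) := by
  refine ⟨⟨convex_wulff, hg.isCompact_wulff hR, hg.interior_wulff_nonempty hR⟩, fun u => ?_⟩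
  have hu : ‖(u : EuclideanSpace ℝ (Fin (d + 1)))‖ = 1 := norm_eq_of_mem_sphere u
  refine IsGreatest.csSup_eq ⟨⟨R • (Real.exp (ε * g u) •
    ((u : EuclideanSpace ℝ (Fin (d + 1))) + ε • G u)), fun v hv => ?_, ?_⟩, ?_⟩
  · rw [inner_smul_left]
    exact mul_le_mul_of_nonneg_left (hg.inner_le_exp hε hεC hu hv) hR.le
  · simp only [inner_smul_left, inner_add_left, hg.tangent _ hu, real_inner_self_eq_norm_sq, hu]
    simp
  · rintro _ ⟨x, hx, rfl⟩
    exact hx u hu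

end

end IsSphereFunction

/-- By Hahn–Banach a convex body is the intersection of its supporting half-spaces; this gives
uniqueness. -/
lemma IsBodyWithSupport.eq {n : ℕ} {K : Set (EuclideanSpace ℝ (Fin n))}
    {h : sphere (0 : EuclideanSpace ℝ (Fin n)) 1 → ℝ} (hK : IsBodyWithSupport K h) :
    K = {x | ∀ u : sphere (0 : EuclideanSpace ℝ (Fin n)) 1,
      inner ℝ x (u : EuclideanSpace ℝ (Fin n)) ≤ h u} := by
  obtain ⟨⟨hconv, hcomp, hint⟩, hsup⟩ := hK
  have hne : K.Nonempty := hint.mono interior_subset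
  have hbdd (u : sphere (0 : EuclideanSpace ℝ (Fin n)) 1) :
      BddAbove ((fun x => inner ℝ x (u : EuclideanSpace ℝ (Fin n))) '' K) :=
    hcomp.bddAbove_image (by fun_prop)
  ext x
  refine ⟨fun hx u => ?_, fun hx => ?_⟩
  · rw [← hsup u]
    exact le_csSup (hbdd u) ⟨x, hx, rfl⟩
  · by_contra hxK
    obtain ⟨f, s, hf1, hf2⟩ := geometric_hahn_banach_closed_point hconv hcomp.isClosed hxK
    set v := (InnerProductSpace.toDual ℝ (EuclideanSpace ℝ (Fin n))).symm f with hv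
    have hfv (y) : f y = inner ℝ y v := by
      rw [real_inner_comm, hv, InnerProductSpace.toDual_symm_apply]
    have hv0 : v ≠ 0 := by
      rintro h0
      obtain ⟨k, hk⟩ := hne
      have h1 := hf1 k hk
      rw [hfv, h0, inner_zero_right] at h1 hf2
      linarith
    have hvp : 0 < ‖v‖ := norm_pos_iff.2 hv0
    let u : sphere (0 : EuclideanSpace ℝ (Fin n)) 1 := ⟨‖v‖⁻¹ • v, by simp [norm_smul, hv0]⟩
    have hu (y) : inner ℝ y (u : EuclideanSpace ℝ (Fin n)) = f y / ‖v‖ := by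
      rw [hfv]; simp only [u, inner_smul_right]; rw [inv_mul_eq_div]
    have h1 := hx u
    rw [← hsup u, hu] at h1
    have h2 : supportFn K u ≤ s / ‖v‖ := by
      refine csSup_le (hne.image _) ?_
      rintro _ ⟨k, hk, rfl⟩
      simp only
      rw [hu]
      exact div_le_div_of_nonneg_right (hf1 k hk).le hvp.le
    have h3 := h1.trans h2
    rw [div_le_div_iff_of_pos_right hvp] at h3
    linarith

/-- The gauge of `wulff 1 ε g`. -/
noncomputable def wulffGauge {E : Type*} [NormedAddCommGroup E] [InnerProductSpace ℝ E]
    (g : E → ℝ) (ε : ℝ) (x : E) : ℝ :=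
  sSup ((fun u : sphere (0 : E) 1 => inner ℝ x (u : E) * Real.exp (-(ε * g u))) '' Set.univ)

/-- The logarithm of the radial function of `wulff 1 ε g`. -/
noncomputable def logRadial {E : Type*} [NormedAddCommGroup E] [InnerProductSpace ℝ E]
    (g : E → ℝ) (ε : ℝ) (x : E) : ℝ := -Real.log (wulffGauge g ε x)

namespace IsSphereFunction

variable {E : Type*} [NormedAddCommGroup E] [InnerProductSpace ℝ E]
  [MeasurableSpace E] {g : E → ℝ} {G : E → E} {C : ℝ}

lemma continuous_coe_sphere (hg : IsSphereFunction g G C) :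
    Continuous fun u : sphere (0 : E) 1 => g u :=
  hg.continuousOn.comp_continuous continuous_subtype_val fun u => by
    rw [Set.mem_compl_singleton_iff, ← norm_ne_zero_iff, norm_eq_of_mem_sphere u]
    exact one_ne_zero

lemma continuous_uncurry_inner_mul_exp (hg : IsSphereFunction g G C) (ε : ℝ) :
    Continuous fun p : E × sphere (0 : E) 1 => inner ℝ p.1 (p.2 : E) * Real.exp (-(ε * g p.2)) :=
  (continuous_fst.inner (continuous_subtype_val.comp continuous_snd)).mul
    (Real.continuous_exp.comp
      (continuous_const.mul (hg.continuous_coe_sphere.comp continuous_snd)).neg)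

lemma continuous_inner_mul_exp (hg : IsSphereFunction g G C) (ε : ℝ) (x : E) :
    Continuous fun u : sphere (0 : E) 1 => inner ℝ x (u : E) * Real.exp (-(ε * g u)) :=
  (hg.continuous_uncurry_inner_mul_exp ε).comp (continuous_const.prodMk continuous_id)

variable [FiniteDimensional ℝ E]

lemma continuous_wulffGauge (hg : IsSphereFunction g G C) (ε : ℝ) :
    Continuous (wulffGauge g ε) := by
  have := FiniteDimensional.proper_real E
  have : CompactSpace (sphere (0 : E) 1) := isCompact_iff_compactSpace.1 (isCompact_sphere _ _)
  refine isCompact_univ.continuous_sSup (f := fun (x : E) (u : sphere (0 : E) 1) =>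
    inner ℝ x (u : E) * Real.exp (-(ε * g u))) ?_
  exact hg.continuous_uncurry_inner_mul_exp ε

lemma le_wulffGauge (hg : IsSphereFunction g G C) (ε : ℝ) (x : E) {u : E} (hu : ‖u‖ = 1) :
    inner ℝ x u * Real.exp (-(ε * g u)) ≤ wulffGauge g ε x := by
  have := FiniteDimensional.proper_real E
  have : CompactSpace (sphere (0 : E) 1) := isCompact_iff_compactSpace.1 (isCompact_sphere _ _)
  refine le_csSup (isCompact_univ.bddAbove_image
    (hg.continuous_inner_mul_exp ε x).continuousOn) ⟨⟨u, by simpa using hu⟩, ?_⟩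
  simp

lemma exists_eq_wulffGauge (hg : IsSphereFunction g G C) (ε : ℝ) {θ : E} (hθ : ‖θ‖ = 1) (x : E) :
    ∃ u, ‖u‖ = 1 ∧ inner ℝ x u * Real.exp (-(ε * g u)) = wulffGauge g ε x := by
  have := FiniteDimensional.proper_real E
  have : CompactSpace (sphere (0 : E) 1) := isCompact_iff_compactSpace.1 (isCompact_sphere _ _)
  have hne : (Set.univ : Set (sphere (0 : E) 1)).Nonempty := ⟨⟨θ, by simpa using hθ⟩, trivial⟩
  obtain ⟨u, -, hu⟩ := isCompact_univ.exists_sSup_image_eq hne (f := fun u : sphere (0 : E) 1 =>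
    inner ℝ x (u : E) * Real.exp (-(ε * g u))) (hg.continuous_inner_mul_exp ε x).continuousOn
  exact ⟨u, norm_eq_of_mem_sphere u, hu.symm⟩

lemma wulffGauge_pos (hg : IsSphereFunction g G C) (ε : ℝ) {θ : E} (hθ : ‖θ‖ = 1) :
    0 < wulffGauge g ε θ := by
  refine lt_of_lt_of_le ?_ (hg.le_wulffGauge ε θ hθ)
  rw [real_inner_self_eq_norm_sq, hθ]
  positivity

/-- Every vector is a competitor in the minimum defining `logRadial`. It need not be normalised
because `g` has degree zero, and this allows perturbed minimisers such as `u - x • G u`. -/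
lemma logRadial_le (hg : IsSphereFunction g G C) (ε : ℝ) {θ y : E}
    (hy : 0 < inner ℝ θ y) :
    logRadial g ε θ ≤ ε * g y - Real.log (inner ℝ θ y) + Real.log ‖y‖ := by
  have hy0 : y ≠ 0 := by rintro rfl; simp at hy
  have hyn : 0 < ‖y‖ := norm_pos_iff.2 hy0
  have h1 := hg.le_wulffGauge ε θ (u := ‖y‖⁻¹ • y) (by simp [norm_smul, hy0])
  rw [hg.smul _ (inv_pos.2 hyn), inner_smul_right] at h1
  have h2 := Real.log_le_log (by positivity) h1
  rw [Real.log_mul (by positivity) (by positivity), Real.log_exp,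
    Real.log_mul (by positivity) (by positivity), Real.log_inv] at h2
  rw [logRadial]
  linarith

lemma exists_eq_logRadial (hg : IsSphereFunction g G C) (ε : ℝ) {θ : E} (hθ : ‖θ‖ = 1) :
    ∃ u, ‖u‖ = 1 ∧ 0 < inner ℝ θ u ∧ logRadial g ε θ = ε * g u - Real.log (inner ℝ θ u) := by
  obtain ⟨u, hu, h⟩ := hg.exists_eq_wulffGauge ε hθ θ
  have hp := hg.wulffGauge_pos ε hθ
  rw [← h] at hp
  have hi : 0 < inner ℝ θ u := (mul_pos_iff_of_pos_right (Real.exp_pos _)).1 hp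
  refine ⟨u, hu, hi, ?_⟩
  rw [logRadial, ← h, Real.log_mul hi.ne' (Real.exp_pos _).ne', Real.log_exp]
  ring

lemma smul_mem_wulff_iff (hg : IsSphereFunction g G C) {R ε r : ℝ} (hr : 0 ≤ r)
    {θ : E} (hθ : ‖θ‖ = 1) :
    r • θ ∈ wulff R ε g ↔ r ≤ R * Real.exp (logRadial g ε θ) := by
  have hp := hg.wulffGauge_pos ε hθ
  rw [logRadial, Real.exp_neg, Real.exp_log hp, ← div_eq_mul_inv, le_div_iff₀ hp]
  have key (u : E) : inner ℝ (r • θ) u ≤ R * Real.exp (ε * g u) ↔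
      r * (inner ℝ θ u * Real.exp (-(ε * g u))) ≤ R := by
    rw [inner_smul_left, Real.exp_neg, ← mul_assoc, ← div_eq_mul_inv,
      div_le_iff₀ (Real.exp_pos _)]
    rfl
  constructor
  · intro h
    obtain ⟨u, hu, he⟩ := hg.exists_eq_wulffGauge ε hθ θ
    rw [← he]
    exact (key u).1 (h u hu)
  · intro h u hu
    refine (key u).2 (le_trans ?_ h)
    exact mul_le_mul_of_nonneg_left (hg.le_wulffGauge ε θ hu) hr

variable [BorelSpace E]

open OrthGroup in
lemma measure_wulff (hg : IsSphereFunction g G C) {γ : Measure E} [SFinite γ]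
    (hγ : ∀ T : E ≃ₗᵢ[ℝ] E, ∀ A, MeasurableSet A → γ (T '' A) = γ A) {e : E} (he : ‖e‖ = 1)
    (R ε : ℝ) :
    γ (wulff R ε g) =
      ∫⁻ T : OrthGroup E, γ (closedBall 0 (R * Real.exp (logRadial g ε (act T e)))) ∂haar := by
  rw [measure_eq_lintegral hγ he isClosed_wulff.measurableSet]
  refine lintegral_congr fun T => ?_
  congr 1
  ext x
  rw [Set.mem_ofPred_eq, hg.smul_mem_wulff_iff (norm_nonneg x) (by simpa using he),
    mem_closedBall_zero_iff]

end IsSphereFunction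

end Bodies

/-! ### First and second order expansion of the radial functions. -/

section LogRadial

open Filter Topology Metric

lemma neg_log_one_sub_le {s : ℝ} (hs : s ≤ 1 / 2) : -Real.log (1 - s) ≤ s + 2 * s ^ 2 := by
  have hp : 0 < 1 - s := by linarith
  have h1 := Real.one_sub_inv_le_log_of_pos hp
  have h2 : (1 - s)⁻¹ ≤ 1 + s + 2 * s ^ 2 := by
    rw [inv_eq_one_div, div_le_iff₀ hp]
    nlinarith [mul_nonneg (sq_nonneg s) (by linarith : 0 ≤ 1 - 2 * s)]
  linarith

lemma neg_log_inner_nonneg {E : Type*} [NormedAddCommGroup E] [InnerProductSpace ℝ E] {θ u : E} (hθ : ‖θ‖ = 1) (hu : ‖u‖ = 1) (hi : 0 < inner ℝ θ u) :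
    0 ≤ -Real.log (inner ℝ θ u) := by
  have h := real_inner_le_norm θ u
  rw [hθ, hu, mul_one] at h
  linarith [Real.log_nonpos hi.le h]

namespace IsSphereFunction

variable {E : Type*} [NormedAddCommGroup E] [InnerProductSpace ℝ E]
  [MeasurableSpace E] {g : E → ℝ} {G : E → E} {C : ℝ}

lemma abs_sub_le (hg : IsSphereFunction g G C) {u v : E} (hu : ‖u‖ = 1) (hv : ‖v‖ = 1) :
    |g v - g u| ≤ 3 * C * ‖v - u‖ := by
  have hv0 : v ≠ 0 := by rw [← norm_ne_zero_iff, hv]; exact one_ne_zero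
  have hC := hg.nonneg
  have h1 := hg.taylor u v hu hv0
  have h2 : |inner ℝ (G u) (v - u)| ≤ C * ‖v - u‖ :=
    (abs_real_inner_le_norm _ _).trans
      (mul_le_mul_of_nonneg_right (hg.norm_grad_le u hu) (norm_nonneg _))
  have h3 : ‖v - u‖ ≤ 2 := (norm_sub_le v u).trans (by rw [hu, hv]; norm_num)
  have h4 : |g v - g u| ≤ |g v - g u - inner ℝ (G u) (v - u)| + |inner ℝ (G u) (v - u)| := by
    simpa using abs_add_le (g v - g u - inner ℝ (G u) (v - u)) (inner ℝ (G u) (v - u))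
  have h5 : C * ‖v - u‖ ^ 2 ≤ C * (2 * ‖v - u‖) :=
    mul_le_mul_of_nonneg_left (by nlinarith [norm_nonneg (v - u)]) hC
  linarith

variable [FiniteDimensional ℝ E]

lemma logRadial_le_mul (hg : IsSphereFunction g G C) (ε : ℝ) {θ : E} (hθ : ‖θ‖ = 1) :
    logRadial g ε θ ≤ ε * g θ := by
  have := hg.logRadial_le ε (θ := θ) (y := θ) (by rw [real_inner_self_eq_norm_sq, hθ]; norm_num)
  simpa [real_inner_self_eq_norm_sq, hθ] using this

/-- Comparing the minimiser `u` with the competitor `θ` gives `‖u - θ‖²/2 ≤ ε (g θ - g u) ≤ 3 C ε ‖u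
- θ‖`. -/
lemma exists_near_eq_logRadial (hg : IsSphereFunction g G C) {ε : ℝ} (hε : 0 ≤ ε) {θ : E}
    (hθ : ‖θ‖ = 1) :
    ∃ u, ‖u‖ = 1 ∧ 0 < inner ℝ θ u ∧ logRadial g ε θ = ε * g u - Real.log (inner ℝ θ u) ∧
      ‖u - θ‖ ≤ 6 * C * ε := by
  obtain ⟨u, hu, hi, h⟩ := hg.exists_eq_logRadial ε hθ
  refine ⟨u, hu, hi, h, ?_⟩
  have h1 := hg.logRadial_le_mul ε hθ
  have h2 := Real.log_le_sub_one_of_pos hi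
  have h3 := one_sub_inner_eq hθ hu
  have h4 := (_root_.abs_le.1 (hg.abs_sub_le hθ hu)).1
  have h5 := mul_le_mul_of_nonneg_left h4 hε
  rw [norm_sub_rev] at h3
  have h6 : ‖u - θ‖ * ‖u - θ‖ ≤ (6 * C * ε) * ‖u - θ‖ := by nlinarith
  rcases (norm_nonneg (u - θ)).eq_or_lt with h0 | h0
  · rw [← h0]
    have := hg.nonneg
    positivity
  · exact le_of_mul_le_mul_right h6 h0

lemma abs_logRadial_le (hg : IsSphereFunction g G C) {ε : ℝ} (hε : 0 ≤ ε) {θ : E}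
    (hθ : ‖θ‖ = 1) : |logRadial g ε θ| ≤ C * ε := by
  obtain ⟨u, hu, hi, h⟩ := hg.exists_eq_logRadial ε hθ
  have h1 := hg.logRadial_le_mul ε hθ
  have h2 := neg_log_inner_nonneg hθ hu hi
  have h3 := mul_le_mul_of_nonneg_left (_root_.abs_le.1 (hg.abs_le θ)).2 hε
  have h4 := mul_le_mul_of_nonneg_left (_root_.abs_le.1 (hg.abs_le u)).1 hε
  rw [_root_.abs_le]
  constructor <;> linarith

lemma logRadial_nonneg (hg : IsSphereFunction g G C) {ε : ℝ} (hε : 0 ≤ ε) {θ : E}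
    (hθ : ‖θ‖ = 1) (h0 : ∀ u, ‖u‖ = 1 → 0 ≤ g u) : 0 ≤ logRadial g ε θ := by
  obtain ⟨u, hu, hi, h⟩ := hg.exists_eq_logRadial ε hθ
  have h2 := neg_log_inner_nonneg hθ hu hi
  have h3 := mul_nonneg hε (h0 u hu)
  linarith

lemma logRadial_eq_of_const (hg : IsSphereFunction g G C) (ε : ℝ) {θ : E}
    (hθ : ‖θ‖ = 1) {c : ℝ} (h0 : ∀ u, ‖u‖ = 1 → g u = c) : logRadial g ε θ = ε * c := by
  obtain ⟨u, hu, hi, h⟩ := hg.exists_eq_logRadial ε hθ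
  have h1 := hg.logRadial_le_mul ε hθ
  have h2 := neg_log_inner_nonneg hθ hu hi
  rw [h0 θ hθ] at h1
  rw [h0 u hu] at h
  linarith

/-- A minimum of functions affine in `ε` is concave. -/
lemma logRadial_concave (hg : IsSphereFunction g G C) {θ : E} (hθ : ‖θ‖ = 1) (ε₁ ε₂ : ℝ) {lam : ℝ}
    (hl : lam ∈ Set.Icc (0 : ℝ) 1) :
    lam * logRadial g ε₁ θ + (1 - lam) * logRadial g ε₂ θ ≤
      logRadial g (lam * ε₁ + (1 - lam) * ε₂) θ := by
  obtain ⟨u, hu, hi, h⟩ := hg.exists_eq_logRadial (lam * ε₁ + (1 - lam) * ε₂) hθ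
  have h1 := mul_le_mul_of_nonneg_left (hg.logRadial_le ε₁ hi) hl.1
  have h2 := mul_le_mul_of_nonneg_left (hg.logRadial_le ε₂ hi) (by linarith [hl.2] : 0 ≤ 1 - lam)
  rw [hu, Real.log_one] at h1 h2
  rw [h]
  linarith

/-- Testing at `ε'` with the minimiser for `ε` gives slope `g u`, which is close to `g θ`.
Exchanging the two parameters gives the other side. -/
lemma abs_logRadial_sub_le (hg : IsSphereFunction g G C) {a ε ε' : ℝ} (hε : ε ∈ Set.Icc 0 a)
    (hε' : ε' ∈ Set.Icc 0 a) {θ : E} (hθ : ‖θ‖ = 1) :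
    |logRadial g ε' θ - logRadial g ε θ - (ε' - ε) * g θ| ≤ 18 * C ^ 2 * a * |ε' - ε| := by
  have hC := hg.nonneg
  have key : ∀ ε ∈ Set.Icc 0 a, ∀ ε', logRadial g ε' θ - logRadial g ε θ - (ε' - ε) * g θ ≤
      18 * C ^ 2 * a * |ε' - ε| := by
    intro ε hε ε'
    obtain ⟨u, hu, hi, h, hn⟩ := hg.exists_near_eq_logRadial hε.1 hθ
    have h1 := hg.logRadial_le ε' hi
    rw [hu, Real.log_one] at h1
    have h2 : (ε' - ε) * (g u - g θ) ≤ |ε' - ε| * (18 * C ^ 2 * a) := by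
      refine (le_abs_self _).trans ?_
      rw [abs_mul]
      refine mul_le_mul_of_nonneg_left ?_ (abs_nonneg _)
      refine (hg.abs_sub_le hθ hu).trans ?_
      calc 3 * C * ‖u - θ‖ ≤ 3 * C * (6 * C * ε) := by gcongr
        _ = 18 * C ^ 2 * ε := by ring
        _ ≤ _ := by gcongr; exact hε.2
    linarith
  rw [_root_.abs_le]
  refine ⟨?_, key ε hε ε'⟩
  have := key ε' hε' ε
  rw [abs_sub_comm] at this
  linarith

/-- Keeping the minimiser `u` for the intermediate parameter yields only concavity; moving it to `u
- x • G u` as the parameter changes by `x` gains a quadratic term. The gain from `g` is `-x² ‖G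
u‖²`, and normalising costs half of it back. Terms linear in `x` cancel in the average. -/
lemma logRadial_second_order (hg : IsSphereFunction g G C) {a ε₁ ε₂ : ℝ}
    (h₁ : ε₁ ∈ Set.Icc 0 a) (h₂ : ε₂ ∈ Set.Icc 0 a) (haC : 6 * C * a ≤ 1) {θ : E}
    (hθ : ‖θ‖ = 1) {lam : ℝ} (hl : lam ∈ Set.Icc (0 : ℝ) 1) :
    ∃ u, ‖u‖ = 1 ∧ ‖u - θ‖ ≤ 6 * C * a ∧
      lam * logRadial g ε₁ θ + (1 - lam) * logRadial g ε₂ θ -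
        logRadial g (lam * ε₁ + (1 - lam) * ε₂) θ ≤
      -(lam * (1 - lam) * (ε₁ - ε₂) ^ 2 * ‖G u‖ ^ 2 * (1 / 2 - C * a - 288 * C ^ 2 * a ^ 2)) := by
  have hC := hg.nonneg
  have hl1 : 0 ≤ 1 - lam := by linarith [hl.2]
  have ha0 : 0 ≤ a := h₁.1.trans h₁.2
  set ε₀ := lam * ε₁ + (1 - lam) * ε₂ with hε₀
  have h₀ : ε₀ ∈ Set.Icc 0 a := by
    have := (convex_Icc 0 a) h₁ h₂ hl.1 hl1 (by ring)
    simpa using this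
  obtain ⟨u, hu, hi, h, hn⟩ := hg.exists_near_eq_logRadial h₀.1 hθ
  have hn' : ‖u - θ‖ ≤ 6 * C * a := hn.trans (by gcongr; exact h₀.2)
  refine ⟨u, hu, hn', ?_⟩
  have hhalf : 1 / 2 ≤ inner ℝ θ u := by
    have h1 := one_sub_inner_eq hθ hu
    rw [norm_sub_rev] at h1
    have : ‖u - θ‖ ^ 2 ≤ 1 := pow_le_one₀ (norm_nonneg _) (hn'.trans haC)
    linarith
  set A := ‖G u‖ with hA
  have hA0 : 0 ≤ A := norm_nonneg _
  have hAC : A ≤ C := hg.norm_grad_le u hu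
  -- This is the relative first order change of `⟨θ, u⟩` under the perturbation. It is small because
  -- `G u` is tangent at `u` and `u` is close to `θ`.
  set b := inner ℝ θ (G u) / inner ℝ θ u with hb
  have hbi : b * inner ℝ θ u = inner ℝ θ (G u) := div_mul_cancel₀ _ hi.ne'
  have hbA : |b| ≤ 12 * C * a * A := by
    have h1 : inner ℝ θ (G u) = -inner ℝ (u - θ) (G u) := by
      rw [inner_sub_left, real_inner_comm, real_inner_comm (G u) u, hg.tangent u hu]; ring
    have h2 : |inner ℝ θ (G u)| ≤ 6 * C * a * A := by
      rw [h1, abs_neg]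
      exact (abs_real_inner_le_norm _ _).trans (mul_le_mul_of_nonneg_right hn' hA0)
    rw [hb, abs_div, abs_of_pos hi, div_le_iff₀ hi]
    have : 0 ≤ 12 * C * a * A := by positivity
    nlinarith
  have hb2 : b ^ 2 ≤ 144 * C ^ 2 * a ^ 2 * A ^ 2 := by
    rw [← sq_abs]
    calc |b| ^ 2 ≤ (12 * C * a * A) ^ 2 := by gcongr
      _ = _ := by ring
  have key : ∀ x, |x| ≤ a → ε₀ + x ∈ Set.Icc 0 a → logRadial g (ε₀ + x) θ ≤
      logRadial g ε₀ θ + x * (g u + b - ε₀ * A ^ 2) +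
        x ^ 2 * A ^ 2 * (-1 / 2 + C * a + 288 * C ^ 2 * a ^ 2) := by
    intro x hx hε
    set y := u - x • G u with hy
    have hiy : inner ℝ θ y = inner ℝ θ u * (1 - x * b) := by
      rw [hy, inner_sub_right, inner_smul_right, ← hbi]; ring
    have hxb : x * b ≤ 1 / 2 := by
      refine (le_abs_self _).trans ?_
      rw [abs_mul]
      have h1 : |x| * |b| ≤ a * (12 * C * a * C) := by
        refine mul_le_mul hx (hbA.trans ?_) (abs_nonneg _) ha0
        gcongr
      have h2 : (6 * C * a) ^ 2 ≤ 1 := pow_le_one₀ (by positivity) haC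
      linarith
    have hpos : 0 < 1 - x * b := by linarith
    have hypos : 0 < inner ℝ θ y := by rw [hiy]; positivity
    have hy0 : y ≠ 0 := by intro h0; rw [h0] at hypos; simp at hypos
    have h1 := hg.logRadial_le (ε₀ + x) hypos
    have hyn : ‖y‖ ^ 2 = 1 + x ^ 2 * A ^ 2 := by
      rw [hy, norm_sub_sq_real, inner_smul_right, real_inner_comm, hg.tangent u hu, hu, norm_smul,
        mul_pow, Real.norm_eq_abs, sq_abs]
      ring
    have hylog : Real.log ‖y‖ ≤ x ^ 2 * A ^ 2 / 2 := by
      have h2 := Real.log_le_sub_one_of_pos (show 0 < ‖y‖ ^ 2 by positivity)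
      rw [Real.log_pow, hyn] at h2
      push_cast at h2
      linarith
    have hlog : Real.log (inner ℝ θ y) = Real.log (inner ℝ θ u) + Real.log (1 - x * b) := by
      rw [hiy, Real.log_mul hi.ne' hpos.ne']
    have hl2 := neg_log_one_sub_le hxb
    have htay := (_root_.abs_le.1 (hg.taylor u y hu hy0)).2
    have hyu : y - u = -(x • G u) := by rw [hy]; abel
    rw [hyu, inner_neg_right, inner_smul_right, real_inner_self_eq_norm_sq, norm_neg, norm_smul,
      mul_pow, Real.norm_eq_abs, sq_abs, ← hA] at htay
    have h3 := mul_le_mul_of_nonneg_left htay hε.1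
    have h4 : (ε₀ + x) * (C * (x ^ 2 * A ^ 2)) ≤ a * (C * (x ^ 2 * A ^ 2)) :=
      mul_le_mul_of_nonneg_right hε.2 (by positivity)
    have h5 : x ^ 2 * b ^ 2 ≤ x ^ 2 * (144 * C ^ 2 * a ^ 2 * A ^ 2) :=
      mul_le_mul_of_nonneg_left hb2 (sq_nonneg x)
    rw [h]
    linarith
  have hD : |ε₁ - ε₂| ≤ a := by
    rw [_root_.abs_le]; constructor <;> linarith [h₁.1, h₁.2, h₂.1, h₂.2]
  have k1 := key ((1 - lam) * (ε₁ - ε₂)) (by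
    rw [abs_mul, abs_of_nonneg hl1]
    exact (mul_le_of_le_one_left (abs_nonneg _) (by linarith [hl.1])).trans hD)
    (by rw [hε₀]; convert h₁ using 1; ring)
  have k2 := key (-lam * (ε₁ - ε₂)) (by
    rw [abs_mul, abs_neg, abs_of_nonneg hl.1]
    exact (mul_le_of_le_one_left (abs_nonneg _) hl.2).trans hD)
    (by rw [hε₀]; convert h₂ using 1; ring)
  have e1 : ε₀ + (1 - lam) * (ε₁ - ε₂) = ε₁ := by rw [hε₀]; ring
  have e2 : ε₀ + -lam * (ε₁ - ε₂) = ε₂ := by rw [hε₀]; ring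
  rw [e1] at k1
  rw [e2] at k2
  have m1 := mul_le_mul_of_nonneg_left k1 hl.1
  have m2 := mul_le_mul_of_nonneg_left k2 hl1
  refine (sub_le_sub_right (add_le_add m1 m2) _).trans (le_of_eq ?_)
  ring

/-- The first and second order behaviour of the radial functions, uniformly near the ball. -/
lemma exists_logRadial_bounds (hg : IsSphereFunction g G C) {η : ℝ} (hη : 0 < η) :
    ∃ a > 0, ∀ ε₁ ∈ Set.Ioo 0 a, ∀ ε₂ ∈ Set.Ioo 0 a, ∀ θ : E, ‖θ‖ = 1 →
      |logRadial g ε₁ θ - logRadial g ε₂ θ - (ε₁ - ε₂) * g θ| ≤ η * |ε₁ - ε₂| ∧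
      ∀ lam ∈ Set.Icc (0 : ℝ) 1, lam * logRadial g ε₁ θ + (1 - lam) * logRadial g ε₂ θ -
        logRadial g (lam * ε₁ + (1 - lam) * ε₂) θ ≤
        -(lam * (1 - lam) * (ε₁ - ε₂) ^ 2 * (‖G θ‖ ^ 2 - η) / 2) := by
  have hC := hg.nonneg
  have := FiniteDimensional.proper_real E
  have hcont : ContinuousOn (fun u => ‖G u‖ ^ 2) (sphere (0 : E) 1) := hg.continuousOn_grad.norm.pow 2
  have huc := (isCompact_sphere (0 : E) 1).uniformContinuousOn_of_continuous hcont
  obtain ⟨δ, hδ, hδu⟩ := Metric.uniformContinuousOn_iff.1 huc (η / 2) (by positivity)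
  have t1 : Tendsto (fun a : ℝ => 6 * C * a) (𝓝[>] 0) (𝓝 0) := by
    have : Continuous fun a : ℝ => 6 * C * a := by fun_prop
    simpa using (this.tendsto 0).mono_left nhdsWithin_le_nhds
  have t2 : Tendsto (fun a : ℝ => 18 * C ^ 2 * a) (𝓝[>] 0) (𝓝 0) := by
    have : Continuous fun a : ℝ => 18 * C ^ 2 * a := by fun_prop
    simpa using (this.tendsto 0).mono_left nhdsWithin_le_nhds
  have t3 : Tendsto (fun a : ℝ => C ^ 2 * (C * a + 288 * C ^ 2 * a ^ 2)) (𝓝[>] 0) (𝓝 0) := by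
    have : Continuous fun a : ℝ => C ^ 2 * (C * a + 288 * C ^ 2 * a ^ 2) := by fun_prop
    simpa using (this.tendsto 0).mono_left nhdsWithin_le_nhds
  obtain ⟨a, ⟨⟨⟨ha1, ha2⟩, ha3⟩, ha4⟩, ha0⟩ :=
    (((((t1.eventually (gt_mem_nhds one_pos)).and (t1.eventually (gt_mem_nhds hδ))).and
    (t2.eventually (gt_mem_nhds hη))).and (t3.eventually
    (gt_mem_nhds (show 0 < η / 4 by positivity)))).and
    self_mem_nhdsWithin).exists
  have ha0 : 0 < a := ha0
  refine ⟨a, ha0, fun ε₁ h₁ ε₂ h₂ θ hθ => ⟨?_, fun lam hl => ?_⟩⟩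
  · refine (hg.abs_logRadial_sub_le (Set.Ioo_subset_Icc_self h₂) (Set.Ioo_subset_Icc_self h₁)
      hθ).trans ?_
    gcongr
  · obtain ⟨u, hu, hn, h⟩ := hg.logRadial_second_order (Set.Ioo_subset_Icc_self h₁)
      (Set.Ioo_subset_Icc_self h₂) ha1.le hθ hl
    refine h.trans ?_
    have hd := hδu u (by simpa using hu) θ (by simpa using hθ)
      (by rw [dist_eq_norm]; exact hn.trans_lt ha2)
    rw [Real.dist_eq] at hd
    have hd' := (abs_lt.1 hd).1
    have hGC : ‖G u‖ ^ 2 ≤ C ^ 2 := pow_le_pow_left₀ (norm_nonneg _) (hg.norm_grad_le u hu) 2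
    have hκ : 0 ≤ C * a + 288 * C ^ 2 * a ^ 2 := by positivity
    have h6 := mul_le_mul_of_nonneg_right hGC hκ
    have hQ : 0 ≤ lam * (1 - lam) * (ε₁ - ε₂) ^ 2 :=
      mul_nonneg (mul_nonneg hl.1 (by linarith [hl.2])) (sq_nonneg _)
    have h7 : (‖G θ‖ ^ 2 - η) / 2 ≤ ‖G u‖ ^ 2 * (1 / 2 - C * a - 288 * C ^ 2 * a ^ 2) := by
      nlinarith
    have h8 := mul_le_mul_of_nonneg_left h7 hQ
    rw [neg_le_neg_iff]
    linarith

end IsSphereFunction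

end LogRadial

/-! ### The limit function with two slopes, and its variance. -/

section Kink

open Filter Topology Metric OrthGroup

/-- The slope of the piecewise linear function with slope `r` on the left and `s` on the right
of the origin. -/
noncomputable def kinkSlope (r s y : ℝ) : ℝ := if y ≤ 0 then r else s

variable {r s : ℝ}

lemma kinkSlope_of_nonpos {y : ℝ} (hy : y ≤ 0) : kinkSlope r s y = r := if_pos hy

lemma kinkSlope_of_pos {y : ℝ} (hy : 0 < y) : kinkSlope r s y = s := if_neg hy.not_ge

lemma kinkSlope_nonneg (hs : 0 ≤ s) (hsr : s ≤ r) (y : ℝ) : 0 ≤ kinkSlope r s y := by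
  unfold kinkSlope; split_ifs <;> linarith

lemma kinkSlope_le (hsr : s ≤ r) (y : ℝ) : kinkSlope r s y ≤ r := by
  unfold kinkSlope; split_ifs <;> linarith

lemma measurable_kinkSlope : Measurable (kinkSlope r s) :=
  Measurable.ite measurableSet_Iic measurable_const measurable_const

lemma abs_kink_sub_le (hs : 0 ≤ s) (hsr : s ≤ r) (y z : ℝ) :
    |kinkSlope r s z * z - kinkSlope r s y * y| ≤ r * |z - y| := by
  have h : ∀ y z, y ≤ z → kinkSlope r s z * z - kinkSlope r s y * y ∈ Set.Icc 0 (r * (z - y)) := by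
    intro y z hyz
    rcases le_or_gt z 0 with hz | hz
    · rw [kinkSlope_of_nonpos hz, kinkSlope_of_nonpos (hyz.trans hz)]
      constructor <;> nlinarith
    · rw [kinkSlope_of_pos hz]
      rcases le_or_gt y 0 with hy | hy
      · rw [kinkSlope_of_nonpos hy]
        constructor <;> nlinarith
      · rw [kinkSlope_of_pos hy]
        constructor <;> nlinarith
  rcases le_total y z with hyz | hyz
  · rw [abs_of_nonneg (h y z hyz).1, abs_of_nonneg (sub_nonneg.2 hyz)]
    exact (h y z hyz).2
  · rw [abs_sub_comm, abs_sub_comm z, abs_of_nonneg (h z y hyz).1,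
      abs_of_nonneg (sub_nonneg.2 hyz)]
    exact (h z y hyz).2

/-- At the vertex the larger slope `r` dominates both one-sided slopes; this is why `kinkSlope`
takes the value `r` at `0`. -/
lemma eventually_abs_kink_sub_le (hs : 0 ≤ s) (hsr : s ≤ r) (y : ℝ) :
    ∀ᶠ z in 𝓝 y, |kinkSlope r s z * z - kinkSlope r s y * y| ≤ kinkSlope r s y * |z - y| := by
  rcases le_or_gt y 0 with hy | hy
  · rw [kinkSlope_of_nonpos hy]
    refine Eventually.of_forall fun z => ?_
    have := abs_kink_sub_le hs hsr y z
    rwa [kinkSlope_of_nonpos hy] at this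
  · filter_upwards [lt_mem_nhds hy] with z hz
    rw [kinkSlope_of_pos hy, kinkSlope_of_pos hz, ← mul_sub, abs_mul, abs_of_nonneg hs]

namespace IsSphereFunction

variable {E : Type*} [NormedAddCommGroup E] [InnerProductSpace ℝ E]
  [MeasurableSpace E] {g : E → ℝ} {G : E → E} {C : ℝ}

lemma evenWithGradientBound_kink (hg : IsSphereFunction g G C) (hs : 0 ≤ s) (hsr : s ≤ r) :
    EvenWithGradientBound (fun x => kinkSlope r s (g x) * g x)
      (fun x => kinkSlope r s (g x) • G x) (r * (3 * C)) where
  even x _ := by simp only [hg.even]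
  lipschitz x y hx hy := by
    refine (abs_kink_sub_le hs hsr _ _).trans ?_
    rw [mul_assoc]
    exact mul_le_mul_of_nonneg_left (hg.abs_sub_le hy hx) (hs.trans hsr)
  norm_le x hx := by
    have hC := hg.nonneg
    rw [norm_smul, Real.norm_of_nonneg (kinkSlope_nonneg hs hsr _)]
    refine mul_le_mul (kinkSlope_le hsr _) ?_ (norm_nonneg _) (hs.trans hsr)
    linarith [hg.norm_grad_le x hx]
  tangent x hx := by rw [inner_smul_left, hg.tangent x hx, mul_zero]
  slope_le x e hx he hxe ε hε := by
    have hC := hg.nonneg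
    have hr := hs.trans hsr
    have hlim : Tendsto (fun h : ℝ => g (circlePt x e h)) (𝓝[>] 0) (𝓝 (g x)) := by
      rw [tendsto_iff_dist_tendsto_zero]
      refine squeeze_zero (g := fun h : ℝ => 3 * C * |h|) (fun _ => dist_nonneg) (fun h => ?_) ?_
      · rw [Real.dist_eq]
        exact (hg.abs_sub_le hx (norm_circlePt hx he hxe h)).trans
          (mul_le_mul_of_nonneg_left (norm_circlePt_sub_le hx he hxe h) (by positivity))
      · have : Continuous fun h : ℝ => 3 * C * |h| := by fun_prop
        simpa using (this.tendsto 0).mono_left nhdsWithin_le_nhds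
    have hsmall : ∀ᶠ h : ℝ in 𝓝[>] 0, r * C * h < ε := by
      have : Continuous fun h : ℝ => r * C * h := by fun_prop
      exact ((this.tendsto 0).mono_left nhdsWithin_le_nhds).eventually
        (gt_mem_nhds (by simpa using hε))
    filter_upwards [hlim.eventually (eventually_abs_kink_sub_le hs hsr (g x)), hsmall,
      self_mem_nhdsWithin] with h h1 h2 h3
    have h3 : 0 < h := h3
    refine h1.trans ?_
    have hP := kinkSlope_nonneg hs hsr (g x)
    have hz := norm_circlePt hx he hxe h
    have hz0 : circlePt x e h ≠ 0 := by rw [← norm_ne_zero_iff, hz]; exact one_ne_zero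
    have ht := hg.taylor x _ hx hz0
    have hin : inner ℝ (G x) (circlePt x e h - x) = Real.sin h * inner ℝ (G x) e := by
      rw [circlePt, inner_sub_right, inner_add_right, inner_smul_right, inner_smul_right,
        hg.tangent x hx]
      ring
    have hn : ‖circlePt x e h - x‖ ^ 2 ≤ h ^ 2 := by
      rw [← sq_abs h]
      exact pow_le_pow_left₀ (norm_nonneg _) (norm_circlePt_sub_le hx he hxe h) 2
    have hsin : |Real.sin h * inner ℝ (G x) e| ≤ h * |inner ℝ (G x) e| := by
      rw [abs_mul]
      refine mul_le_mul_of_nonneg_right ?_ (abs_nonneg _)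
      exact Real.abs_sin_le_abs.trans (abs_of_pos h3).le
    have h4 : |g (circlePt x e h) - g x| ≤ h * |inner ℝ (G x) e| + C * h ^ 2 := by
      rw [hin] at ht
      have h5 := abs_add_le (g (circlePt x e h) - g x - Real.sin h * inner ℝ (G x) e)
        (Real.sin h * inner ℝ (G x) e)
      rw [sub_add_cancel] at h5
      have := mul_le_mul_of_nonneg_left hn hC
      linarith
    rw [inner_smul_left, abs_mul, conj_trivial, abs_of_nonneg hP]
    have h6 := mul_le_mul_of_nonneg_left h4 hP
    have h7 : kinkSlope r s (g x) * (C * h ^ 2) ≤ r * (C * h ^ 2) :=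
      mul_le_mul_of_nonneg_right (kinkSlope_le hsr _) (by positivity)
    have h8 := mul_le_mul_of_nonneg_right h2.le h3.le
    linarith

variable [FiniteDimensional ℝ E] [BorelSpace E]

lemma integrable_kinkSlope_mul (hg : IsSphereFunction g G C) (hs : 0 ≤ s) (hsr : s ≤ r) {e : E}
    (he : ‖e‖ = 1) (k m : ℕ) : Integrable (fun T : OrthGroup E =>
      kinkSlope r s (g (act T e)) ^ k * ‖G (act T e)‖ ^ m) haar := by
  have hact : Measurable fun T : OrthGroup E => act T e :=
    (show Continuous fun T : OrthGroup E => act T e by fun_prop).measurable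
  refine Integrable.of_bound (C := r ^ k * C ^ m)
    (((measurable_kinkSlope.comp (hg.measurable.comp hact)).pow_const k).mul
      ((hg.measurable_grad.comp hact).norm.pow_const m)).aestronglyMeasurable
    (Eventually.of_forall fun T => ?_)
  have hP := kinkSlope_nonneg hs hsr (g (act T e))
  rw [Real.norm_of_nonneg (by positivity)]
  exact mul_le_mul (pow_le_pow_left₀ hP (kinkSlope_le hsr _) _)
    (pow_le_pow_left₀ (norm_nonneg _) (hg.norm_grad_le _ (by rw [norm_act, he])) _)
    (by positivity) (pow_nonneg (hs.trans hsr) _)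

/-- Either the piecewise linear function of `g` is constant on the sphere, or its variance is
strictly less than its weighted energy. -/
theorem kink_const_or_variance_lt (hg : IsSphereFunction g G C) (hs : 0 ≤ s) (hsr : s ≤ r)
    (hr : 0 < r) (hrn : r ≤ Module.finrank ℝ E) {e : E} (he : ‖e‖ = 1) :
    (∃ c, ∀ u, ‖u‖ = 1 → kinkSlope r s (g u) * g u = c) ∨
      ∃ c, ∫ T : OrthGroup E, (kinkSlope r s (g (act T e)) * g (act T e) - c) ^ 2 ∂haar <
        ∫ T : OrthGroup E, kinkSlope r s (g (act T e)) * ‖G (act T e)‖ ^ 2 ∂haar := by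
  have H := hg.evenWithGradientBound_kink hs hsr
  set ψ : E → ℝ := fun x => kinkSlope r s (g x) * g x with hψ
  have hc := H.continuous_comp_act he
  set c := ∫ T : OrthGroup E, ψ (act T e) ∂haar with hcdef
  have hvar : ∫ T : OrthGroup E, (ψ (act T e) - c) ^ 2 ∂haar =
      ∫ T : OrthGroup E, ψ (act T e) ^ 2 ∂haar - c ^ 2 := by
    have h1 : ∀ T : OrthGroup E, (ψ (act T e) - c) ^ 2 =
        ψ (act T e) ^ 2 - 2 * c * ψ (act T e) + c ^ 2 := fun T => by ring
    simp_rw [h1]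
    have i1 : Integrable (fun T : OrthGroup E => ψ (act T e) ^ 2) haar :=
      integrable_of_continuous (hc.pow 2)
    have i2 : Integrable (fun T : OrthGroup E => 2 * c * ψ (act T e)) haar :=
      (integrable_of_continuous hc).const_mul _
    have i3 : Integrable (fun T : OrthGroup E => ψ (act T e) ^ 2 - 2 * c * ψ (act T e)) haar :=
      i1.sub i2
    rw [integral_add i3 (integrable_const _), integral_sub i1 i2, integral_const_mul,
      ← hcdef]
    simp
    ring
  have hp := H.poincare ((measurable_kinkSlope.comp hg.measurable).smul hg.measurable_grad) he
  rw [← hcdef, ← hvar] at hp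
  have hV0 : 0 ≤ ∫ T : OrthGroup E, (ψ (act T e) - c) ^ 2 ∂haar :=
    integral_nonneg fun _ => sq_nonneg _
  rcases hV0.eq_or_lt with hV | hV
  · left
    refine ⟨c, fun u hu => ?_⟩
    have hcont : Continuous fun T : OrthGroup E => (ψ (act T e) - c) ^ 2 := by
      exact (hc.sub continuous_const).pow 2
    have h0 := (integral_eq_zero_iff_of_nonneg (fun _ => sq_nonneg _)
      (integrable_of_continuous hcont)).1 hV.symm
    -- Haar measure charges open sets, so a continuous function vanishing almost everywhere vanishes
    -- everywhere.
    have h1 : (fun T : OrthGroup E => (ψ (act T e) - c) ^ 2) = fun _ => 0 :=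
      (hcont.ae_eq_iff_eq haar continuous_const).1 h0
    obtain ⟨S, hS⟩ := exists_act_eq (x := e) (y := u) (by rw [he, hu])
    have h2 := congrFun h1 S
    simp only [hS] at h2
    exact sub_eq_zero.1 (pow_eq_zero_iff two_ne_zero |>.1 h2)
  · right
    refine ⟨c, ?_⟩
    have hn : (0 : ℝ) < Module.finrank ℝ E := hr.trans_le hrn
    -- As slopes are at most `n`, one factor of the squared slope can be traded for `n`. With the
    -- gap `2n`, the variance is at most half the energy, so a positive variance is strictly
    -- smaller.
    have hle : ∫ T : OrthGroup E, ‖kinkSlope r s (g (act T e)) • G (act T e)‖ ^ 2 ∂haar ≤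
        Module.finrank ℝ E *
          ∫ T : OrthGroup E, kinkSlope r s (g (act T e)) * ‖G (act T e)‖ ^ 2 ∂haar := by
      rw [← integral_const_mul]
      have i1 := hg.integrable_kinkSlope_mul hs hsr he 1 2
      have i2 := hg.integrable_kinkSlope_mul hs hsr he 2 2
      simp only [pow_one] at i1
      simp only [norm_smul, mul_pow, Real.norm_eq_abs, sq_abs]
      refine integral_mono i2 (i1.const_mul _) fun T => ?_
      have hP := kinkSlope_nonneg hs hsr (g (act T e))
      have hPn := (kinkSlope_le hsr (g (act T e))).trans hrn
      simp only
      rw [pow_two, mul_assoc]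
      exact mul_le_mul_of_nonneg_right hPn (by positivity)
    have h3 := hp.trans hle
    rw [mul_comm 2, mul_assoc] at h3
    have h4 := le_of_mul_le_mul_left h3 hn
    linarith

end IsSphereFunction

end Kink

/-! ### Second order bounds for weighted exponential means. -/

section Weighted

open Filter Topology Metric OrthGroup

lemma exp_le_one_add_add_sq {κ x : ℝ} (hκ : κ ≤ 1) (hx : |x| ≤ κ) :
    Real.exp x ≤ 1 + x + (1 + κ) / 2 * x ^ 2 := by
  have h := (abs_le.1 (Real.exp_bound (hx.trans hκ) (n := 3) (by norm_num))).2
  norm_num [Finset.sum_range_succ, Nat.factorial] at h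
  have h1 : |x| ^ 3 ≤ κ * x ^ 2 := by
    rw [pow_succ', sq_abs]
    exact mul_le_mul_of_nonneg_right hx (sq_nonneg x)
  have h2 : 0 ≤ κ * x ^ 2 := mul_nonneg ((abs_nonneg x).trans hx) (sq_nonneg x)
  linarith

section

variable {Ω : Type*} [MeasurableSpace Ω] {μ : Measure Ω} {h a : Ω → ℝ}

/-- Expand the exponential about the weighted mean `m` of `a`, where linear terms integrate to zero.
The variance is then bounded by the second moment about any `c`, so a convenient centre can be
chosen later. -/
lemma integral_mul_exp_le {κ : ℝ} (hκ : κ ≤ 1) (hh : Integrable h μ) (h0 : ∀ x, 0 ≤ h x)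
    (ham : AEStronglyMeasurable a μ) (ha : ∀ x, |a x| ≤ κ / 2) (hZ : 0 < ∫ x, h x ∂μ) (c : ℝ) :
    ∫ x, h x * Real.exp (a x) ∂μ ≤ (∫ x, h x ∂μ) * Real.exp
      ((∫ x, h x * (a x + (1 + κ) / 2 * (a x - c) ^ 2) ∂μ) / ∫ x, h x ∂μ) := by
  set Z := ∫ x, h x ∂μ with hZdef
  have hbdd (F : ℝ → ℝ) (hF : Continuous F) : Integrable (fun x => h x * F (a x)) μ := by
    obtain ⟨B, hB⟩ := (isCompact_Icc (a := -(κ / 2)) (b := κ / 2)).exists_bound_of_continuousOn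
      hF.continuousOn
    exact hh.mul_bdd (hF.comp_aestronglyMeasurable ham)
      (Eventually.of_forall fun x => hB _ (abs_le.1 (ha x)))
  set A := ∫ x, h x * a x ∂μ with hA
  have i1 : Integrable (fun x => h x * a x) μ := hbdd (fun y => y) continuous_id
  have i2 : Integrable (fun x => h x * (a x - c) ^ 2) μ :=
    hbdd (fun y => (y - c) ^ 2) (by fun_prop)
  set Q := ∫ x, h x * (a x - c) ^ 2 ∂μ with hQ
  set m := A / Z with hm
  have hmZ : m * Z = A := div_mul_cancel₀ _ hZ.ne'
  have hmκ : |m| ≤ κ / 2 := by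
    rw [hm, abs_div, abs_of_pos hZ, div_le_iff₀ hZ, hZdef, ← integral_const_mul]
    refine abs_integral_le_integral_abs.trans (integral_mono i1.abs (hh.const_mul _) fun x => ?_)
    simp only [abs_mul, abs_of_nonneg (h0 x)]
    rw [mul_comm]
    exact mul_le_mul_of_nonneg_right (ha x) (h0 x)
  have hsplit : ∫ x, h x * (a x + (1 + κ) / 2 * (a x - c) ^ 2) ∂μ = A + (1 + κ) / 2 * Q := by
    rw [hA, hQ, ← integral_const_mul, ← integral_add i1 (i2.const_mul _)]
    refine integral_congr_ae (Eventually.of_forall fun x => ?_)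
    simp only
    ring
  -- This coefficient collects the linear terms produced by moving the centre of the square from `m`
  -- to `c`; their integral `K (A - m Z)` vanishes.
  set K := 1 - (1 + κ) * (m - c) with hK
  have hpt : ∀ x, h x * Real.exp (a x) ≤ Real.exp m *
      (((1 - K * m) * h x + K * (h x * a x)) + (1 + κ) / 2 * (h x * (a x - c) ^ 2)) := by
    intro x
    have e1 : Real.exp (a x) = Real.exp m * Real.exp (a x - m) := by
      rw [← Real.exp_add]; congr 1; ring
    have e2 : Real.exp (a x - m) ≤ 1 + (a x - m) + (1 + κ) / 2 * (a x - m) ^ 2 := by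
      refine exp_le_one_add_add_sq hκ ((abs_sub _ _).trans ?_)
      linarith [ha x]
    have hκ0 : 0 ≤ κ / 2 := (abs_nonneg _).trans hmκ
    have e3 : 0 ≤ (1 + κ) / 2 * (m - c) ^ 2 := by nlinarith [sq_nonneg (m - c)]
    have e4 : Real.exp (a x - m) ≤
        (1 - K * m) + K * a x + (1 + κ) / 2 * (a x - c) ^ 2 := by
      rw [hK]; linarith
    rw [e1]
    have := mul_le_mul_of_nonneg_left (mul_le_mul_of_nonneg_left e4 (h0 x)) (Real.exp_pos m).le
    linarith
  have i3 : Integrable (fun x => (1 - K * m) * h x + K * (h x * a x)) μ :=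
    (hh.const_mul _).add (i1.const_mul _)
  have hint : ∫ x, h x * Real.exp (a x) ∂μ ≤ Real.exp m * (Z + (1 + κ) / 2 * Q) := by
    refine (integral_mono (hbdd Real.exp Real.continuous_exp)
      ((i3.add (i2.const_mul _)).const_mul _) hpt).trans (le_of_eq ?_)
    simp only [Pi.add_apply]
    rw [integral_const_mul, integral_add i3 (i2.const_mul _), integral_add (hh.const_mul _)
      (i1.const_mul _), integral_const_mul, integral_const_mul, integral_const_mul, ← hZdef, ← hA,
      ← hQ, ← hmZ]
    ring
  refine hint.trans ?_
  rw [hsplit, add_div A, Real.exp_add, ← hm]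
  have h5 := Real.add_one_le_exp ((1 + κ) / 2 * Q / Z)
  have h6 : Z + (1 + κ) / 2 * Q = Z * ((1 + κ) / 2 * Q / Z + 1) := by
    field_simp; ring
  rw [h6]
  have := mul_le_mul_of_nonneg_left h5 (mul_pos hZ (Real.exp_pos m)).le
  linarith

lemma rpow_integral_mul_rpow_integral_le {a' : Ω → ℝ} {κ lam : ℝ} (hκ : κ ≤ 1)
    (hh : Integrable h μ) (h0 : ∀ x, 0 ≤ h x) (ham : AEStronglyMeasurable a μ)
    (ham' : AEStronglyMeasurable a' μ) (ha : ∀ x, |a x| ≤ κ / 2) (ha' : ∀ x, |a' x| ≤ κ / 2)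
    (hZ : 0 < ∫ x, h x ∂μ) (c c' : ℝ) (hl : lam ∈ Set.Icc (0 : ℝ) 1)
    (hle : ∫ x, h x * (lam * (a x + (1 + κ) / 2 * (a x - c) ^ 2) +
      (1 - lam) * (a' x + (1 + κ) / 2 * (a' x - c') ^ 2)) ∂μ ≤ 0) :
    (∫ x, h x * Real.exp (a x) ∂μ) ^ lam * (∫ x, h x * Real.exp (a' x) ∂μ) ^ (1 - lam) ≤
      ∫ x, h x ∂μ := by
  have hl1 : 0 ≤ 1 - lam := by linarith [hl.2]
  set Z := ∫ x, h x ∂μ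
  have hbdd {b : Ω → ℝ} (hbm : AEStronglyMeasurable b μ) (hb : ∀ x, |b x| ≤ κ / 2) (e : ℝ) :
      Integrable (fun x => h x * (b x + (1 + κ) / 2 * (b x - e) ^ 2)) μ := by
    have hF : Continuous fun y : ℝ => y + (1 + κ) / 2 * (y - e) ^ 2 := by fun_prop
    obtain ⟨B, hB⟩ := (isCompact_Icc (a := -(κ / 2)) (b := κ / 2)).exists_bound_of_continuousOn
      hF.continuousOn
    exact hh.mul_bdd (hF.comp_aestronglyMeasurable hbm)
      (Eventually.of_forall fun x => hB _ (abs_le.1 (hb x)))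
  have k1 := integral_mul_exp_le hκ hh h0 ham ha hZ c
  have k2 := integral_mul_exp_le hκ hh h0 ham' ha' hZ c'
  have n1 : 0 ≤ ∫ x, h x * Real.exp (a x) ∂μ :=
    integral_nonneg fun x => mul_nonneg (h0 x) (Real.exp_pos _).le
  have n2 : 0 ≤ ∫ x, h x * Real.exp (a' x) ∂μ :=
    integral_nonneg fun x => mul_nonneg (h0 x) (Real.exp_pos _).le
  have hsum : lam * (∫ x, h x * (a x + (1 + κ) / 2 * (a x - c) ^ 2) ∂μ) +
      (1 - lam) * (∫ x, h x * (a' x + (1 + κ) / 2 * (a' x - c') ^ 2) ∂μ) ≤ 0 := by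
    rw [← integral_const_mul, ← integral_const_mul,
      ← integral_add ((hbdd ham ha c).const_mul _) ((hbdd ham' ha' c').const_mul _)]
    refine le_of_eq_of_le (integral_congr_ae (Eventually.of_forall fun x => ?_)) hle
    simp only
    ring
  refine (mul_le_mul (Real.rpow_le_rpow n1 k1 hl.1) (Real.rpow_le_rpow n2 k2 hl1)
    (Real.rpow_nonneg n2 _) (Real.rpow_nonneg (n1.trans k1) _)).trans ?_
  rw [Real.mul_rpow hZ.le (Real.exp_pos _).le, Real.mul_rpow hZ.le (Real.exp_pos _).le,
    ← Real.exp_mul, ← Real.exp_mul, mul_mul_mul_comm, ← Real.rpow_add hZ, ← Real.exp_add]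
  rw [show lam + (1 - lam) = 1 by ring, Real.rpow_one]
  refine mul_le_of_le_one_right hZ.le (Real.exp_le_one_iff.2 ?_)
  rw [div_mul_eq_mul_div, div_mul_eq_mul_div, ← add_div]
  exact div_nonpos_of_nonpos_of_nonneg (by linarith) hZ.le

end

namespace IsRadialProfile

variable {H p : ℝ → ℝ} {n : ℝ}

lemma monotone (hH : IsRadialProfile H p n) : Monotone H := by
  intro t s hts
  refine (hH.le_mul_exp s t).trans (mul_le_of_le_one_right (hH.pos s).le ?_)
  exact Real.exp_le_one_iff.2 (mul_nonpos_of_nonneg_of_nonpos (hH.nonneg s) (by linarith))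

lemma log_le (hH : IsRadialProfile H p n) (s t : ℝ) :
    Real.log (H t) ≤ Real.log (H s) + p s * (t - s) := by
  have := Real.log_le_log (hH.pos t) (hH.le_mul_exp s t)
  rwa [Real.log_mul (hH.pos s).ne' (Real.exp_pos _).ne', Real.log_exp] at this

lemma continuous (hH : IsRadialProfile H p n) : Continuous H := by
  have hn : 0 ≤ n := (hH.nonneg 0).trans (hH.le 0)
  have hL : LipschitzWith n.toNNReal fun t => Real.log (H t) := by
    refine LipschitzWith.of_le_add_mul _ fun t s => (hH.log_le s t).trans ?_
    rw [Real.coe_toNNReal _ hn, Real.dist_eq]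
    have h1 := (mul_le_mul_of_nonneg_left (le_abs_self (t - s)) (hH.nonneg s)).trans
      (mul_le_mul_of_nonneg_right (hH.le s) (abs_nonneg _))
    linarith
  have : H = fun t => Real.exp (Real.log (H t)) := funext fun t => (Real.exp_log (hH.pos t)).symm
  rw [this]
  exact Real.continuous_exp.comp hL.continuous

lemma rpow_mul_rpow_le (hH : IsRadialProfile H p n) (x y : ℝ) {lam : ℝ}
    (hl : lam ∈ Set.Icc (0 : ℝ) 1) :
    H x ^ lam * H y ^ (1 - lam) ≤ H (lam * x + (1 - lam) * y) := by
  set m := lam * x + (1 - lam) * y with hm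
  have h1 := mul_le_mul_of_nonneg_left (hH.log_le m x) hl.1
  have h2 := mul_le_mul_of_nonneg_left (hH.log_le m y) (by linarith [hl.2] : 0 ≤ 1 - lam)
  rw [Real.rpow_def_of_pos (hH.pos x), Real.rpow_def_of_pos (hH.pos y), ← Real.exp_add]
  conv_rhs => rw [← Real.exp_log (hH.pos m)]
  refine Real.exp_le_exp.2 ?_
  have h3 : lam * (p m * (x - m)) + (1 - lam) * (p m * (y - m)) = 0 := by rw [hm]; ring
  linarith

end IsRadialProfile

end Weighted

/-! ### Means over directions and the limit at the ball. -/

section MeanRadial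

open Filter Topology Metric OrthGroup

/-- The mean over directions of a function of the logarithmic radial function. -/
noncomputable def meanRadial {E : Type*} [NormedAddCommGroup E] [InnerProductSpace ℝ E]
    [FiniteDimensional ℝ E] (H : ℝ → ℝ) (g : E → ℝ) (e : E) (ε : ℝ) : ℝ :=
  ∫ T : OrthGroup E, H (logRadial g ε (act T e)) ∂haar

namespace IsSphereFunction

variable {E : Type*} [NormedAddCommGroup E] [InnerProductSpace ℝ E] [FiniteDimensional ℝ E]
  [MeasurableSpace E] {g : E → ℝ} {G : E → E} {C : ℝ} {e : E}

lemma continuous_logRadial_comp_act (hg : IsSphereFunction g G C) (he : ‖e‖ = 1) (ε : ℝ) :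
    Continuous fun T : OrthGroup E => logRadial g ε (act T e) := by
  unfold logRadial
  refine (Continuous.log ?_ fun T => ?_).neg
  · exact (hg.continuous_wulffGauge ε).comp (by fun_prop)
  · exact (hg.wulffGauge_pos ε (by rw [norm_act, he])).ne'

/-- The radial function moves in the direction of the sign of `g` near `ε = 0`. -/
lemma tendsto_comp_logRadial (hg : IsSphereFunction g G C) {p : ℝ → ℝ} {s : ℝ}
    (hleft : Tendsto p (𝓝[<] 0) (𝓝 (p 0))) (hright : Tendsto p (𝓝[>] 0) (𝓝 s)) {θ : E}
    (hθ : ‖θ‖ = 1) (hgθ : g θ ≠ 0) :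
    Tendsto (fun ε => p (logRadial g ε θ)) (𝓝[>] 0) (𝓝 (kinkSlope (p 0) s (g θ))) := by
  have h0 : Tendsto (fun ε => logRadial g ε θ) (𝓝[>] 0) (𝓝 0) := by
    rw [tendsto_zero_iff_abs_tendsto_zero]
    refine squeeze_zero' (g := fun ε => C * ε) (Eventually.of_forall fun _ => abs_nonneg _) ?_ ?_
    · filter_upwards [self_mem_nhdsWithin] with ε hε
      exact hg.abs_logRadial_le (le_of_lt hε) hθ
    · have : Continuous fun ε : ℝ => C * ε := by fun_prop
      simpa using (this.tendsto 0).mono_left nhdsWithin_le_nhds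
  rcases hgθ.lt_or_gt with h | h
  · rw [kinkSlope_of_nonpos h.le]
    refine hleft.comp (tendsto_nhdsWithin_iff.2 ⟨h0, ?_⟩)
    filter_upwards [self_mem_nhdsWithin] with ε hε
    exact (hg.logRadial_le_mul ε hθ).trans_lt (mul_neg_of_pos_of_neg hε h)
  · rw [kinkSlope_of_pos h]
    refine hright.comp (tendsto_nhdsWithin_iff.2 ⟨h0, ?_⟩)
    have hc : Continuous fun ε : ℝ => 18 * C ^ 2 * ε := by fun_prop
    have hev := ((hc.tendsto 0).mono_left (nhdsWithin_le_nhds (s := Set.Ioi 0))).eventually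
      (gt_mem_nhds (show 18 * C ^ 2 * 0 < g θ by simpa using h))
    filter_upwards [self_mem_nhdsWithin, hev] with ε hε h1
    have hε : 0 < ε := hε
    have h2 := hg.abs_logRadial_sub_le (a := ε) (ε := 0) (ε' := ε) ⟨le_rfl, hε.le⟩
      ⟨hε.le, le_rfl⟩ hθ
    have h3 : logRadial g 0 θ = 0 := by
      have := hg.abs_logRadial_le le_rfl hθ
      rw [mul_zero] at this
      exact abs_nonpos_iff.1 this
    rw [h3, sub_zero, sub_zero, abs_of_pos hε] at h2
    have h4 := (_root_.abs_le.1 h2).1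
    have h5 := mul_lt_mul_of_pos_right h1 hε
    show 0 < logRadial g ε θ
    linarith

variable {H p : ℝ → ℝ} {n : ℝ}

lemma integrable_comp_logRadial (hg : IsSphereFunction g G C) (hH : IsRadialProfile H p n)
    (he : ‖e‖ = 1) (ε : ℝ) :
    Integrable (fun T : OrthGroup E => H (logRadial g ε (act T e))) haar :=
  integrable_of_continuous (hH.continuous.comp (hg.continuous_logRadial_comp_act he ε))

variable [BorelSpace E]

/-- The strict inequality between variance and energy persists for small `ε`. -/
lemma exists_eventually_integral_neg (hg : IsSphereFunction g G C) (hH : IsRadialProfile H p n)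
    (he : ‖e‖ = 1) {s c : ℝ} (hs : 0 ≤ s) (hsp : s ≤ p 0) (hright : Tendsto p (𝓝[>] 0) (𝓝 s))
    (hlt : ∫ T : OrthGroup E, (kinkSlope (p 0) s (g (act T e)) * g (act T e) - c) ^ 2 ∂haar <
      ∫ T : OrthGroup E, kinkSlope (p 0) s (g (act T e)) * ‖G (act T e)‖ ^ 2 ∂haar) :
    ∃ η > 0, η ≤ 1 ∧ ∀ᶠ ε in 𝓝[>] (0 : ℝ), ∫ T : OrthGroup E, H (logRadial g ε (act T e)) *
      ((1 + η) * (|p (logRadial g ε (act T e)) * g (act T e) - c| + n * η) ^ 2 + n * η -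
        p (logRadial g ε (act T e)) * ‖G (act T e)‖ ^ 2) ∂haar < 0 := by
  have hC := hg.nonneg
  have hn : 0 ≤ n := (hH.nonneg 0).trans (hH.le 0)
  set P : E → ℝ := fun x => kinkSlope (p 0) s (g x) with hP
  have hP0 (x) : 0 ≤ P x := kinkSlope_nonneg hs hsp _
  have hPn (x) : P x ≤ n := (kinkSlope_le hsp _).trans (hH.le 0)
  set B := n * C + |c| with hB
  have hB0 : 0 ≤ B := by positivity
  have hpB {y x} (hy0 : 0 ≤ y) (hyn : y ≤ n) : |y * g x - c| ≤ B := by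
    refine (abs_sub _ _).trans (add_le_add_left ?_ _)
    rw [abs_mul, abs_of_nonneg hy0]
    exact mul_le_mul hyn (hg.abs_le x) (abs_nonneg _) hn
  have hact : Measurable fun T : OrthGroup E => act T e :=
    (show Continuous fun T : OrthGroup E => act T e by fun_prop).measurable
  have hmP : Measurable fun T : OrthGroup E => P (act T e) :=
    measurable_kinkSlope.comp (hg.measurable.comp hact)
  have hmg : Measurable fun T : OrthGroup E => g (act T e) := hg.measurable.comp hact
  have hmG : Measurable fun T : OrthGroup E => ‖G (act T e)‖ ^ 2 :=
    (hg.measurable_grad.comp hact).norm.pow_const 2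
  have hGC (T : OrthGroup E) : ‖G (act T e)‖ ^ 2 ≤ C ^ 2 :=
    pow_le_pow_left₀ (norm_nonneg _) (hg.norm_grad_le _ (by rw [norm_act, he])) 2
  have hi1 : Integrable (fun T : OrthGroup E => (P (act T e) * g (act T e) - c) ^ 2) haar := by
    refine Integrable.of_bound (C := B ^ 2)
      (((hmP.mul hmg).sub_const c).pow_const 2).aestronglyMeasurable
      (Eventually.of_forall fun T => ?_)
    rw [norm_pow]
    exact pow_le_pow_left₀ (norm_nonneg _) (hpB (hP0 _) (hPn _)) 2
  have hi2 : Integrable (fun T : OrthGroup E => P (act T e) * ‖G (act T e)‖ ^ 2) haar := by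
    simpa using hg.integrable_kinkSlope_mul hs hsp he 1 2
  obtain ⟨η, ⟨hη1, hη⟩, hη0⟩ : ∃ η : ℝ, (η ≤ 1 ∧
      η * B ^ 2 + (1 + η) * (2 * n * η * B + n ^ 2 * η ^ 2) + n * η <
      ∫ T : OrthGroup E, P (act T e) * ‖G (act T e)‖ ^ 2 ∂haar -
      ∫ T : OrthGroup E, (P (act T e) * g (act T e) - c) ^ 2 ∂haar) ∧ 0 < η := by
    have hc : Continuous fun η : ℝ =>
      η * B ^ 2 + (1 + η) * (2 * n * η * B + n ^ 2 * η ^ 2) + n * η := by fun_prop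
    have h1 : ∀ᶠ η : ℝ in 𝓝[>] 0, η ≤ 1 :=
      Filter.eventually_of_mem (Ioc_mem_nhdsGT zero_lt_one) fun a ha => ha.2
    have h2 := ((hc.tendsto 0).mono_left (nhdsWithin_le_nhds (s := Set.Ioi 0))).eventually
      (gt_mem_nhds (show _ < ∫ T : OrthGroup E, P (act T e) * ‖G (act T e)‖ ^ 2 ∂haar -
        ∫ T : OrthGroup E, (P (act T e) * g (act T e) - c) ^ 2 ∂haar by
          simpa using sub_pos.2 hlt))
    exact ((h1.and h2).and self_mem_nhdsWithin).exists
  refine ⟨η, hη0, hη1, ?_⟩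
  set Φ : ℝ → E → ℝ := fun y x => (1 + η) * (|y * g x - c| + n * η) ^ 2 + n * η with hΦ
  have hnη : 0 ≤ n * η := by positivity
  have hΦB {y x} (hy0 : 0 ≤ y) (hyn : y ≤ n) : |Φ y x| ≤ (1 + η) * (B + n * η) ^ 2 + n * η := by
    rw [abs_of_nonneg (by positivity)]
    have := hpB (x := x) hy0 hyn
    simp only [hΦ]
    gcongr
  have hlim_neg : ∫ T : OrthGroup E, H 0 * (Φ (P (act T e)) (act T e) -
      P (act T e) * ‖G (act T e)‖ ^ 2) ∂haar < 0 := by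
    rw [integral_const_mul]
    refine mul_neg_of_pos_of_neg (hH.pos 0) ?_
    have hmΦ : Measurable fun T : OrthGroup E => Φ (P (act T e)) (act T e) :=
      (((((hmP.mul hmg).sub_const c).abs.add_const (n * η)).pow_const 2).const_mul
        (1 + η)).add_const (n * η)
    have hi3 : Integrable (fun T : OrthGroup E => Φ (P (act T e)) (act T e)) haar :=
      Integrable.of_bound hmΦ.aestronglyMeasurable _
        (Eventually.of_forall fun T => hΦB (hP0 _) (hPn _))
    rw [integral_sub hi3 hi2]
    have h1 : ∫ T : OrthGroup E, Φ (P (act T e)) (act T e) ∂haar ≤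
        ∫ T : OrthGroup E, ((P (act T e) * g (act T e) - c) ^ 2 +
          (η * B ^ 2 + (1 + η) * (2 * n * η * B + n ^ 2 * η ^ 2) + n * η)) ∂haar := by
      refine integral_mono hi3 (hi1.add (integrable_const _)) fun T => ?_
      simp only [hΦ]
      have h2 := hpB (x := act T e) (hP0 (act T e)) (hPn (act T e))
      rw [← sq_abs (P (act T e) * g (act T e) - c)]
      set w := |P (act T e) * g (act T e) - c|
      have hw : 0 ≤ w := abs_nonneg _
      have h3 : w ^ 2 ≤ B ^ 2 := pow_le_pow_left₀ hw h2 2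
      have h4 := mul_le_mul_of_nonneg_left h3 hη0.le
      have h5 := mul_le_mul_of_nonneg_left h2 (show 0 ≤ (1 + η) * (2 * n * η) by positivity)
      linarith
    rw [integral_add hi1 (integrable_const _)] at h1
    simp only [integral_const, probReal_univ, one_smul] at h1
    linarith
  -- Taking the minimum only raises the integrand. Where `g = 0`, the radial logarithm is
  -- nonpositive, hence `p ≥ p 0` and the minimum is exactly `P`, while `Φ` does not see `p`. The
  -- integrand therefore converges at every direction.
  set F : ℝ → OrthGroup E → ℝ := fun ε T => H (logRadial g ε (act T e)) *
      (Φ (p (logRadial g ε (act T e))) (act T e) -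
        min (p (logRadial g ε (act T e))) (P (act T e)) * ‖G (act T e)‖ ^ 2) with hF
  have hmt (ε) : Measurable fun T : OrthGroup E => logRadial g ε (act T e) :=
    (hg.continuous_logRadial_comp_act he ε).measurable
  have hmp (ε) : Measurable fun T : OrthGroup E => p (logRadial g ε (act T e)) :=
    hH.anti.measurable.comp (hmt ε)
  have hmH (ε) : Measurable fun T : OrthGroup E => H (logRadial g ε (act T e)) :=
    hH.continuous.measurable.comp (hmt ε)
  have hmΦ (ε) : Measurable fun T : OrthGroup E =>
      Φ (p (logRadial g ε (act T e))) (act T e) :=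
    ((((((hmp ε).mul hmg).sub_const c).abs.add_const (n * η)).pow_const 2).const_mul
      (1 + η)).add_const (n * η)
  have hsm : ∀ᶠ ε : ℝ in 𝓝[>] 0, 0 < ε ∧ ε ≤ 1 := Ioc_mem_nhdsGT zero_lt_one
  have hHle {ε : ℝ} (hε : 0 < ε ∧ ε ≤ 1) (T : OrthGroup E) :
      H (logRadial g ε (act T e)) ≤ H C := by
    refine hH.monotone ?_
    have h1 := hg.abs_logRadial_le (θ := act T e) hε.1.le (by rw [norm_act, he])
    have h2 := mul_le_mul_of_nonneg_left hε.2 hC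
    linarith [le_abs_self (logRadial g ε (act T e))]
  set D := (1 + η) * (B + n * η) ^ 2 + n * η + n * C ^ 2 with hD
  have hFm (ε) : AEStronglyMeasurable (F ε) haar :=
    ((hmH ε).mul ((hmΦ ε).sub (((hmp ε).min hmP).mul hmG))).aestronglyMeasurable
  have hbound {ε : ℝ} (hε : 0 < ε ∧ ε ≤ 1) (T : OrthGroup E) {y : ℝ} (hy0 : 0 ≤ y)
      (hyn : y ≤ n) : ‖H (logRadial g ε (act T e)) *
      (Φ (p (logRadial g ε (act T e))) (act T e) - y * ‖G (act T e)‖ ^ 2)‖ ≤ H C * D := by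
    rw [norm_mul, Real.norm_of_nonneg (hH.pos _).le]
    refine mul_le_mul (hHle hε T) ?_ (norm_nonneg _) (hH.pos _).le
    refine (norm_sub_le _ _).trans (add_le_add (hΦB (hH.nonneg _) (hH.le _)) ?_)
    rw [Real.norm_of_nonneg (by positivity)]
    exact mul_le_mul hyn (hGC T) (by positivity) hn
  have hmin0 (ε) (T : OrthGroup E) :
      0 ≤ min (p (logRadial g ε (act T e))) (P (act T e)) := le_min (hH.nonneg _) (hP0 _)
  have hminn (ε) (T : OrthGroup E) :
      min (p (logRadial g ε (act T e))) (P (act T e)) ≤ n := (min_le_left _ _).trans (hH.le _)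
  have hlim : Tendsto (fun ε => ∫ T, F ε T ∂haar) (𝓝[>] 0)
      (𝓝 (∫ T : OrthGroup E, H 0 * (Φ (P (act T e)) (act T e) -
      P (act T e) * ‖G (act T e)‖ ^ 2) ∂haar)) := by
    refine tendsto_integral_filter_of_dominated_convergence (fun _ => H C * D)
      (Eventually.of_forall hFm) ?_ (integrable_const _) (Eventually.of_forall fun T => ?_)
    · filter_upwards [hsm] with ε hε
      exact Eventually.of_forall fun T => hbound hε T (hmin0 ε T) (hminn ε T)
    · have hθ : ‖act T e‖ = 1 := by rw [norm_act, he]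
      have ht0 : Tendsto (fun ε => logRadial g ε (act T e)) (𝓝[>] 0) (𝓝 0) := by
        rw [tendsto_zero_iff_abs_tendsto_zero]
        refine squeeze_zero' (g := fun ε => C * ε) (Eventually.of_forall fun _ => abs_nonneg _)
          ?_ ?_
        · filter_upwards [hsm] with ε hε
          exact hg.abs_logRadial_le hε.1.le hθ
        · have : Continuous fun ε : ℝ => C * ε := by fun_prop
          simpa using (this.tendsto 0).mono_left nhdsWithin_le_nhds
      have htH := (hH.continuous.tendsto 0).comp ht0
      refine htH.mul ?_
      by_cases hg0 : g (act T e) = 0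
      · refine tendsto_const_nhds.congr' ?_
        filter_upwards [hsm] with ε hε
        have h1 := hg.logRadial_le_mul ε hθ
        rw [hg0, mul_zero] at h1
        have h2 : P (act T e) = p 0 := by
          simp only [hP]; exact kinkSlope_of_nonpos hg0.le
        rw [h2, min_eq_right (hH.anti h1)]
        simp only [hΦ, hg0, mul_zero]
      · have hp := hg.tendsto_comp_logRadial hH.left_cont hright hθ hg0
        have hm := hp.min (tendsto_const_nhds (x := P (act T e)))
        rw [show kinkSlope (p 0) s (g (act T e)) = P (act T e) from rfl, min_self] at hm
        have hΦc : Continuous fun y => Φ y (act T e) := by simp only [hΦ]; fun_prop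
        exact ((hΦc.tendsto _).comp hp).sub (hm.mul_const _)
  filter_upwards [hlim.eventually (gt_mem_nhds hlim_neg), hsm] with ε h1 hε
  refine lt_of_le_of_lt (integral_mono ?_ ?_ fun T => ?_) h1
  · exact Integrable.of_bound ((hmH ε).mul ((hmΦ ε).sub ((hmp ε).mul hmG))).aestronglyMeasurable _
      (Eventually.of_forall fun T => hbound hε T (hH.nonneg _) (hH.le _))
  · exact Integrable.of_bound (hFm ε) _
      (Eventually.of_forall fun T => hbound hε T (hmin0 ε T) (hminn ε T))
  · refine mul_le_mul_of_nonneg_left (sub_le_sub_left ?_ _) (hH.pos _).le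
    exact mul_le_mul_of_nonneg_right (min_le_left _ _) (by positivity)

end IsSphereFunction

end MeanRadial

/-! ### Log-concavity of the mean, case by case. -/

section LogConcavity

open Filter Topology Metric OrthGroup

namespace IsSphereFunction

variable {E : Type*} [NormedAddCommGroup E] [InnerProductSpace ℝ E] [FiniteDimensional ℝ E]
  [MeasurableSpace E] {g : E → ℝ} {G : E → E} {C : ℝ} {e : E}
  {H p : ℝ → ℝ} {n : ℝ}

/-- Log-concavity of the mean near `ε = 0`, under a strict variance estimate. -/
lemma exists_meanRadial_of_eventually_neg (hg : IsSphereFunction g G C)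
    (hH : IsRadialProfile H p n) (he : ‖e‖ = 1) {η c : ℝ} (hη : 0 < η) (hη1 : η ≤ 1)
    (hneg : ∀ᶠ ε in 𝓝[>] (0 : ℝ), ∫ T : OrthGroup E, H (logRadial g ε (act T e)) *
      ((1 + η) * (|p (logRadial g ε (act T e)) * g (act T e) - c| + n * η) ^ 2 + n * η -
        p (logRadial g ε (act T e)) * ‖G (act T e)‖ ^ 2) ∂haar < 0) :
    ∃ a > 0, ∀ ε₁ ∈ Set.Ioo 0 a, ∀ ε₂ ∈ Set.Ioo 0 a, ∀ lam ∈ Set.Icc (0 : ℝ) 1,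
      meanRadial H g e ε₁ ^ lam * meanRadial H g e ε₂ ^ (1 - lam) ≤
        meanRadial H g e (lam * ε₁ + (1 - lam) * ε₂) := by
  have hC := hg.nonneg
  have hn : 0 ≤ n := (hH.nonneg 0).trans (hH.le 0)
  obtain ⟨a₁, ha₁, hb⟩ := hg.exists_logRadial_bounds hη
  obtain ⟨a₂, ha₂, hneg⟩ := mem_nhdsGT_iff_exists_Ioo_subset.1 hneg
  have ha₂ : 0 < a₂ := ha₂
  -- This keeps every exponent `p (t_ε - t_ε₀)` below `η / 2`, as the exponential estimate with `κ =
  -- η` requires.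
  set a₃ := η / 2 / (n * (C + η) + 1) with ha₃
  have hden : 0 < n * (C + η) + 1 := by positivity
  have ha₃0 : 0 < a₃ := by positivity
  refine ⟨min a₁ (min a₂ a₃), by positivity, fun ε₁ h₁ ε₂ h₂ lam hl => ?_⟩
  have hl1 : 0 ≤ 1 - lam := by linarith [hl.2]
  set ε₀ := lam * ε₁ + (1 - lam) * ε₂ with hε₀
  have h₀ : ε₀ ∈ Set.Ioo 0 (min a₁ (min a₂ a₃)) := by
    simpa using (convex_Ioo 0 (min a₁ (min a₂ a₃))) h₁ h₂ hl.1 hl1 (by ring)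
  have hsub1 : Set.Ioo 0 (min a₁ (min a₂ a₃)) ⊆ Set.Ioo 0 a₁ :=
    Set.Ioo_subset_Ioo_right (min_le_left _ _)
  have hsub3 : min a₁ (min a₂ a₃) ≤ a₃ := (min_le_right _ _).trans (min_le_right _ _)
  have hI := hneg ⟨h₀.1, h₀.2.trans_le ((min_le_right _ _).trans (min_le_left _ _))⟩
  have hI : ∫ T : OrthGroup E, H (logRadial g ε₀ (act T e)) *
      ((1 + η) * (|p (logRadial g ε₀ (act T e)) * g (act T e) - c| + n * η) ^ 2 + n * η -
        p (logRadial g ε₀ (act T e)) * ‖G (act T e)‖ ^ 2) ∂haar < 0 := hI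
  have hunit (T : OrthGroup E) : ‖act T e‖ = 1 := by rw [norm_act, he]
  set t : ℝ → OrthGroup E → ℝ := fun ε T => logRadial g ε (act T e) with ht
  have htc (ε) : Continuous (t ε) := hg.continuous_logRadial_comp_act he ε
  set q : OrthGroup E → ℝ := fun T => p (t ε₀ T) with hq
  have hqm : Measurable q := hH.anti.measurable.comp (htc ε₀).measurable
  have hq0 (T) : 0 ≤ q T := hH.nonneg _
  have hqn (T) : q T ≤ n := hH.le _
  have hhint : Integrable (fun T => H (t ε₀ T)) haar := hg.integrable_comp_logRadial hH he ε₀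
  have hfirst {ε : ℝ} (hε : ε ∈ Set.Ioo 0 (min a₁ (min a₂ a₃))) (T : OrthGroup E) :
      |t ε T - t ε₀ T - (ε - ε₀) * g (act T e)| ≤ η * |ε - ε₀| :=
    (hb ε (hsub1 hε) ε₀ (hsub1 h₀) (act T e) (hunit T)).1
  have hsmall {ε : ℝ} (hε : ε ∈ Set.Ioo 0 (min a₁ (min a₂ a₃))) (T : OrthGroup E) :
      |q T * (t ε T - t ε₀ T)| ≤ η / 2 := by
    have h3 : |t ε T - t ε₀ T| ≤ (C + η) * |ε - ε₀| := by
      have h4 := abs_add_le (t ε T - t ε₀ T - (ε - ε₀) * g (act T e)) ((ε - ε₀) * g (act T e))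
      rw [sub_add_cancel, abs_mul] at h4
      have h5 := mul_le_mul_of_nonneg_left (hg.abs_le (act T e)) (abs_nonneg (ε - ε₀))
      linarith [hfirst hε T]
    have h6 : |ε - ε₀| ≤ a₃ := by
      rw [_root_.abs_le]
      constructor <;> linarith [hε.1, hε.2, h₀.1, h₀.2]
    rw [abs_mul, abs_of_nonneg (hq0 T)]
    calc q T * |t ε T - t ε₀ T| ≤ n * ((C + η) * a₃) := by
          refine mul_le_mul (hqn T) (h3.trans ?_) (abs_nonneg _) hn
          gcongr
      _ = n * (C + η) * a₃ := by ring
      _ ≤ (n * (C + η) + 1) * a₃ := by gcongr; linarith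
      _ = η / 2 := by rw [ha₃]; field_simp
  have hmean {ε : ℝ} : 0 ≤ meanRadial H g e ε := integral_nonneg fun T => (hH.pos _).le
  have hm {ε : ℝ} (hε : ε ∈ Set.Ioo 0 (min a₁ (min a₂ a₃))) : meanRadial H g e ε ≤
      ∫ T, H (t ε₀ T) * Real.exp (q T * (t ε T - t ε₀ T)) ∂haar := by
    refine integral_mono (hg.integrable_comp_logRadial hH he ε) ?_ fun T => hH.le_mul_exp _ _
    refine hhint.mul_bdd (c := Real.exp (η / 2)) ?_ (Eventually.of_forall fun T => ?_)
    · exact (hqm.mul ((htc ε).sub (htc ε₀)).measurable).exp.aestronglyMeasurable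
    · rw [Real.norm_of_nonneg (Real.exp_pos _).le]
      exact Real.exp_le_exp.2 ((le_abs_self _).trans (hsmall hε T))
  have ham (ε) : AEStronglyMeasurable (fun T => q T * (t ε T - t ε₀ T)) haar :=
    (hqm.mul ((htc ε).sub (htc ε₀)).measurable).aestronglyMeasurable
  have hZ : 0 < ∫ T, H (t ε₀ T) ∂haar := by
    refine (integral_pos_iff_support_of_nonneg (fun T => (hH.pos _).le) hhint).2 ?_
    rw [Function.support_eq_univ fun T => (hH.pos (t ε₀ T)).ne']
    simp
  refine (mul_le_mul (Real.rpow_le_rpow hmean (hm h₁) hl.1) (Real.rpow_le_rpow hmean (hm h₂) hl1)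
    (Real.rpow_nonneg hmean _) (Real.rpow_nonneg (hmean.trans (hm h₁)) _)).trans ?_
  refine rpow_integral_mul_rpow_integral_le hη1 hhint (fun T => (hH.pos _).le) (ham ε₁) (ham ε₂)
    (hsmall h₁) (hsmall h₂) hZ ((ε₁ - ε₀) * c) ((ε₂ - ε₀) * c) hl ?_
  set κ := lam * (1 - lam) * (ε₁ - ε₂) ^ 2 / 2 with hκ
  have hκ0 : 0 ≤ κ := div_nonneg (mul_nonneg (mul_nonneg hl.1 hl1) (sq_nonneg _)) two_pos.le
  have hdev {ε : ℝ} (hε : ε ∈ Set.Ioo 0 (min a₁ (min a₂ a₃))) (T : OrthGroup E) :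
      (q T * (t ε T - t ε₀ T) - (ε - ε₀) * c) ^ 2 ≤
        (ε - ε₀) ^ 2 * (|q T * g (act T e) - c| + n * η) ^ 2 := by
    rw [← sq_abs, ← sq_abs (ε - ε₀), ← mul_pow]
    refine pow_le_pow_left₀ (abs_nonneg _) ?_ 2
    have h3 : q T * (t ε T - t ε₀ T) - (ε - ε₀) * c =
      q T * (t ε T - t ε₀ T - (ε - ε₀) * g (act T e)) + (ε - ε₀) * (q T * g (act T e) - c) := by
      ring
    rw [h3]
    refine (abs_add_le _ _).trans ?_
    rw [abs_mul, abs_mul, abs_of_nonneg (hq0 T)]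
    have h4 := mul_le_mul (hqn T) (hfirst hε T) (abs_nonneg _) hn
    linarith
  -- The second order bound on the radial functions supplies the energy term and the first order
  -- bound the variance term, both with the common factor `κ`; the integrand of `hneg` remains.
  have hpt (T : OrthGroup E) : H (t ε₀ T) * (lam * (q T * (t ε₁ T - t ε₀ T) + (1 + η) / 2 *
      (q T * (t ε₁ T - t ε₀ T) - (ε₁ - ε₀) * c) ^ 2) +
      (1 - lam) * (q T * (t ε₂ T - t ε₀ T) + (1 + η) / 2 *
      (q T * (t ε₂ T - t ε₀ T) - (ε₂ - ε₀) * c) ^ 2)) ≤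
      κ * (H (t ε₀ T) * ((1 + η) * (|q T * g (act T e) - c| + n * η) ^ 2 + n * η -
        q T * ‖G (act T e)‖ ^ 2)) := by
    rw [mul_left_comm κ]
    refine mul_le_mul_of_nonneg_left ?_ (hH.pos _).le
    have h3 := (hb ε₁ (hsub1 h₁) ε₂ (hsub1 h₂) (act T e) (hunit T)).2 lam hl
    have h4 := mul_le_mul_of_nonneg_left h3 (hq0 T)
    have h5 := mul_le_mul_of_nonneg_left (hdev h₁ T) hl.1
    have h6 := mul_le_mul_of_nonneg_left (hdev h₂ T) hl1
    have e1 : ε₁ - ε₀ = (1 - lam) * (ε₁ - ε₂) := by rw [hε₀]; ring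
    have e2 : ε₂ - ε₀ = -(lam * (ε₁ - ε₂)) := by rw [hε₀]; ring
    set W := (|q T * g (act T e) - c| + n * η) ^ 2
    have h7 : lam * ((ε₁ - ε₀) ^ 2 * W) + (1 - lam) * ((ε₂ - ε₀) ^ 2 * W) = 2 * κ * W := by
      rw [e1, e2, hκ]; ring
    have h8 : (1 + η) / 2 * (lam * (q T * (t ε₁ T - t ε₀ T) - (ε₁ - ε₀) * c) ^ 2 +
        (1 - lam) * (q T * (t ε₂ T - t ε₀ T) - (ε₂ - ε₀) * c) ^ 2) ≤ (1 + η) / 2 * (2 * κ * W) :=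
      mul_le_mul_of_nonneg_left (by linarith) (by positivity)
    have h9 : q T * (lam * t ε₁ T + (1 - lam) * t ε₂ T - t ε₀ T) ≤
        κ * (q T * η - q T * ‖G (act T e)‖ ^ 2) := by
      refine h4.trans (le_of_eq ?_)
      rw [hκ]; ring
    have h10 : κ * (q T * η) ≤ κ * (n * η) :=
      mul_le_mul_of_nonneg_left (mul_le_mul_of_nonneg_right (hqn T) hη.le) hκ0
    linarith
  -- Integrability need not be proved: an undefined integral is `0`, which contradicts the strict
  -- inequality `hI` for the bound and is harmless for the quantity to be bounded.
  by_cases hint : Integrable (fun T => H (t ε₀ T) *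
      ((1 + η) * (|q T * g (act T e) - c| + n * η) ^ 2 + n * η - q T * ‖G (act T e)‖ ^ 2)) haar
  · by_cases hint' : Integrable (fun T => H (t ε₀ T) * (lam * (q T * (t ε₁ T - t ε₀ T) +
      (1 + η) / 2 * (q T * (t ε₁ T - t ε₀ T) - (ε₁ - ε₀) * c) ^ 2) +
      (1 - lam) * (q T * (t ε₂ T - t ε₀ T) + (1 + η) / 2 *
      (q T * (t ε₂ T - t ε₀ T) - (ε₂ - ε₀) * c) ^ 2))) haar
    · refine (integral_mono hint' (hint.const_mul κ) hpt).trans ?_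
      rw [integral_const_mul]
      exact mul_nonpos_of_nonneg_of_nonpos hκ0 hI.le
    · exact (integral_undef hint').le
  · exact absurd (integral_undef hint) hI.ne

/-- Concavity of the mean when the profile is concave near the sphere. -/
lemma exists_meanRadial_of_concaveOn (hg : IsSphereFunction g G C)
    (hH : IsRadialProfile H p n) (he : ‖e‖ = 1) {δ : ℝ} (hδ : 0 < δ)
    (hconc : ConcaveOn ℝ (Set.Ici (-δ)) H) :
    ∃ a > 0, ∀ ε₁ ∈ Set.Ioo 0 a, ∀ ε₂ ∈ Set.Ioo 0 a, ∀ lam ∈ Set.Icc (0 : ℝ) 1,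
      meanRadial H g e ε₁ ^ lam * meanRadial H g e ε₂ ^ (1 - lam) ≤
        meanRadial H g e (lam * ε₁ + (1 - lam) * ε₂) := by
  have hC := hg.nonneg
  refine ⟨δ / (C + 1), by positivity, fun ε₁ h₁ ε₂ h₂ lam hl => ?_⟩
  have hl1 : 0 ≤ 1 - lam := by linarith [hl.2]
  have hmean {ε : ℝ} : 0 ≤ meanRadial H g e ε := integral_nonneg fun T => (hH.pos _).le
  refine (Real.geom_mean_le_arith_mean2_weighted hl.1 hl1 hmean hmean (by ring)).trans ?_
  unfold meanRadial
  have i1 := hg.integrable_comp_logRadial hH he ε₁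
  have i2 := hg.integrable_comp_logRadial hH he ε₂
  rw [← integral_const_mul, ← integral_const_mul, ← integral_add (i1.const_mul _) (i2.const_mul _)]
  refine integral_mono ((i1.const_mul _).add (i2.const_mul _))
    (hg.integrable_comp_logRadial hH he _) fun T => ?_
  have hθ : ‖act T e‖ = 1 := by rw [norm_act, he]
  have hmem {ε : ℝ} (hε : ε ∈ Set.Ioo 0 (δ / (C + 1))) :
      logRadial g ε (act T e) ∈ Set.Ici (-δ) := by
    have h3 := (_root_.abs_le.1 (hg.abs_logRadial_le hε.1.le hθ)).1
    have h4 := (lt_div_iff₀ (by positivity)).1 hε.2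
    have h5 := hε.1
    show -δ ≤ _
    linarith
  have h6 := hconc.2 (hmem h₁) (hmem h₂) hl.1 hl1 (by ring)
  simp only [smul_eq_mul] at h6
  exact h6.trans (hH.monotone (hg.logRadial_concave hθ ε₁ ε₂ hl))

/-- Log-concavity of the mean for balls. -/
lemma meanRadial_of_const (hg : IsSphereFunction g G C) (hH : IsRadialProfile H p n)
    (he : ‖e‖ = 1) {k : ℝ} (hk : ∀ u, ‖u‖ = 1 → g u = k) (ε₁ ε₂ : ℝ) {lam : ℝ}
    (hl : lam ∈ Set.Icc (0 : ℝ) 1) :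
    meanRadial H g e ε₁ ^ lam * meanRadial H g e ε₂ ^ (1 - lam) ≤
      meanRadial H g e (lam * ε₁ + (1 - lam) * ε₂) := by
  have h (ε) : meanRadial H g e ε = H (ε * k) := by
    unfold meanRadial
    rw [integral_congr_ae (g := fun _ => H (ε * k))]
    · simp
    · exact Eventually.of_forall fun T => congrArg H
        (hg.logRadial_eq_of_const ε (by rw [norm_act, he]) hk)
  rw [h, h, h]
  convert hH.rpow_mul_rpow_le (ε₁ * k) (ε₂ * k) hl using 2
  ring

/-- Log-concavity of the mean when the profile has a vertex and the bodies contain the ball. -/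
lemma meanRadial_of_nonneg (hg : IsSphereFunction g G C) (hH : IsRadialProfile H p n)
    (he : ‖e‖ = 1) (hright : Tendsto p (𝓝[>] 0) (𝓝 0)) (h0 : ∀ u, ‖u‖ = 1 → 0 ≤ g u)
    {ε₁ ε₂ : ℝ} (h₁ : 0 ≤ ε₁) (h₂ : 0 ≤ ε₂) {lam : ℝ} (hl : lam ∈ Set.Icc (0 : ℝ) 1) :
    meanRadial H g e ε₁ ^ lam * meanRadial H g e ε₂ ^ (1 - lam) ≤
      meanRadial H g e (lam * ε₁ + (1 - lam) * ε₂) := by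
  -- A vanishing right slope makes `H` constant on `[0, ∞)`, where all the radial logarithms lie.
  have hp (s : ℝ) (hs : 0 < s) : p s = 0 := by
    refine le_antisymm (ge_of_tendsto hright ?_) (hH.nonneg s)
    filter_upwards [Ioo_mem_nhdsGT hs] with x hx using hH.anti hx.2.le
  have hle (t s : ℝ) (hs : 0 < s) : H t ≤ H s := by
    simpa [hp s hs] using hH.le_mul_exp s t
  have hle0 (t : ℝ) : H t ≤ H 0 := by
    refine ge_of_tendsto ((hH.continuous.tendsto 0).mono_left
      (nhdsWithin_le_nhds (s := Set.Ioi 0))) ?_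
    filter_upwards [self_mem_nhdsWithin] with s hs using hle t s hs
  have h (ε) (hε : 0 ≤ ε) : meanRadial H g e ε = H 0 := by
    unfold meanRadial
    rw [integral_congr_ae (g := fun _ => H 0)]
    · simp
    · exact Eventually.of_forall fun T => le_antisymm (hle0 _)
        (hH.monotone (hg.logRadial_nonneg hε (by rw [norm_act, he]) h0))
  have hl1 : 0 ≤ 1 - lam := by linarith [hl.2]
  rw [h _ h₁, h _ h₂, h _ (by have := mul_nonneg hl.1 h₁; have := mul_nonneg hl1 h₂; linarith),
    ← Real.rpow_add (hH.pos 0)]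
  simp

variable [BorelSpace E]

/-- The mean over directions of a radial profile is log-concave near `ε = 0`. -/
theorem exists_meanRadial_log_concave (hg : IsSphereFunction g G C)
    (hH : IsRadialProfile H p n) (hn : n = Module.finrank ℝ E) (he : ‖e‖ = 1) :
    ∃ a > 0, ∀ ε₁ ∈ Set.Ioo 0 a, ∀ ε₂ ∈ Set.Ioo 0 a, ∀ lam ∈ Set.Icc (0 : ℝ) 1,
      meanRadial H g e ε₁ ^ lam * meanRadial H g e ε₂ ^ (1 - lam) ≤
        meanRadial H g e (lam * ε₁ + (1 - lam) * ε₂) := by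
  rcases (hH.nonneg 0).eq_or_lt with hp0 | hp0
  · obtain ⟨δ, hδ, hconc⟩ := hH.concaveOn hp0.symm
    exact hg.exists_meanRadial_of_concaveOn hH he hδ hconc
  have hright := hH.anti.tendsto_rightLim 0
  set s := Function.rightLim p 0 with hs
  have hs0 : 0 ≤ s := ge_of_tendsto hright (Eventually.of_forall hH.nonneg)
  have hsp : s ≤ p 0 := by
    refine le_of_tendsto hright ?_
    filter_upwards [self_mem_nhdsWithin] with x hx using hH.anti (le_of_lt hx)
  rcases hg.kink_const_or_variance_lt hs0 hsp hp0 (hn ▸ hH.le 0) he with ⟨c, hc⟩ | ⟨c, hc⟩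
  -- With both slopes positive the two-slope function is injective, so `g` is constant. With `s = 0`
  -- it forgets the positive part of `g`; a negative value of `g` still forces `g` to be constant.
  · rcases hs0.eq_or_lt with h0 | h0
    · by_cases hpos : ∀ u, ‖u‖ = 1 → 0 ≤ g u
      · rw [← h0] at hright
        exact ⟨1, one_pos, fun ε₁ h₁ ε₂ h₂ lam hl =>
          hg.meanRadial_of_nonneg hH he hright hpos h₁.1.le h₂.1.le hl⟩
      · push Not at hpos
        obtain ⟨v, hv, hgv⟩ := hpos
        have hcv := hc v hv
        rw [kinkSlope_of_nonpos hgv.le] at hcv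
        refine ⟨1, one_pos, fun ε₁ _ ε₂ _ lam hl =>
          hg.meanRadial_of_const hH he (k := g v) (fun u hu => ?_) ε₁ ε₂ hl⟩
        have hcu := hc u hu
        rcases le_or_gt (g u) 0 with h | h
        · rw [kinkSlope_of_nonpos h, ← hcv] at hcu
          exact mul_left_cancel₀ hp0.ne' hcu
        · rw [kinkSlope_of_pos h, ← h0, zero_mul, ← hcv] at hcu
          exact absurd hcu (mul_neg_of_pos_of_neg hp0 hgv).ne'
    · refine ⟨1, one_pos, fun ε₁ _ ε₂ _ lam hl =>
        hg.meanRadial_of_const hH he (k := g e) (fun u hu => ?_) ε₁ ε₂ hl⟩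
      have h1 := (hc u hu).trans (hc e he).symm
      rcases le_or_gt (g u) 0 with h | h <;> rcases le_or_gt (g e) 0 with h' | h'
      · rw [kinkSlope_of_nonpos h, kinkSlope_of_nonpos h'] at h1
        exact mul_left_cancel₀ hp0.ne' h1
      · rw [kinkSlope_of_nonpos h, kinkSlope_of_pos h'] at h1
        nlinarith [mul_pos h0 h', mul_nonneg hp0.le (neg_nonneg.2 h)]
      · rw [kinkSlope_of_pos h, kinkSlope_of_nonpos h'] at h1
        nlinarith [mul_pos h0 h, mul_nonneg hp0.le (neg_nonneg.2 h')]
      · rw [kinkSlope_of_pos h, kinkSlope_of_pos h'] at h1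
        exact mul_left_cancel₀ h0.ne' h1
  · obtain ⟨η, hη, hη1, hneg⟩ := hg.exists_eventually_integral_neg hH he hs0 hsp hright hc
    exact hg.exists_meanRadial_of_eventually_neg hH he hη hη1 hneg

end IsSphereFunction

end LogConcavity

/-! ### From means back to measures of bodies. -/

section WulffMeasure

open Filter Topology Metric OrthGroup

lemma ENNReal.rpow_mul_rpow_one_sub_le {x : ENNReal} {lam : ℝ} (hl : lam ∈ Set.Icc (0 : ℝ) 1) :
    x ^ lam * x ^ (1 - lam) ≤ x := by
  rw [← ENNReal.rpow_add_of_nonneg _ _ hl.1 (by linarith [hl.2]), add_sub_cancel, ENNReal.rpow_one]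

lemma zero_mem_wulff {E : Type*} [NormedAddCommGroup E] [InnerProductSpace ℝ E] {g : E → ℝ}
    {R ε : ℝ} (hR : 0 ≤ R) : (0 : E) ∈ wulff R ε g := fun u _ => by
  rw [inner_zero_left]; positivity

variable {d : ℕ} {g : EuclideanSpace ℝ (Fin (d + 1)) → ℝ}

lemma IsBodyWithSupport.eq_wulff {K : Set (EuclideanSpace ℝ (Fin (d + 1)))} {R ε : ℝ}
    (hK : IsBodyWithSupport K fun u => R * Real.exp (ε * g u)) : K = wulff R ε g := by
  rw [hK.eq]
  ext x
  exact ⟨fun h u hu => h ⟨u, by simpa using hu⟩, fun h u => h u (norm_eq_of_mem_sphere u)⟩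

lemma geomAverage_eq_wulff {K₁ K₂ : Set (EuclideanSpace ℝ (Fin (d + 1)))} {R ε₁ ε₂ lam : ℝ}
    (hR : 0 < R) (h₁ : IsBodyWithSupport K₁ fun u => R * Real.exp (ε₁ * g u))
    (h₂ : IsBodyWithSupport K₂ fun u => R * Real.exp (ε₂ * g u)) :
    geomAverage lam K₁ K₂ = wulff R (lam * ε₁ + (1 - lam) * ε₂) g := by
  have h (u : sphere (0 : EuclideanSpace ℝ (Fin (d + 1))) 1) :
      supportFn K₁ u ^ lam * supportFn K₂ u ^ (1 - lam) =
      R * Real.exp ((lam * ε₁ + (1 - lam) * ε₂) * g u) := by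
    rw [h₁.2 u, h₂.2 u, Real.mul_rpow hR.le (Real.exp_pos _).le,
      Real.mul_rpow hR.le (Real.exp_pos _).le, mul_mul_mul_comm, ← Real.rpow_add hR,
      ← Real.exp_mul, ← Real.exp_mul, ← Real.exp_add, add_sub_cancel, Real.rpow_one]
    congr 2
    ring
  ext x
  simp only [geomAverage, h]
  exact ⟨fun h u hu => h ⟨u, by simpa using hu⟩, fun h u => h u (norm_eq_of_mem_sphere u)⟩

variable {G : EuclideanSpace ℝ (Fin (d + 1)) → EuclideanSpace ℝ (Fin (d + 1))} {C : ℝ}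
  {γ : Measure (EuclideanSpace ℝ (Fin (d + 1)))} [IsLocallyFiniteMeasure γ]

lemma IsSphereFunction.measure_wulff_eq_meanRadial (hg : IsSphereFunction g G C)
    (hrot : IsRotationInvariant γ) {e : EuclideanSpace ℝ (Fin (d + 1))} (he : ‖e‖ = 1) {R n : ℝ}
    {p : ℝ → ℝ} (hH : IsRadialProfile (fun t => γ.real (closedBall 0 (R * Real.exp t))) p n)
    (ε : ℝ) : γ (wulff R ε g) =
      ENNReal.ofReal (meanRadial (fun t => γ.real (closedBall 0 (R * Real.exp t))) g e ε) := by
  rw [hg.measure_wulff hrot he, meanRadial, ofReal_integral_eq_lintegral_ofReal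
    (hg.integrable_comp_logRadial hH he ε) (Eventually.of_forall fun T => (hH.pos _).le)]
  refine lintegral_congr fun T => ?_
  rw [ofReal_measureReal (isCompact_closedBall _ _).measure_lt_top.ne]

/-- A rotation invariant log-concave measure is log-concave along the family of bodies with
support function `R * exp (ε * g)`, near `ε = 0`. -/
theorem IsSphereFunction.exists_measure_wulff_log_concave (hg : IsSphereFunction g G C)
    (hrot : IsRotationInvariant γ) (hlog : IsLogConcaveMeasure γ) {R : ℝ} (hR : 0 < R) :
    ∃ a > 0, ∀ ε₁ ∈ Set.Ioo (0 : ℝ) a, ∀ ε₂ ∈ Set.Ioo (0 : ℝ) a, ∀ lam ∈ Set.Icc (0 : ℝ) 1,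
      γ (wulff R ε₁ g) ^ lam * γ (wulff R ε₂ g) ^ (1 - lam) ≤
        γ (wulff R (lam * ε₁ + (1 - lam) * ε₂) g) := by
  by_cases h0 : γ {0} = 0
  swap
  · refine ⟨1, one_pos, fun ε₁ _ ε₂ _ lam hl => ?_⟩
    have h (ε) : γ (wulff R ε g) = γ {0} := by
      refine le_antisymm ?_
        (measure_mono (Set.singleton_subset_iff.2 (zero_mem_wulff hR.le)))
      refine (measure_mono (Set.subset_univ _)).trans ?_
      rw [← Set.union_compl_self {(0 : EuclideanSpace ℝ (Fin (d + 1)))}]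
      refine (measure_union_le _ _).trans ?_
      rw [hlog.measure_compl_zero_eq_zero h0, add_zero]
    rw [h, h, h]
    exact ENNReal.rpow_mul_rpow_one_sub_le hl
  -- The profile must be positive, so the zero measure is set apart.
  by_cases hne : γ = 0
  · refine ⟨1, one_pos, fun ε₁ _ ε₂ _ lam hl => ?_⟩
    rw [hne]
    exact ENNReal.rpow_mul_rpow_one_sub_le (x := 0) hl
  obtain ⟨w, hw0, hw, hwn, hint, hH⟩ := exists_logConcave_radial hlog hrot h0 hR
  obtain ⟨p, hp⟩ := exists_isRadialProfile (n := (d : ℝ) + 1) (by positivity) hw0 hw hwn hint hH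
    fun t => hlog.closedBall_pos hrot hne (by positivity)
  have he : ‖(EuclideanSpace.single 0 1 : EuclideanSpace ℝ (Fin (d + 1)))‖ = 1 := by simp
  obtain ⟨a, ha, h⟩ := hg.exists_meanRadial_log_concave hp (by simp) he
  refine ⟨a, ha, fun ε₁ h₁ ε₂ h₂ lam hl => ?_⟩
  have hmean (ε) : 0 ≤ meanRadial (fun t => γ.real (closedBall 0 (R * Real.exp t))) g
      (EuclideanSpace.single 0 1) ε := integral_nonneg fun T => (hp.pos _).le
  simp only [hg.measure_wulff_eq_meanRadial hrot he hp]
  rw [ENNReal.ofReal_rpow_of_nonneg (hmean _) hl.1,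
    ENNReal.ofReal_rpow_of_nonneg (hmean _) (by linarith [hl.2]),
    ← ENNReal.ofReal_mul (Real.rpow_nonneg (hmean _) _)]
  exact ENNReal.ofReal_le_ofReal (h ε₁ h₁ ε₂ h₂ lam hl)

end WulffMeasure

/-- The log-Brunn-Minkowski inequality near a ball, in the space of dimension `d + 1`; a Radon
measure on a Euclidean space is a locally finite Borel measure, and `φ` is a `C²` function on
the unit sphere, which is a manifold of dimension `d`. -/
theorem theorem1p4 (d : ℕ)
    (γ : Measure (EuclideanSpace ℝ (Fin (d + 1)))) [IsLocallyFiniteMeasure γ]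
    (hrot : IsRotationInvariant γ) (hlog : IsLogConcaveMeasure γ)
    (R : ℝ) (hR : 0 < R)
    (φ : Metric.sphere (0 : EuclideanSpace ℝ (Fin (d + 1))) 1 → ℝ)
    (hφ : ContMDiff (𝓡 d) 𝓘(ℝ, ℝ) 2 φ)
    (heven : ∀ u, φ (-u) = φ u) (hpos : ∀ u, 0 < φ u) :
    ∃ a : ℝ, 0 < a ∧
      (∀ ε ∈ Set.Ioo (0 : ℝ) a, ∃! K : Set (EuclideanSpace ℝ (Fin (d + 1))),
        IsBodyWithSupport K (fun u => R * φ u ^ ε)) ∧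
      ∀ ε₁ ∈ Set.Ioo (0 : ℝ) a, ∀ ε₂ ∈ Set.Ioo (0 : ℝ) a, ∀ lam ∈ Set.Icc (0 : ℝ) 1,
        ∀ K₁ K₂ : Set (EuclideanSpace ℝ (Fin (d + 1))),
          IsBodyWithSupport K₁ (fun u => R * φ u ^ ε₁) →
          IsBodyWithSupport K₂ (fun u => R * φ u ^ ε₂) →
          γ K₁ ^ lam * γ K₂ ^ (1 - lam) ≤ γ (geomAverage lam K₁ K₂) := by
  have hlogφ : ContMDiff (𝓡 d) 𝓘(ℝ, ℝ) 2 fun u => Real.log (φ u) := fun u =>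
    (Real.contDiffAt_log.2 (hpos u).ne').contMDiffAt.comp u (hφ u)
  obtain ⟨g, G, C, hg, hgφ⟩ := exists_isSphereFunction hlogφ fun u => by rw [heven]
  have hsupp (ε : ℝ) : (fun u => R * φ u ^ ε) =
      fun u : Metric.sphere (0 : EuclideanSpace ℝ (Fin (d + 1))) 1 => R * Real.exp (ε * g u) := by
    funext u
    rw [hgφ, Real.rpow_def_of_pos (hpos u), mul_comm ε]
  simp only [hsupp]
  obtain ⟨a, ha, h⟩ := hg.exists_measure_wulff_log_concave hrot hlog hR
  have hC := hg.nonneg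
  -- The second bound gives `2 ε C ≤ 1`, which is needed only for the existence of the bodies.
  refine ⟨min a (1 / (2 * C + 1)), by positivity, fun ε hε => ?_,
    fun ε₁ h₁ ε₂ h₂ lam hl K₁ K₂ hK₁ hK₂ => ?_⟩
  · have hεC : 2 * ε * C ≤ 1 := by
      have h1 := (lt_div_iff₀ (by positivity)).1 (hε.2.trans_le (min_le_right _ _))
      linarith [hε.1]
    exact ⟨wulff R ε g, hg.isBodyWithSupport_wulff hR hε.1.le hεC, fun K hK => hK.eq_wulff⟩
  · rw [geomAverage_eq_wulff hR hK₁ hK₂, hK₁.eq_wulff, hK₂.eq_wulff]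
    exact h ε₁ (Set.Ioo_subset_Ioo_right (min_le_left _ _) h₁) ε₂
      (Set.Ioo_subset_Ioo_right (min_le_left _ _) h₂) lam hl
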